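/- Let $d\ge 2$, let $\Lambda$ be a lattice in $\mathbb{R}^d$ (a discrete subgroup spanning $\mathbb{R}^d$), and let $S$ be a random walk on $\Lambda$, started at $0$, whose increments are independent with a common law $p$ that is symmetric ($p(-x)=p(x)$), finitely supported, has support generating $\Lambda$, and has covariance matrix equal to the identity. Write $B_r=\{x\in\Lambda: |x|<r\}$ (Euclidean norm), $\partial B=\{x\in\Lambda\setminus B:\ p(y-x)>0\text{ for some }y\in B\}$, and, for a process $Y$ and $K\subset\Lambda$, $\sigma_K^Y=\min\{j\ge 1: Y_j\notin K\}$ ($=\infty$ if there is no such $j$); $\sigma_K=\sigma_K^S$. For $l\in\mathbb{N}$ let $\Omega_l$ be the set of paths $\omega=[0,\omega_1,\dots,\omega_k]$ in $\Lambda$ with steps of positive $p$-probability such that $\omega_j\in B_l$ for $0\le j\le k-1$ and $\omega_k\in\partial B_l$. For a finite path $\lambda=[\lambda_0,\dots,\lambda_m]$ let $\mathrm{L}(\lambda)$ be its chronological loop-erasure, that is, $\mathrm{L}(\lambda)=[\lambda_{s_0},\dots,\lambda_{s_r}]$ where $s_0=\max\{j:\lambda_j=\lambda_0\}$, $s_i=\max\{j:\lambda_j=\lambda_{s_{i-1}+1}\}$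 and $r=\min\{i:s_i=m\}$. If $B_l\subset K$ and $\sigma_K<\infty$ a.s., let $\mu_{l,K}(\omega)$, $\omega\in\Omega_l$, be the probability that $\mathrm{L}(S[0,\sigma_K])$, stopped at its first time $\ge 1$ outside $B_l$, equals $\omega$. If $B_l\subset K_1\cap K_2$, $\sigma_{K_i}<\infty$ a.s. for $i=1$ or $i=2$, and $\mathbf{P}(\sigma_{K_1}<\sigma_{K_2})>0$, let $X$ be $S$ conditioned on $\{\sigma_{K_1}<\sigma_{K_2}\}$ and let $\mu_{l,K_1,K_2}(\omega)$ be the probability that $\mathrm{L}(X[0,\sigma^X_{K_1}])$, stopped at its first time $\ge 1$ outside $B_l$, equals $\omega$. Then there is a constant $C<\infty$, depending only on the walk, such that for all $l\in\mathbb{N}$, all real $n\ge 4$, all $K_1,K_2\subset\Lambda$ with $B_{nl}\subset K_1$ and $B_{nl}\subset K_2$ for which $\mu_{l,K_1,K_2}$ is defined, and all $\omega\in\Omega_l$, $$\bigl(1-C\,e(n)\bigr)\,\mu_{l,K_1\cap K_2}(\omega)\ \le\ \mu_{l,K_1,K_2}(\omega)\ \le\ \bigl(1+C\,e(n)\bigr)\,\mu_{l,K_1\cap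 K_2}(\omega),$$ where $e(n)=1/\log n$ if $d=2$ and $e(n)=1/n$ if $d\ge 3$. Moreover, there are $0<C'<\infty$ and $l_0\in\mathbb{N}$, depending only on the walk, such that for all $l\ge l_0$, all $K_1,K_2\subset\Lambda$ with $B_{4l}\subset K_1$ and $B_{4l}\subset K_2$ for which $\mu_{l,K_1,K_2}$ is defined, and all $\omega\in\Omega_l$, $$\frac1{C'}\,\mu_{l,K_1\cap K_2}(\omega)\le \mu_{l,K_1,K_2}(\omega)\le C'\mu_{l,K_1\cap K_2}(\omega).$$ -/

import Mathlib

open MeasureTheory ProbabilityTheory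

namespace LatticeWalk

variable {d : ℕ} {Λ : Submodule ℤ (EuclideanSpace ℝ (Fin d))}

/-- `p` is the step distribution of a symmetric, irreducible random walk on the lattice `Λ`
with bounded increments and covariance matrix equal to the identity. -/
structure IsStepDistribution (p : PMF Λ) : Prop where
  bounded : p.support.Finite
  symmetric : ∀ x : Λ, p (-x) = p x
  irreducible : AddSubgroup.closure p.support = ⊤
  covariance : ∀ i j : Fin d,
    ∑' x : Λ, (p x).toReal * ((x : EuclideanSpace ℝ (Fin d)) i *
      (x : EuclideanSpace ℝ (Fin d)) j) = if i = j then 1 else 0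

/-- The lattice ball `B_r = {x ∈ Λ : |x| < r}` (Euclidean norm). -/
def ball (Λ : Submodule ℤ (EuclideanSpace ℝ (Fin d))) (r : ℝ) : Set Λ :=
  {x | ‖(x : EuclideanSpace ℝ (Fin d))‖ < r}

/-- The outer boundary of `K`: the points outside `K` with a possible step into `K`. -/
def outerBoundary (p : PMF Λ) (K : Set Λ) : Set Λ :=
  {x | x ∉ K ∧ ∃ y ∈ K, 0 < p (y - x)}

/-- `Ω_l`: the paths `[0, ω₁, …, ω_k]` with steps of positive probability, all of whose points
but the last lie in `B_l`, and whose last point lies in the outer boundary of `B_l`. -/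
def pathsToBoundary (p : PMF Λ) (l : ℕ) : Set (List Λ) :=
  {ω | ω.head? = some 0 ∧ ω.IsChain (fun x y => 0 < p (y - x)) ∧
    (∀ x ∈ ω.dropLast, x ∈ ball Λ l) ∧
    ∃ y, ω.getLast? = some y ∧ y ∈ outerBoundary p (ball Λ l)}

/-- The law of the sequence of independent steps with distribution `p`. -/
noncomputable def stepsLaw (p : PMF Λ) : Measure (ℕ → Λ) :=
  Measure.infinitePi (fun _ : ℕ => p.toMeasure)

/-- The random walk started at `0` with steps `X 0, X 1, …`. -/
def walk (X : ℕ → Λ) (j : ℕ) : Λ := ∑ i ∈ Finset.range j, X i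

/-- `σ_K = min {j ≥ 1 : w j ∉ K}`, equal to `⊤` if there is no such `j`. -/
noncomputable def exitTime (K : Set Λ) (w : ℕ → Λ) : ℕ∞ :=
  sInf {t : ℕ∞ | ∃ j : ℕ, 1 ≤ j ∧ w j ∉ K ∧ t = j}

section LoopErasure

variable {α : Type*} [DecidableEq α]

/-- The times `s_i` of the chronological loop-erasure of `[w 0, …, w m]`:
`s_0` is the last time (up to `m`) at which the path is at `w 0`, and `s_{i+1}` is the last time
at which it is at `w (s_i + 1)`. -/
def eraseTime (w : ℕ → α) (m : ℕ) : ℕ → ℕ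
  | 0 => Nat.findGreatest (fun j => w j = w 0) m
  | i + 1 => Nat.findGreatest (fun j => w j = w (eraseTime w m i + 1)) m

/-- The number of steps of the loop-erasure of `[w 0, …, w m]`: the first `i` with `s_i = m`. -/
noncomputable def eraseLength (w : ℕ → α) (m : ℕ) : ℕ := sInf {i | eraseTime w m i = m}

/-- The loop-erasure of `[w 0, …, w m]`, from its start up to its first exit from `B` at a
time `≥ 1`. -/
noncomputable def loopErasedUntilExit (B : Set α) (w : ℕ → α) (m : ℕ) : List α :=
  (List.range (sInf {j | 1 ≤ j ∧ j ≤ eraseLength w m ∧ w (eraseTime w m j) ∉ B} + 1)).map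
    (fun j => w (eraseTime w m j))

end LoopErasure

open Classical in
/-- The event that the loop-erasure of the walk run up to its (finite) exit time from `K`,
stopped at its first exit from `B_l`, is `ω`. -/
def lerwEvent (l : ℕ) (K : Set Λ) (ω : List Λ) : Set (ℕ → Λ) :=
  {X | exitTime K (walk X) < ⊤ ∧
    loopErasedUntilExit (ball Λ l) (walk X) (exitTime K (walk X)).toNat = ω}

/-- The event that the walk leaves `K₁` before `K₂`. -/
def leavesBefore (K₁ K₂ : Set Λ) : Set (ℕ → Λ) :=
  {X | exitTime K₁ (walk X) < exitTime K₂ (walk X)}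

/-- `μ_{l,K}(ω)`. -/
noncomputable def lerwMeasure (p : PMF Λ) (l : ℕ) (K : Set Λ) (ω : List Λ) : ℝ :=
  (stepsLaw p).real (lerwEvent l K ω)

/-- `μ_{l,K₁,K₂}(ω)`: the same for the walk conditioned to leave `K₁` before `K₂`, run up to
its exit time from `K₁`. -/
noncomputable def condLerwMeasure (p : PMF Λ) (l : ℕ) (K₁ K₂ : Set Λ) (ω : List Λ) : ℝ :=
  ((stepsLaw p)[|leavesBefore K₁ K₂]).real (lerwEvent l K₁ ω)

/-- The walk leaves `K₁` or leaves `K₂` in finite time almost surely, and it leaves `K₁` before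
`K₂` with positive probability: this is when `μ_{l,K₁,K₂}` is defined. -/
def Admissible (p : PMF Λ) (K₁ K₂ : Set Λ) : Prop :=
  ((∀ᵐ X ∂stepsLaw p, exitTime K₁ (walk X) < ⊤) ∨
    (∀ᵐ X ∂stepsLaw p, exitTime K₂ (walk X) < ⊤)) ∧
  0 < stepsLaw p (leavesBefore K₁ K₂)

/-- The relative error: `1 / log n` in dimension two and `1 / n` in higher dimensions. -/
noncomputable def errorRate (d : ℕ) (n : ℝ) : ℝ := if d = 2 then 1 / Real.log n else 1 / n

end LatticeWalk

/-!
Put `K = K₁ ∩ K₂` and `A = K₂ \ K₁`. Conditioning on leaving `K₁` before `K₂` is conditioning on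
leaving `K` at a point of `A`. Let `ω = [ω₀, …, ωₖ]`, `η = {ω₀, …, ωₖ₋₁}` and `y = ωₖ`. Cutting the
walk just after its last visit to `ωₖ₋₁` and applying the Markov property shows that the
probability that the loop-erasure begins with `ω` and the walk leaves `K` in `A` is `W * g_A(y)`,
where `g_A(y)` is the probability, for the walk started at `y`, of leaving `K` in `A` before
hitting `η`, and `W` does not depend on `A` (`exists_measure_lerwExitEvent`). Writing `h_A(0)` for
the probability of leaving `K` in `A` from `0`, and `g` for `g_A` with `A` the complement of `K`,
one gets `μ_{l,K₁,K₂}(ω) = W * g_A(y) / h_A(0)` and `μ_{l,K}(ω) = W * g(y)`. It remains to compare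
`g_A(y)` with `h_A(0) * g(y)`: the two events of escaping `η` and of leaving in `A` are nearly
independent.

The comparison is `escape_comparable`. If the walk leaves a ball `D ⊆ K` from all points of `η`
with nearly the same distribution `m`, then starting the walk at a point of `η` where the
probability `h_A` of leaving in `A` is maximal (or minimal) and decomposing it at its first return
to `η` after leaving `D` bounds the `m`-average of `g_A` above and below by `h_A(0)` times a factor
that does not depend on `A`. This carries over to the start `y` if also the exit distribution from
`D` restricted to the walks that avoid `η` is nearly proportional to `m`, from every point of some
sphere between `η` and the boundary of `D`.

* The exit distributions are compared through a Harnack inequality with sharp constants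
  (`exists_harnack`): a nonnegative harmonic function on a ball of radius `n * l` varies by a
  factor `1 + O(1 / n)` on the ball of radius `l`. It is derived from a gradient estimate
  (`exists_gradient_bound`) in the manner of Li and Yau: for `u = w ^ 2` harmonic, the defect `Q =
  1 - avg w / w` satisfies a curvature inequality (`energy_le_avg_energy`), and the maximum
  principle applied to `Q` times a cutoff gives `Q = O(1 / r ^ 2)`.
* For the restricted exit distributions one also needs a lower bound on the probability of escaping
  `η`: it is at least of order `n ^ (-1/2)` in the plane and of order one in higher dimensions, by
  comparison with the functions `‖x‖ ^ (1/2)` and `‖x‖ ^ (-1/2)` (`exists_escape_bound`). The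
  relative errors are thus `O(n ^ (-1/2))` and `O(1 / n)`; in the plane this is even smaller than
  the asserted `O(1 / log n)`.
* For bounded `n` and large `l`, a Harnack inequality on an annulus and comparison with `‖x‖ ^ 2`
  give the comparison up to a constant (`exists_escape_comparable_of_scale`).
* For bounded `n` and bounded `l`, only an upper bound is needed. Either `K` contains a large ball
  and the previous bounds apply, or it misses a point within a bounded distance, and the walk
  reaches this point outside the ball of radius `l` with a probability bounded below, because the
  exterior of a ball is connected (`exists_escape_le_of_missing`).
-/


namespace LatticeWalk

/-! ### The Markov property of the walk -/

section Markov

variable {d : ℕ} {Λ : Submodule ℤ (EuclideanSpace ℝ (Fin d))}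

instance isProbabilityMeasure_stepsLaw (p : PMF Λ) : IsProbabilityMeasure (stepsLaw p) := by
  unfold stepsLaw; infer_instance

/-- The sequence of steps after time `t`. -/
def shift (t : ℕ) (X : ℕ → Λ) : ℕ → Λ := fun i => X (t + i)

/-- The event `F` only depends on the first `t` steps. -/
def DependsOnFirst (t : ℕ) (F : Set (ℕ → Λ)) : Prop :=
  ∀ X Y : ℕ → Λ, (∀ i < t, X i = Y i) → X ∈ F → Y ∈ F

@[simp] lemma walk_zero (X : ℕ → Λ) : walk X 0 = 0 := by simp [walk]

lemma walk_add (X : ℕ → Λ) (t j : ℕ) : walk X (t + j) = walk X t + walk (shift t X) j := by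
  simp [walk, shift, Finset.sum_range_add]

lemma walk_one (X : ℕ → Λ) : walk X 1 = X 0 := by simp [walk]

lemma walk_congr {X Y : ℕ → Λ} {t j : ℕ} (h : ∀ i < t, X i = Y i) (hj : j ≤ t) :
    walk X j = walk Y j :=
  Finset.sum_congr rfl fun i hi => h i ((Finset.mem_range.1 hi).trans_le hj)

lemma DependsOnFirst.exists_preimage {t : ℕ} {F : Set (ℕ → Λ)} (hF : DependsOnFirst t F) :
    F = (fun (X : ℕ → Λ) (i : Fin t) => X i) ⁻¹' ((fun X (i : Fin t) => X i) '' F) := by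
  refine Set.Subset.antisymm (Set.subset_preimage_image _ _) ?_
  rintro Y ⟨X, hX, h⟩
  exact hF X Y (fun i hi => congrFun h ⟨i, hi⟩) hX

lemma measurable_shift (t : ℕ) : Measurable (shift t : (ℕ → Λ) → ℕ → Λ) := by
  unfold shift; fun_prop

variable [DiscreteTopology Λ]

lemma countable_lattice : Countable Λ :=
  TopologicalSpace.separableSpace_iff_countable.1 inferInstance

lemma DependsOnFirst.measurableSet {t : ℕ} {F : Set (ℕ → Λ)} (hF : DependsOnFirst t F) :
    MeasurableSet F := by
  have := countable_lattice (Λ := Λ)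
  rw [hF.exists_preimage]
  exact measurableSet_preimage (by fun_prop) (Set.to_countable _).measurableSet

/-- Markov property: an event of the first `t` steps is independent of the later steps, and these
have the law of the whole sequence. -/
lemma stepsLaw_inter_shift (p : PMF Λ) {t : ℕ} {F B : Set (ℕ → Λ)} (hF : DependsOnFirst t F)
    (hB : MeasurableSet B) :
    stepsLaw p (F ∩ shift t ⁻¹' B) = stepsLaw p F * stepsLaw p B := by
  have := countable_lattice (Λ := Λ)
  have hind : iIndepFun (fun (i : ℕ) (X : ℕ → Λ) => X i) (stepsLaw p) :=
    iIndepFun_infinitePi (X := fun _ x => x) (by fun_prop)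
  have hsh : stepsLaw p (shift t ⁻¹' B) = stepsLaw p B := by
    have h := Measure.map_infinitePi_infinitePi_of_inj (P := fun _ : ℕ => p.toMeasure)
      (f := fun i => t + i) (add_right_injective t)
    rw [← Measure.map_apply (measurable_shift t) hB]
    exact congrArg (fun m : Measure (ℕ → Λ) => m B) h
  rw [← hsh]
  have hdis : Disjoint (Set.Iio t) (Set.Ici t) :=
    Set.disjoint_left.2 fun i hi hi' => absurd (Set.mem_Ici.1 hi') (not_le.2 (Set.mem_Iio.1 hi))
  have key := indep_iSup_of_disjoint
    (m := fun i : ℕ => MeasurableSpace.comap (fun X : ℕ → Λ => X i) inferInstance)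
    (fun i => (measurable_pi_apply i).comap_le) hind hdis
  refine (Indep_iff _ _ _).1 key _ _ ?_ ?_
  · rw [hF.exists_preimage]
    have : Measurable[⨆ i ∈ Set.Iio t,
        MeasurableSpace.comap (fun X : ℕ → Λ => X i) inferInstance]
        (fun (X : ℕ → Λ) (i : Fin t) => X i) := by
      refine @measurable_pi_lambda _ _ _ (_) _ _ fun i => ?_
      refine Measurable.mono (comap_measurable _) ?_ le_rfl
      exact le_iSup₂_of_le (i : ℕ) i.2 le_rfl
    exact this (Set.to_countable _).measurableSet
  · have : Measurable[⨆ i ∈ Set.Ici t,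
        MeasurableSpace.comap (fun X : ℕ → Λ => X i) inferInstance]
        (shift t : (ℕ → Λ) → ℕ → Λ) := by
      refine @measurable_pi_lambda _ _ _ (_) _ _ fun i => ?_
      refine Measurable.mono (comap_measurable _) ?_ le_rfl
      exact le_iSup₂_of_le (t + i) (Set.mem_Ici.2 (Nat.le_add_right t i)) le_rfl
    exact this hB

end Markov

/-! ### Exit distributions -/

section Exit

variable {d : ℕ} {Λ : Submodule ℤ (EuclideanSpace ℝ (Fin d))}

/-- The walk started at `x` with the given steps leaves `D` (at a time `≥ 0`) in finite time, at a
point of `A`. It is meant for `A` disjoint from `D`. -/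
def exitEvent (D A : Set Λ) (x : Λ) : Set (ℕ → Λ) :=
  {X | ∃ j, x + walk X j ∈ A ∧ ∀ i < j, x + walk X i ∈ D}

/-- The probability that the walk started at `x` leaves `D` at a point of `A`. -/
noncomputable def hit (p : PMF Λ) (D A : Set Λ) (x : Λ) : ℝ := (stepsLaw p).real (exitEvent D A x)

/-- The walk started at `x` leaves `D` at time `t`, at the point `v`. -/
def exitAt (D : Set Λ) (x v : Λ) (t : ℕ) : Set (ℕ → Λ) :=
  {X | x + walk X t = v ∧ ∀ i < t, x + walk X i ∈ D}

/-- The one-step averaging operator of the walk. -/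
noncomputable def avg (p : PMF Λ) (f : Λ → ℝ) (x : Λ) : ℝ :=
  ∑' s, (p s).toReal * f (x + s)

lemma dependsOnFirst_exitAt (D : Set Λ) (x v : Λ) (t : ℕ) :
    DependsOnFirst t (exitAt D x v t) := by
  rintro X Y h ⟨h1, h2⟩
  refine ⟨by rw [← walk_congr h le_rfl, h1], fun i hi => ?_⟩
  rw [← walk_congr h hi.le]; exact h2 i hi

lemma exitEvent_eq_iUnion (D A : Set Λ) (x : Λ) :
    exitEvent D A x = ⋃ j, {X | x + walk X j ∈ A ∧ ∀ i < j, x + walk X i ∈ D} := by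
  ext X; simp [exitEvent]

lemma exitEvent_mono {D D' A A' : Set Λ} (hD : D ⊆ D') (hA : A ⊆ A') (x : Λ) :
    exitEvent D A x ⊆ exitEvent D' A' x :=
  fun _ ⟨j, h1, h2⟩ => ⟨j, hA h1, fun i hi => hD (h2 i hi)⟩

lemma pairwise_disjoint_exitAt {D : Set Λ} {v : Λ} (hv : v ∉ D) (x : Λ) :
    Pairwise (Function.onFun Disjoint (exitAt D x v)) := by
  intro s t hst
  rw [Function.onFun, Set.disjoint_left]
  rintro X ⟨h1, h2⟩ ⟨h3, h4⟩
  rcases lt_or_gt_of_ne hst with h | h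
  · exact hv (h1 ▸ h4 s h)
  · exact hv (h3 ▸ h2 t h)

lemma disjoint_exitEvent {D A B : Set Λ} (hA : Disjoint A D) (hB : Disjoint B D)
    (hAB : Disjoint A B) (x : Λ) : Disjoint (exitEvent D A x) (exitEvent D B x) := by
  rw [Set.disjoint_left]
  rintro X ⟨i, h1, h2⟩ ⟨j, h3, h4⟩
  rcases lt_trichotomy i j with h | rfl | h
  · exact Set.disjoint_left.1 hA h1 (h4 i h)
  · exact Set.disjoint_left.1 hAB h1 h3
  · exact Set.disjoint_left.1 hB h3 (h2 j h)

variable (p : PMF Λ)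

lemma hit_nonneg (D A : Set Λ) (x : Λ) : 0 ≤ hit p D A x := measureReal_nonneg

lemma hit_mono {D D' A A' : Set Λ} (hD : D ⊆ D') (hA : A ⊆ A') (x : Λ) :
    hit p D A x ≤ hit p D' A' x := measureReal_mono (exitEvent_mono hD hA x)

lemma hit_of_mem {D A : Set Λ} {x : Λ} (hx : x ∈ A) : hit p D A x = 1 := by
  have : exitEvent D A x = Set.univ :=
    Set.eq_univ_of_forall fun X => ⟨0, by simpa using hx, by simp⟩
  simp [hit, this]

lemma hit_of_notMem {D A : Set Λ} {x : Λ} (hD : x ∉ D) (hA : x ∉ A) : hit p D A x = 0 := by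
  have : exitEvent D A x = ∅ := by
    refine Set.eq_empty_of_forall_notMem fun X ⟨j, h1, h2⟩ => ?_
    rcases Nat.eq_zero_or_pos j with rfl | hj
    · exact hA (by simpa using h1)
    · exact hD (by simpa using h2 0 hj)
  simp [hit, this]

variable [DiscreteTopology Λ]

lemma measurableSet_exitEvent (D A : Set Λ) (x : Λ) : MeasurableSet (exitEvent D A x) := by
  rw [exitEvent_eq_iUnion]
  refine MeasurableSet.iUnion fun j => DependsOnFirst.measurableSet (t := j) ?_
  rintro X Y h ⟨h1, h2⟩
  refine ⟨by rw [← walk_congr h le_rfl]; exact h1, fun i hi => ?_⟩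
  rw [← walk_congr h hi.le]; exact h2 i hi

/-- Strong Markov property at the exit from `D ⊆ D'`. -/
lemma measure_exitEvent_inter {D D' A : Set Λ} (hD : D ⊆ D') (hA : Disjoint A D) {v : Λ}
    (hv : v ∉ D) (x : Λ) :
    (stepsLaw p).real (exitEvent D' A x ∩ exitEvent D {v} x) = hit p D {v} x * hit p D' A v := by
  have h1 : exitEvent D {v} x = ⋃ t, exitAt D x v t := by
    rw [exitEvent_eq_iUnion]; rfl
  have h2 : exitEvent D' A x ∩ exitEvent D {v} x =
      ⋃ t, (exitAt D x v t ∩ shift t ⁻¹' exitEvent D' A v) := by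
    rw [h1]
    ext X
    simp only [Set.mem_inter_iff, Set.mem_iUnion]
    constructor
    · rintro ⟨⟨j, hj, hj'⟩, t, ht, ht'⟩
      have htj : t ≤ j := by
        by_contra! hlt
        exact Set.disjoint_left.1 hA hj (ht' j hlt)
      obtain ⟨k, rfl⟩ := Nat.exists_eq_add_of_le htj
      refine ⟨t, ⟨ht, ht'⟩, k, ?_, fun i hi => ?_⟩
      · rwa [walk_add, ← add_assoc, ht] at hj
      · have := hj' (t + i) (by omega)
        rwa [walk_add, ← add_assoc, ht] at this
    · rintro ⟨t, ⟨ht, ht'⟩, k, hk, hk'⟩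
      refine ⟨⟨t + k, ?_, fun i hi => ?_⟩, t, ht, ht'⟩
      · rwa [walk_add, ← add_assoc, ht]
      · rcases lt_or_ge i t with h | h
        · exact hD (ht' i h)
        · obtain ⟨m, rfl⟩ := Nat.exists_eq_add_of_le h
          rw [walk_add, ← add_assoc, ht]
          exact hk' m (by omega)
  have hdis := pairwise_disjoint_exitAt hv x
  have hm := measurableSet_exitEvent D' A v
  have e2 : stepsLaw p (exitEvent D' A x ∩ exitEvent D {v} x) =
      stepsLaw p (exitEvent D {v} x) * stepsLaw p (exitEvent D' A v) := by
    rw [h2, h1, measure_iUnion, measure_iUnion hdis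
      fun t => (dependsOnFirst_exitAt D x v t).measurableSet, ← ENNReal.tsum_mul_right]
    · exact tsum_congr fun t => stepsLaw_inter_shift p (dependsOnFirst_exitAt D x v t) hm
    · exact fun s t hst => (hdis hst).mono Set.inter_subset_left Set.inter_subset_left
    · exact fun t => (dependsOnFirst_exitAt D x v t).measurableSet.inter (measurable_shift t hm)
  simp only [hit, Measure.real, e2, ENNReal.toReal_mul]

/-- The walk that leaves `K` at a point of `A` either does so without visiting the finite set `η`,
or it first visits `η` at some point `v`, from which it leaves `K` at a point of `A`. -/
lemma hit_eq_hit_sdiff_add (K A : Set Λ) (hA : Disjoint A K) (η : Finset Λ) (hη : ↑η ⊆ K)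
    (x : Λ) :
    hit p K A x = hit p (K \ η) A x + ∑ v ∈ η, hit p (K \ η) {v} x * hit p K A v := by
  have hsub : K \ (η : Set Λ) ⊆ K := Set.sdiff_subset
  have hAη : Disjoint A (K \ η) := hA.mono_right hsub
  have hset : exitEvent K A x = exitEvent (K \ η) A x ∪
      ⋃ v ∈ η, (exitEvent K A x ∩ exitEvent (K \ η) {v} x) := by
    refine Set.Subset.antisymm ?_ (Set.union_subset (exitEvent_mono hsub le_rfl x)
      (Set.iUnion₂_subset fun v _ => Set.inter_subset_left))
    rintro X ⟨j, hj, hj'⟩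
    by_cases hX : ∃ i, i < j ∧ x + walk X i ∈ η
    · classical
      right
      simp only [Set.mem_iUnion]
      refine ⟨x + walk X (Nat.find hX), (Nat.find_spec hX).2, ⟨j, hj, hj'⟩, Nat.find hX, rfl,
        fun i hi => ⟨hj' i (hi.trans (Nat.find_spec hX).1), fun h => ?_⟩⟩
      exact Nat.find_min hX hi ⟨hi.trans (Nat.find_spec hX).1, h⟩
    · push Not at hX
      exact Or.inl ⟨j, hj, fun i hi => ⟨hj' i hi, hX i hi⟩⟩
  have hsing : ∀ v ∈ η, Disjoint {v} (K \ (η : Set Λ)) := fun v hv =>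
    Set.disjoint_singleton_left.2 fun h => h.2 hv
  have hmeas : ∀ v ∈ η, MeasurableSet (exitEvent K A x ∩ exitEvent (K \ η) {v} x) := fun v _ =>
    (measurableSet_exitEvent _ _ _).inter (measurableSet_exitEvent _ _ _)
  conv_lhs => rw [hit, hset]
  rw [measureReal_union _ (Finset.measurableSet_biUnion _ hmeas) (measure_ne_top _ _)
    (measure_ne_top _ _),
    measureReal_biUnion_finset _ hmeas]
  · congr 1
    exact Finset.sum_congr rfl fun v hv =>
      measure_exitEvent_inter p hsub hAη (fun h => h.2 hv) x
  · intro v hv w hw hvw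
    exact (disjoint_exitEvent (hsing v hv) (hsing w hw)
      (Set.disjoint_singleton.2 hvw) x).mono Set.inter_subset_right Set.inter_subset_right
  · refine Set.disjoint_iUnion₂_right.2 fun v hv => ?_
    refine (disjoint_exitEvent hAη (hsing v hv) ?_ x).mono_right Set.inter_subset_right
    exact Set.disjoint_singleton_right.2 fun h => Set.disjoint_left.1 hA h (hη hv)

lemma sum_hit_singleton_le_one (D : Set Λ) (η : Finset Λ) (hη : Disjoint (η : Set Λ) D) (x : Λ) :
    ∑ v ∈ η, hit p D {v} x ≤ 1 := by
  have hsing : ∀ v ∈ η, Disjoint {v} D := fun v hv =>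
    Set.disjoint_singleton_left.2 fun h => Set.disjoint_left.1 hη hv h
  unfold hit
  rw [← measureReal_biUnion_finset _ fun v _ => measurableSet_exitEvent _ _ _]
  · exact measureReal_le_one
  · intro v hv w hw hvw
    exact disjoint_exitEvent (hsing v hv) (hsing w hw) (Set.disjoint_singleton.2 hvw) x

/-- Exit probabilities are harmonic. -/
lemma hit_eq_avg {D A : Set Λ} (hA : Disjoint A D) {x : Λ} (hx : x ∈ D) :
    hit p D A x = avg p (hit p D A) x := by
  have := countable_lattice (Λ := Λ)
  have hset : exitEvent D A x =
      ⋃ s : Λ, ({X | X 0 = s} ∩ shift 1 ⁻¹' exitEvent D A (x + s)) := by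
    ext X
    simp only [Set.mem_iUnion, Set.mem_inter_iff, Set.mem_ofPred_eq]
    have hw : ∀ j, walk X (j + 1) = X 0 + walk (shift 1 X) j := fun j => by
      rw [add_comm, walk_add, walk_one]
    constructor
    · rintro ⟨j, hj, hj'⟩
      rcases j with _ | j
      · exact absurd hx (Set.disjoint_left.1 hA (by simpa using hj))
      · refine ⟨X 0, rfl, j, ?_, fun i hi => ?_⟩
        · rwa [add_assoc, ← hw]
        · rw [add_assoc, ← hw]; exact hj' _ (by omega)
    · rintro ⟨s, hs, j, hj, hj'⟩
      refine ⟨j + 1, by rwa [hw, hs, ← add_assoc], fun i hi => ?_⟩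
      rcases i with _ | i
      · simpa using hx
      · rw [hw, hs, ← add_assoc]; exact hj' i (by omega)
  have hdep : ∀ s : Λ, DependsOnFirst 1 {X : ℕ → Λ | X 0 = s} := fun s X Y h hX =>
    (h 0 one_pos).symm.trans hX
  have hstep : ∀ s : Λ, stepsLaw p {X | X 0 = s} = p s := by
    intro s
    have h := Measure.infinitePi_map_eval (fun _ : ℕ => p.toMeasure) 0
    rw [← PMF.toMeasure_apply_singleton p s (measurableSet_singleton s), ← h,
      Measure.map_apply (measurable_pi_apply 0) (measurableSet_singleton s)]
    rfl
  have hsum : stepsLaw p (exitEvent D A x) =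
      ∑' s, p s * stepsLaw p (exitEvent D A (x + s)) := by
    rw [hset, measure_iUnion]
    · refine tsum_congr fun s => ?_
      rw [stepsLaw_inter_shift p (hdep s) (measurableSet_exitEvent _ _ _), hstep]
    · intro s t hst
      refine Disjoint.mono Set.inter_subset_left Set.inter_subset_left ?_
      exact Set.disjoint_left.2 fun X h1 h2 => hst (h1.symm.trans h2)
    · exact fun s => (hdep s).measurableSet.inter
        (measurable_shift 1 (measurableSet_exitEvent _ _ _))
  rw [hit, Measure.real, hsum, ENNReal.tsum_toReal_eq fun s =>
    ENNReal.mul_ne_top (p.apply_ne_top s) (measure_ne_top _ _)]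
  simp [avg, hit, Measure.real, ENNReal.toReal_mul]

end Exit

end LatticeWalk

namespace LatticeWalk

/-! ### The geometry of the lattice and of the steps -/

section Lattice

variable {d : ℕ} {Λ : Submodule ℤ (EuclideanSpace ℝ (Fin d))}

lemma finite_ball [DiscreteTopology Λ] (r : ℝ) : (ball Λ r).Finite := by
  have h := Metric.finite_isBounded_inter_isClosed (s := (Λ : Set (EuclideanSpace ℝ (Fin d))))
    (K := Metric.ball (0 : EuclideanSpace ℝ (Fin d)) r) ⟨‹_›⟩ Metric.isBounded_ball
    (AddSubgroup.isClosed_of_discrete (H := Λ.toAddSubgroup))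
  refine Set.Finite.of_finite_image (f := ((↑) : Λ → EuclideanSpace ℝ (Fin d)))
    (h.subset ?_) Subtype.val_injective.injOn
  rintro _ ⟨x, hx, rfl⟩
  exact ⟨by simpa [ball] using hx, x.2⟩

/-- Every point of the space is within a bounded distance of the lattice. -/
lemma exists_covering_radius [DiscreteTopology Λ] [IsZLattice ℝ Λ] :
    ∃ ρ : ℝ, 0 < ρ ∧ ∀ x : EuclideanSpace ℝ (Fin d), ∃ a : Λ,
      ‖(a : EuclideanSpace ℝ (Fin d)) - x‖ ≤ ρ := by
  have := ZLattice.module_free ℝ Λ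
  have := ZLattice.module_finite ℝ Λ
  let b := Module.Free.chooseBasis ℤ Λ
  let B := b.ofZLatticeBasis ℝ Λ
  refine ⟨∑ i, ‖B i‖ + 1, by positivity, fun x => ?_⟩
  have hmem : (ZSpan.floor B x : EuclideanSpace ℝ (Fin d)) ∈ Λ :=
    (Module.Basis.ofZLatticeBasis_span ℝ Λ b).le (ZSpan.floor B x).2
  refine ⟨⟨_, hmem⟩, ?_⟩
  have h := ZSpan.norm_fract_le B x
  rw [ZSpan.fract, ← norm_neg, neg_sub] at h
  exact h.trans (by linarith)

/-- `HasWord N z k`: `z` is a sum of at most `k` elements of `N`. -/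
def HasWord (N : Set Λ) (z : Λ) (k : ℕ) : Prop :=
  ∃ L : List Λ, (∀ s ∈ L, s ∈ N) ∧ L.sum = z ∧ L.length ≤ k

lemma HasWord.add {N : Set Λ} {z z' : Λ} {k k' : ℕ} (h : HasWord N z k) (h' : HasWord N z' k') :
    HasWord N (z + z') (k + k') := by
  obtain ⟨L, h1, h2, h3⟩ := h
  obtain ⟨L', h1', h2', h3'⟩ := h'
  refine ⟨L ++ L', fun s hs => ?_, by simp [h2, h2'], by simp; omega⟩
  rcases List.mem_append.1 hs with h | h
  exacts [h1 s h, h1' s h]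

lemma HasWord.zero {N : Set Λ} : HasWord N (0 : Λ) 0 := ⟨[], by simp, by simp, by simp⟩

lemma HasWord.neg {N : Set Λ} (hN : ∀ s ∈ N, -s ∈ N) {z : Λ} {k : ℕ} (h : HasWord N z k) :
    HasWord N (-z) k := by
  obtain ⟨L, h1, h2, h3⟩ := h
  refine ⟨L.map Neg.neg, fun s hs => ?_, ?_, by simpa using h3⟩
  · obtain ⟨t, ht, rfl⟩ := List.mem_map.1 hs
    exact hN t (h1 t ht)
  · rw [← h2, List.sum_neg]

lemma HasWord.nsmul {N : Set Λ} {z : Λ} {k : ℕ} (h : HasWord N z k) (n : ℕ) :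
    HasWord N (n • z) (n * k) := by
  induction n with
  | zero => simpa using HasWord.zero
  | succ n ih => simpa [succ_nsmul, add_mul] using ih.add h

lemma HasWord.zsmul {N : Set Λ} (hN : ∀ s ∈ N, -s ∈ N) {z : Λ} {k : ℕ} (h : HasWord N z k)
    (n : ℤ) : HasWord N (n • z) (n.natAbs * k) := by
  obtain ⟨m, rfl | rfl⟩ := n.eq_nat_or_neg
  · simpa using h.nsmul m
  · simpa using (h.nsmul m).neg hN

lemma HasWord.sum {N : Set Λ} {ι : Type*} (t : Finset ι) (z : ι → Λ) (k : ι → ℕ)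
    (h : ∀ i, HasWord N (z i) (k i)) : HasWord N (∑ i ∈ t, z i) (∑ i ∈ t, k i) := by
  classical
  induction t using Finset.induction_on with
  | empty => simpa using HasWord.zero
  | insert a t ha ih => rw [Finset.sum_insert ha, Finset.sum_insert ha]; exact (h a).add ih

/-- A finite symmetric generating set has word length at most proportional to the norm. -/
lemma exists_hasWord [DiscreteTopology Λ] [IsZLattice ℝ Λ] {N : Set Λ} (hN : ∀ s ∈ N, -s ∈ N)
    (hgen : AddSubgroup.closure N = ⊤) :
    ∃ C : ℝ, 1 ≤ C ∧ ∀ z : Λ, ∃ k : ℕ, HasWord N z k ∧ (k : ℝ) ≤ C * ‖z‖ := by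
  have hex : ∀ z : Λ, ∃ k, HasWord N z k := by
    intro z
    have hz : z ∈ AddSubgroup.closure N := by rw [hgen]; trivial
    induction hz using AddSubgroup.closure_induction with
    | mem x hx => exact ⟨1, [x], by simpa using hx, by simp, by simp⟩
    | zero => exact ⟨0, HasWord.zero⟩
    | add x y _ _ hx hy =>
      obtain ⟨k, hk⟩ := hx
      obtain ⟨k', hk'⟩ := hy
      exact ⟨_, hk.add hk'⟩
    | neg x _ hx =>
      obtain ⟨k, hk⟩ := hx
      exact ⟨_, hk.neg hN⟩
  choose len hlen using hex
  have := ZLattice.module_free ℝ Λ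
  have := ZLattice.module_finite ℝ Λ
  let b := Module.Free.chooseBasis ℤ Λ
  let B := b.ofZLatticeBasis ℝ Λ
  let T : EuclideanSpace ℝ (Fin d) →L[ℝ] (Module.Free.ChooseBasisIndex ℤ Λ → ℝ) :=
    B.equivFunL.toContinuousLinearMap
  refine ⟨‖T‖ * ∑ i, (len (b i) : ℝ) + 1, ?_, fun z => ?_⟩
  · have : 0 ≤ ‖T‖ * ∑ i, (len (b i) : ℝ) := by positivity
    linarith
  · refine ⟨∑ i, (b.repr z i).natAbs * len (b i), ?_, ?_⟩
    · have h := HasWord.sum Finset.univ (fun i => b.repr z i • b i)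
        (fun i => (b.repr z i).natAbs * len (b i)) fun i => (hlen (b i)).zsmul hN _
      rwa [b.sum_repr] at h
    · have hco : ∀ i, ((b.repr z i).natAbs : ℝ) ≤
          ‖T‖ * ‖z‖ := by
        intro i
        have h1 : T (z : EuclideanSpace ℝ (Fin d)) i = (b.repr z i : ℝ) :=
          Module.Basis.ofZLatticeBasis_repr_apply ℝ Λ b z i
        have h2 := T.le_opNorm (z : EuclideanSpace ℝ (Fin d))
        have h3 := norm_le_pi_norm (T (z : EuclideanSpace ℝ (Fin d))) i
        rw [h1, Real.norm_eq_abs] at h3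
        rw [Nat.cast_natAbs, Int.cast_abs]
        exact h3.trans h2
      push_cast
      calc ∑ i, ((b.repr z i).natAbs : ℝ) * len (b i)
          ≤ ∑ i, (‖T‖ * ‖z‖) * len (b i) := by
            gcongr with i; exact hco i
        _ = (‖T‖ * ∑ i, (len (b i) : ℝ)) * ‖z‖ := by
            rw [← Finset.mul_sum]; ring
        _ ≤ _ := by gcongr; linarith

end Lattice

section Steps

variable {d : ℕ} {Λ : Submodule ℤ (EuclideanSpace ℝ (Fin d))} {p : PMF Λ}

namespace IsStepDistribution

/-- The finite set of possible steps. -/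
noncomputable def steps (hp : IsStepDistribution p) : Finset Λ := hp.bounded.toFinset

variable (hp : IsStepDistribution p)
include hp

lemma mem_steps {s : Λ} : s ∈ hp.steps ↔ p s ≠ 0 := by
  simp [steps]

lemma mem_steps_iff_pos {s : Λ} : s ∈ hp.steps ↔ 0 < p s := by
  rw [hp.mem_steps, pos_iff_ne_zero]

lemma neg_mem_steps {s : Λ} (h : s ∈ hp.steps) : -s ∈ hp.steps := by
  rw [hp.mem_steps] at h ⊢
  rwa [hp.symmetric]

lemma tsum_eq_sum_steps (f : Λ → ℝ) :
    ∑' s, (p s).toReal * f s = ∑ s ∈ hp.steps, (p s).toReal * f s := by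
  refine tsum_eq_sum fun s hs => ?_
  rw [hp.mem_steps, not_not] at hs
  simp [hs]

lemma avg_eq_sum (f : Λ → ℝ) (x : Λ) :
    avg p f x = ∑ s ∈ hp.steps, (p s).toReal * f (x + s) :=
  hp.tsum_eq_sum_steps fun s => f (x + s)

lemma sum_steps : ∑ s ∈ hp.steps, (p s).toReal = 1 := by
  have h := hp.tsum_eq_sum_steps fun _ => 1
  simp only [mul_one] at h
  rw [← h, ← ENNReal.tsum_toReal_eq fun s => p.apply_ne_top s, p.tsum_coe, ENNReal.toReal_one]

lemma sum_steps_neg (f : Λ → ℝ) :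
    ∑ s ∈ hp.steps, (p s).toReal * f (-s) = ∑ s ∈ hp.steps, (p s).toReal * f s := by
  refine Finset.sum_nbij' (fun s => -s) (fun s => -s) (fun s hs => hp.neg_mem_steps hs)
    (fun s hs => hp.neg_mem_steps hs) (by simp) (by simp) fun s _ => ?_
  rw [hp.symmetric]

lemma toReal_pos {s : Λ} (hs : s ∈ hp.steps) : 0 < (p s).toReal :=
  ENNReal.toReal_pos (hp.mem_steps.1 hs) (p.apply_ne_top s)

lemma sum_inner (x : EuclideanSpace ℝ (Fin d)) :
    ∑ s ∈ hp.steps, (p s).toReal * inner ℝ x (s : EuclideanSpace ℝ (Fin d)) = 0 := by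
  have h := hp.sum_steps_neg fun s => inner ℝ x (s : EuclideanSpace ℝ (Fin d))
  simp only [Submodule.coe_neg, inner_neg_right, mul_neg, Finset.sum_neg_distrib] at h
  linarith

lemma sum_norm_sq : ∑ s ∈ hp.steps, (p s).toReal * ‖s‖ ^ 2 = d := by
  have h : ∀ s : Λ, (p s).toReal * ‖s‖ ^ 2 = ∑ i : Fin d, (p s).toReal *
      ((s : EuclideanSpace ℝ (Fin d)) i * (s : EuclideanSpace ℝ (Fin d)) i) := fun s => by
    rw [← Finset.mul_sum]
    congr 1
    exact (EuclideanSpace.norm_sq_eq (s : EuclideanSpace ℝ (Fin d))).trans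
      (Finset.sum_congr rfl fun i _ => by rw [Real.norm_eq_abs, sq_abs, sq])
  simp_rw [h]
  rw [Finset.sum_comm]
  calc _ = ∑ i : Fin d, (1 : ℝ) := Finset.sum_congr rfl fun i _ => by
        rw [← hp.tsum_eq_sum_steps, hp.covariance]; simp
    _ = d := by simp

lemma sum_inner_sq (x : EuclideanSpace ℝ (Fin d)) :
    ∑ s ∈ hp.steps, (p s).toReal * inner ℝ x (s : EuclideanSpace ℝ (Fin d)) ^ 2 = ‖x‖ ^ 2 := by
  have h : ∀ s : Λ, (p s).toReal * inner ℝ x (s : EuclideanSpace ℝ (Fin d)) ^ 2 =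
      ∑ i : Fin d, ∑ j : Fin d, x i * x j * ((p s).toReal *
      ((s : EuclideanSpace ℝ (Fin d)) i * (s : EuclideanSpace ℝ (Fin d)) j)) := fun s => by
    rw [EuclideanSpace.inner_eq_star_dotProduct, dotProduct, sq, Finset.sum_mul_sum,
      Finset.mul_sum]
    refine Finset.sum_congr rfl fun i _ => ?_
    rw [Finset.mul_sum]
    refine Finset.sum_congr rfl fun j _ => ?_
    simp
    ring
  simp_rw [h]
  rw [Finset.sum_comm, EuclideanSpace.norm_sq_eq]
  refine Finset.sum_congr rfl fun i _ => ?_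
  rw [Finset.sum_comm]
  simp_rw [← Finset.mul_sum, ← hp.tsum_eq_sum_steps, hp.covariance]
  simp [sq]

lemma exists_bound : ∃ R : ℝ, 1 ≤ R ∧ ∀ s ∈ hp.steps, ‖s‖ ≤ R := by
  obtain ⟨R, hR⟩ := (hp.steps.image fun s => ‖s‖).bddAbove
  refine ⟨max R 1, le_max_right _ _, fun s hs => le_max_of_le_left (hR ?_)⟩
  exact Finset.mem_coe.2 (Finset.mem_image_of_mem _ hs)

lemma exists_lower_bound : ∃ c : ℝ, 0 < c ∧ c ≤ 1 ∧ ∀ s ∈ hp.steps, c ≤ (p s).toReal := by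
  have hne : hp.steps.Nonempty := by
    by_contra h
    have := hp.sum_steps
    rw [Finset.not_nonempty_iff_eq_empty.1 h] at this
    simp at this
  obtain ⟨s, hs, hmin⟩ := hp.steps.exists_min_image (fun s => (p s).toReal) hne
  refine ⟨_, hp.toReal_pos hs, ?_, hmin⟩
  exact ENNReal.toReal_le_of_le_ofReal zero_le_one (by simpa using p.coe_le_one s)

omit hp in
lemma norm_add_sq_coe (x s : Λ) : ‖x + s‖ ^ 2 =
    ‖x‖ ^ 2 + (2 * inner ℝ (x : EuclideanSpace ℝ (Fin d)) (s : EuclideanSpace ℝ (Fin d)) +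
      ‖s‖ ^ 2) := by
  have := norm_add_sq_real (x : EuclideanSpace ℝ (Fin d)) (s : EuclideanSpace ℝ (Fin d))
  change ‖(x + s : EuclideanSpace ℝ (Fin d))‖ ^ 2 = _
  rw [this]
  simp only [Submodule.coe_norm]
  ring

lemma avg_norm_sq (x : Λ) : avg p (fun y => ‖y‖ ^ 2) x = ‖x‖ ^ 2 + d := by
  rw [hp.avg_eq_sum]
  simp_rw [norm_add_sq_coe, mul_add, Finset.sum_add_distrib, ← Finset.sum_mul, hp.sum_steps,
    hp.sum_norm_sq]
  have := hp.sum_inner (x : EuclideanSpace ℝ (Fin d))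
  have h2 : ∑ s ∈ hp.steps, (p s).toReal * (2 * inner ℝ (x : EuclideanSpace ℝ (Fin d))
      (s : EuclideanSpace ℝ (Fin d))) = 0 := by
    rw [← mul_zero (2 : ℝ), ← this, Finset.mul_sum]
    exact Finset.sum_congr rfl fun s _ => by ring
  rw [h2]
  ring

/-- Some step increases the norm. -/
lemma exists_norm_lt (hd : 0 < d) (x : Λ) : ∃ s ∈ hp.steps, ‖x‖ < ‖x + s‖ := by
  by_contra! h
  have h1 := hp.avg_norm_sq x
  rw [hp.avg_eq_sum] at h1
  have h2 : ∑ s ∈ hp.steps, (p s).toReal * ‖x + s‖ ^ 2 ≤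
      ∑ s ∈ hp.steps, (p s).toReal * ‖x‖ ^ 2 := by
    gcongr with s hs
    exact h s hs
  rw [← Finset.sum_mul, hp.sum_steps] at h2
  have : (0 : ℝ) < d := by exact_mod_cast hd
  linarith

/-- The maximum principle on a finite set. -/
lemma nonpos_of_subharmonic (hd : 0 < d) {D : Set Λ} (hD : D.Finite) {u : Λ → ℝ}
    (hu : ∀ x ∈ D, u x ≤ avg p u x)
    (hb : ∀ x ∈ D, ∀ s ∈ hp.steps, x + s ∉ D → u (x + s) ≤ 0) : ∀ x ∈ D, u x ≤ 0 := by
  by_contra! hcon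
  obtain ⟨x₁, hx₁, hpos⟩ := hcon
  obtain ⟨x₀, hx₀, hmax⟩ := D.exists_max_image u hD ⟨x₁, hx₁⟩
  have hM : 0 < u x₀ := hpos.trans_le (hmax x₁ hx₁)
  -- among the maximizers, the one of largest norm has a neighbour where `u` is smaller
  obtain ⟨y, ⟨hy, hyM⟩, hymax⟩ := (D ∩ {x | u x = u x₀}).exists_max_image (fun x => ‖x‖)
    (hD.inter_of_left _) ⟨x₀, hx₀, rfl⟩
  have hyM : u y = u x₀ := hyM
  obtain ⟨s, hs, hlt⟩ := hp.exists_norm_lt hd y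
  have hle : ∀ t ∈ hp.steps, u (y + t) ≤ u x₀ := fun t ht => by
    by_cases h : y + t ∈ D
    · exact hmax _ h
    · exact (hb y hy t ht h).trans hM.le
  have hslt : u (y + s) < u x₀ := by
    by_cases h : y + s ∈ D
    · refine lt_of_le_of_ne (hmax _ h) fun he => ?_
      exact absurd (hymax _ ⟨h, he⟩) (not_le.2 hlt)
    · exact (hb y hy s hs h).trans_lt hM
  have h1 := hu y hy
  rw [hp.avg_eq_sum, hyM] at h1
  have h2 : ∑ t ∈ hp.steps, (p t).toReal * u (y + t) < ∑ t ∈ hp.steps, (p t).toReal * u x₀ := by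
    refine Finset.sum_lt_sum (fun t ht => ?_) ⟨s, hs, ?_⟩
    · exact mul_le_mul_of_nonneg_left (hle t ht) ENNReal.toReal_nonneg
    · exact mul_lt_mul_of_pos_left hslt (hp.toReal_pos hs)
  rw [← Finset.sum_mul, hp.sum_steps] at h2
  linarith

end IsStepDistribution

end Steps

end LatticeWalk

namespace LatticeWalk

/-! ### A gradient estimate for positive harmonic functions -/

section Gradient

variable {d : ℕ} {Λ : Submodule ℤ (EuclideanSpace ℝ (Fin d))} {p : PMF Λ}

/-- The exact deficit in the Cauchy–Schwarz inequality for normalized functions. -/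
lemma cauchySchwarz_deficit {ι : Type*} (N : Finset ι) (q α β : ι → ℝ) {A B : ℝ} (hA : A ≠ 0)
    (hB : B ≠ 0) (hα : ∑ t ∈ N, q t * α t ^ 2 = A ^ 2) (hβ : ∑ t ∈ N, q t * β t ^ 2 = B ^ 2) :
    A * B - ∑ t ∈ N, q t * (α t * β t) =
      1 / 2 * (A * B) * ∑ t ∈ N, q t * (α t / A - β t / B) ^ 2 := by
  have h : ∀ t, q t * (α t / A - β t / B) ^ 2 =
      (1 / A ^ 2) * (q t * α t ^ 2) + (1 / B ^ 2) * (q t * β t ^ 2) -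
        2 / (A * B) * (q t * (α t * β t)) := fun t => by
    field_simp
    ring
  simp_rw [h, Finset.sum_sub_distrib, Finset.sum_add_distrib, ← Finset.mul_sum, hα, hβ]
  field_simp
  ring

/-- The defect `1 - (avg w) / w`. For `w = √u` with `u` harmonic, it is the carré du champ of `√u`
divided by `u`. -/
noncomputable def defect (p : PMF Λ) (w : Λ → ℝ) (x : Λ) : ℝ := 1 - avg p w x / w x

namespace IsStepDistribution

variable (hp : IsStepDistribution p)
include hp

lemma sum_ratio_sq {w : Λ → ℝ} {x : Λ} (hw : 0 < w x)
    (hx : avg p (fun z => w z ^ 2) x = w x ^ 2) :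
    ∑ s ∈ hp.steps, (p s).toReal * (w (x + s) / w x) ^ 2 = 1 := by
  rw [hp.avg_eq_sum] at hx
  simp_rw [div_pow, ← mul_div_assoc]
  rw [← Finset.sum_div, hx, div_self (by positivity)]

lemma defect_eq (w : Λ → ℝ) (x : Λ) :
    defect p w x = 1 - ∑ s ∈ hp.steps, (p s).toReal * (w (x + s) / w x) := by
  simp_rw [defect, hp.avg_eq_sum, ← mul_div_assoc]
  rw [Finset.sum_div]

lemma sum_ratio_sub_one_sq {w : Λ → ℝ} {x : Λ} (hw : 0 < w x)
    (hx : avg p (fun z => w z ^ 2) x = w x ^ 2) :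
    ∑ s ∈ hp.steps, (p s).toReal * (w (x + s) / w x - 1) ^ 2 = 2 * defect p w x := by
  have h : ∀ s, (p s).toReal * (w (x + s) / w x - 1) ^ 2 =
      (p s).toReal * (w (x + s) / w x) ^ 2 - 2 * ((p s).toReal * (w (x + s) / w x)) +
        (p s).toReal := fun s => by ring
  simp_rw [h, Finset.sum_add_distrib, Finset.sum_sub_distrib, ← Finset.mul_sum,
    hp.sum_ratio_sq hw hx, hp.defect_eq, hp.sum_steps]
  ring

lemma defect_nonneg {w : Λ → ℝ} {x : Λ} (hw : 0 < w x)
    (hx : avg p (fun z => w z ^ 2) x = w x ^ 2) : 0 ≤ defect p w x := by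
  have h := hp.sum_ratio_sub_one_sq hw hx
  have : 0 ≤ ∑ s ∈ hp.steps, (p s).toReal * (w (x + s) / w x - 1) ^ 2 :=
    Finset.sum_nonneg fun s _ => by positivity
  linarith

lemma defect_le_one {w : Λ → ℝ} (hw : ∀ x, 0 < w x) (x : Λ) : defect p w x ≤ 1 := by
  rw [hp.defect_eq]
  have : 0 ≤ ∑ s ∈ hp.steps, (p s).toReal * (w (x + s) / w x) :=
    Finset.sum_nonneg fun s _ => mul_nonneg ENNReal.toReal_nonneg (div_pos (hw _) (hw _)).le
  linarith

lemma sq_sum_le_sum_sq (f : Λ → ℝ) :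
    (∑ s ∈ hp.steps, (p s).toReal * f s) ^ 2 ≤ ∑ s ∈ hp.steps, (p s).toReal * f s ^ 2 := by
  have h : 0 ≤ ∑ s ∈ hp.steps, (p s).toReal *
      (f s - ∑ t ∈ hp.steps, (p t).toReal * f t) ^ 2 :=
    Finset.sum_nonneg fun s _ => mul_nonneg ENNReal.toReal_nonneg (sq_nonneg _)
  set m := ∑ t ∈ hp.steps, (p t).toReal * f t with hm
  have h1 : ∀ s, (p s).toReal * (f s - m) ^ 2 =
      (p s).toReal * f s ^ 2 - 2 * m * ((p s).toReal * f s) + m ^ 2 * (p s).toReal :=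
    fun s => by ring
  simp_rw [h1, Finset.sum_add_distrib, Finset.sum_sub_distrib, ← Finset.mul_sum, ← hm,
    hp.sum_steps] at h
  linarith

/-- The curvature inequality: if `u = w ^ 2` is harmonic, then the energy density
`E = u * defect w` satisfies `E + c * E ^ 2 / u ≤ avg E`. -/
lemma energy_le_avg_energy {c₀ : ℝ} (hc₀ : 0 < c₀) (hc₁ : c₀ ≤ 1)
    (hc : ∀ s ∈ hp.steps, c₀ ≤ (p s).toReal) {w : Λ → ℝ} (hw : ∀ x, 0 < w x) {x : Λ}
    (hx : avg p (fun z => w z ^ 2) x = w x ^ 2)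
    (hxs : ∀ s ∈ hp.steps, avg p (fun z => w z ^ 2) (x + s) = w (x + s) ^ 2) :
    w x ^ 2 * defect p w x + c₀ ^ 2 / 2 * (w x ^ 2 * defect p w x ^ 2) ≤
      avg p (fun z => w z ^ 2 * defect p w z) x := by
  set N := hp.steps
  set q : Λ → ℝ := fun s => (p s).toReal
  have hq : ∀ s, 0 ≤ q s := fun s => ENNReal.toReal_nonneg
  set a : Λ → ℝ := fun s => w (x + s) / w x
  have ha : ∀ s, 0 < a s := fun s => div_pos (hw _) (hw _)
  have hE : ∀ z, w z ^ 2 * defect p w z = w z ^ 2 - w z * avg p w z := fun z => by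
    have := (hw z).ne'
    rw [defect]; field_simp
  -- the increment of the energy is a sum of Cauchy–Schwarz deficits
  have hdiff : avg p (fun z => w z ^ 2 * defect p w z) x - w x ^ 2 * defect p w x =
      ∑ s ∈ N, q s * (w x * w (x + s) - ∑ t ∈ N, q t * (w (x + t) * w (x + s + t))) := by
    simp_rw [hE]
    have h1 : avg p (fun z => w z ^ 2 - w z * avg p w z) x =
        w x ^ 2 - ∑ t ∈ N, q t * (w (x + t) * avg p w (x + t)) := by
      rw [← hx, hp.avg_eq_sum, hp.avg_eq_sum, ← Finset.sum_sub_distrib]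
      exact Finset.sum_congr rfl fun s _ => by ring
    have h2 : ∑ t ∈ N, q t * (w (x + t) * avg p w (x + t)) =
        ∑ s ∈ N, q s * ∑ t ∈ N, q t * (w (x + t) * w (x + s + t)) := by
      simp_rw [hp.avg_eq_sum, Finset.mul_sum]
      rw [Finset.sum_comm]
      refine Finset.sum_congr rfl fun s _ => Finset.sum_congr rfl fun t _ => ?_
      rw [add_right_comm x t s]
      ring
    rw [h1, h2, hp.avg_eq_sum w x]
    simp_rw [mul_sub, Finset.sum_sub_distrib]
    rw [Finset.mul_sum]
    have h3 : ∑ s ∈ N, w x * ((p s).toReal * w (x + s)) = ∑ s ∈ N, q s * (w x * w (x + s)) :=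
      Finset.sum_congr rfl fun s _ => by ring
    rw [h3]
    ring
  have hdef : ∀ s ∈ N, w x ^ 2 * (c₀ ^ 2 / 2) * (1 - a s * a (-s)) ^ 2 ≤
      w x * w (x + s) - ∑ t ∈ N, q t * (w (x + t) * w (x + s + t)) := by
    intro s hs
    have hx' := hx
    have hxs' := hxs s hs
    rw [hp.avg_eq_sum] at hx' hxs'
    rw [cauchySchwarz_deficit N q (fun t => w (x + t)) (fun t => w (x + s + t)) (hw x).ne'
      (hw _).ne' hx' hxs']
    -- only the term of the step `-s` is kept
    have h1 : q (-s) * (w (x + -s) / w x - w (x + s + -s) / w (x + s)) ^ 2 ≤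
        ∑ t ∈ N, q t * (w (x + t) / w x - w (x + s + t) / w (x + s)) ^ 2 :=
      Finset.single_le_sum (f := fun t => q t * (w (x + t) / w x - w (x + s + t) / w (x + s)) ^ 2)
        (fun t _ => mul_nonneg (hq t) (sq_nonneg _)) (hp.neg_mem_steps hs)
    rw [add_neg_cancel_right] at h1
    have h2 : q (-s) = q s := by simp only [q, hp.symmetric]
    have h3 : c₀ * a s ≤ 1 := by
      have h4 : q s * a s ^ 2 ≤ 1 := by
        rw [← hp.sum_ratio_sq (hw x) hx]
        exact Finset.single_le_sum (f := fun t => q t * a t ^ 2)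
          (fun t _ => mul_nonneg (hq t) (sq_nonneg _)) hs
      have h5 : (c₀ * a s) ^ 2 ≤ 1 := by
        calc (c₀ * a s) ^ 2 = c₀ * (c₀ * a s ^ 2) := by ring
          _ ≤ 1 * (q s * a s ^ 2) := by
            have := hc s hs
            gcongr
          _ ≤ 1 := by linarith
      nlinarith [mul_pos hc₀ (ha s)]
    calc w x ^ 2 * (c₀ ^ 2 / 2) * (1 - a s * a (-s)) ^ 2
        = 1 / 2 * w x ^ 2 * a s * (c₀ * ((c₀ * a s) * (a (-s) - 1 / a s) ^ 2)) := by
          have := (ha s).ne'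
          field_simp
          ring
      _ ≤ 1 / 2 * w x ^ 2 * a s * (q s * (1 * (a (-s) - 1 / a s) ^ 2)) := by
          have := hc s hs
          have := (ha s).le
          gcongr
      _ = 1 / 2 * (w x * w (x + s)) * (q (-s) * (w (x + -s) / w x - w x / w (x + s)) ^ 2) := by
          have := (hw x).ne'
          have := (hw (x + s)).ne'
          rw [h2]
          simp only [a]
          field_simp
      _ ≤ _ := by
          have := (hw x).le
          have := (hw (x + s)).le
          gcongr
  have hQ0 := hp.defect_nonneg (hw x) hx
  -- Jensen's inequality for the positive parts of `1 - (a s + a (-s)) / 2`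
  have hJ : defect p w x ^ 2 ≤ ∑ s ∈ N, q s * (1 - a s * a (-s)) ^ 2 := by
    set z : Λ → ℝ := fun s => max 0 (1 - (a s + a (-s)) / 2)
    have hz : defect p w x ≤ ∑ s ∈ N, q s * z s := by
      calc defect p w x = ∑ s ∈ N, q s * (1 - (a s + a (-s)) / 2) := by
            have h6 : ∀ s, q s * (1 - (a s + a (-s)) / 2) =
              q s - 1 / 2 * (q s * a s) - 1 / 2 * (q s * a (-s)) := fun s => by ring
            simp_rw [h6, Finset.sum_sub_distrib, ← Finset.mul_sum]
            have h7 := hp.sum_steps_neg a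
            have h8 := hp.sum_steps
            rw [hp.defect_eq]
            simp only [q, N, a] at h7 h8 ⊢
            rw [h7, h8]
            ring
        _ ≤ _ := by
            gcongr with s hs
            exact le_max_right _ _
    have hz2 : (∑ s ∈ N, q s * z s) ^ 2 ≤ ∑ s ∈ N, q s * z s ^ 2 :=
      hp.sq_sum_le_sum_sq z
    calc defect p w x ^ 2 ≤ (∑ s ∈ N, q s * z s) ^ 2 := by gcongr
      _ ≤ ∑ s ∈ N, q s * z s ^ 2 := hz2
      _ ≤ _ := by
        refine Finset.sum_le_sum fun s _ => mul_le_mul_of_nonneg_left ?_ (hq s)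
        have h1 := ha s
        have h2 := ha (-s)
        rw [sq_le_sq]
        rcases le_total (1 - (a s + a (-s)) / 2) 0 with h | h
        · simp [z, max_eq_left h]
        · simp only [z, max_eq_right h, abs_of_nonneg h]
          refine le_trans ?_ (le_abs_self _)
          nlinarith [sq_nonneg (a s - a (-s))]
  have hfin : ∑ s ∈ N, q s * (w x ^ 2 * (c₀ ^ 2 / 2) * (1 - a s * a (-s)) ^ 2) ≤
      avg p (fun z => w z ^ 2 * defect p w z) x - w x ^ 2 * defect p w x := by
    rw [hdiff]
    gcongr with s hs
    exact hdef s hs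
  have hre : ∑ s ∈ N, q s * (w x ^ 2 * (c₀ ^ 2 / 2) * (1 - a s * a (-s)) ^ 2) =
      w x ^ 2 * (c₀ ^ 2 / 2) * ∑ s ∈ N, q s * (1 - a s * a (-s)) ^ 2 := by
    rw [Finset.mul_sum]
    exact Finset.sum_congr rfl fun s _ => by ring
  have : w x ^ 2 * (c₀ ^ 2 / 2) * defect p w x ^ 2 ≤
      w x ^ 2 * (c₀ ^ 2 / 2) * ∑ s ∈ N, q s * (1 - a s * a (-s)) ^ 2 := by gcongr
  rw [hre] at hfin
  linarith

end IsStepDistribution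

end Gradient

end LatticeWalk

namespace LatticeWalk

/-! ### The Harnack inequality -/

section Harnack

variable {d : ℕ} {Λ : Submodule ℤ (EuclideanSpace ℝ (Fin d))} {p : PMF Λ}

lemma inv_one_add_sq_le {z : ℝ} (hz : |z| ≤ 3 / 8) : 1 / (1 + z) ^ 2 ≤ 1 - 2 * z + 10 * z ^ 2 := by
  obtain ⟨h1, h2⟩ := abs_le.1 hz
  rw [div_le_iff₀ (by nlinarith)]
  have : (1 - 2 * z + 10 * z ^ 2) * (1 + z) ^ 2 = 1 + z ^ 2 * (7 + 18 * z + 10 * z ^ 2) := by ring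
  rw [this]
  nlinarith [mul_nonneg (sq_nonneg z) (by nlinarith : 0 ≤ 7 + 18 * z + 10 * z ^ 2)]

namespace IsStepDistribution

variable (hp : IsStepDistribution p)
include hp

/-- At a maximum point `x` of `ψ ^ 2 * defect w`, with the cutoff `ψ = 1 - ‖·‖ ^ 2 / r ^ 2`, the
value is at most of order `1 / r ^ 2`. -/
lemma cutoff_mul_defect_le {c₀ R r : ℝ} (hc₀ : 0 < c₀) (hc₁ : c₀ ≤ 1)
    (hc : ∀ s ∈ hp.steps, c₀ ≤ (p s).toReal) (hR : 1 ≤ R) (hsR : ∀ s ∈ hp.steps, ‖s‖ ≤ R)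
    (hr : R ≤ r) {w : Λ → ℝ} (hw : ∀ x, 0 < w x)
    (hharm : ∀ x, ‖x‖ < r → avg p (fun z => w z ^ 2) x = w x ^ 2) {x : Λ}
    (hx : 8 * R / r ≤ 1 - ‖x‖ ^ 2 / r ^ 2)
    (hmax : ∀ y, ‖y‖ < r → (1 - ‖y‖ ^ 2 / r ^ 2) ^ 2 * defect p w y ≤
      (1 - ‖x‖ ^ 2 / r ^ 2) ^ 2 * defect p w x) :
    c₀ ^ 2 / 4 * ((1 - ‖x‖ ^ 2 / r ^ 2) ^ 2 * defect p w x) ≤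
      (288 * R ^ 2 / c₀ ^ 2 + 90 * R ^ 2 + 2 * d) / r ^ 2 := by
  have hr0 : 0 < r := by linarith
  set ψ : Λ → ℝ := fun y => 1 - ‖y‖ ^ 2 / r ^ 2 with hψ
  set Q : Λ → ℝ := defect p w with hQ
  set N := hp.steps
  set q : Λ → ℝ := fun s => (p s).toReal
  have hq : ∀ s, 0 ≤ q s := fun s => ENNReal.toReal_nonneg
  set a : Λ → ℝ := fun s => w (x + s) / w x
  have hψx : 0 < ψ x := lt_of_lt_of_le (by positivity) hx
  have hψ1 : ψ x ≤ 1 := by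
    have : 0 ≤ ‖x‖ ^ 2 / r ^ 2 := by positivity
    simp only [hψ]; linarith
  have hlt : ∀ y, 0 < ψ y → ‖y‖ < r := fun y hy => by
    have : ‖y‖ ^ 2 / r ^ 2 < 1 := by simp only [hψ] at hy; linarith
    rw [div_lt_one (by positivity)] at this
    exact lt_of_pow_lt_pow_left₀ 2 hr0.le this
  have hxr := hlt x hψx
  set ζ : ℝ := 3 * R / (r * ψ x) with hζ
  have hζ0 : 0 < ζ := by positivity
  have hζ1 : ζ ≤ 3 / 8 := by
    rw [hζ, div_le_iff₀ (by positivity)]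
    have := (div_le_iff₀ hr0).1 hx
    change _ ≤ ψ x * r at this
    linarith
  set z : Λ → ℝ := fun s => ψ (x + s) / ψ x - 1 with hz
  have hzeq : ∀ s : Λ, z s = -(2 * inner ℝ (x : EuclideanSpace ℝ (Fin d))
      (s : EuclideanSpace ℝ (Fin d)) + ‖s‖ ^ 2) / (r ^ 2 * ψ x) := fun s => by
    simp only [hz]
    have hx0 : ψ x ≠ 0 := hψx.ne'
    have : ψ (x + s) = ψ x - (2 * inner ℝ (x : EuclideanSpace ℝ (Fin d))
      (s : EuclideanSpace ℝ (Fin d)) + ‖s‖ ^ 2) / r ^ 2 := by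
      simp only [hψ, norm_add_sq_coe]; ring
    rw [this]
    field_simp
    ring
  have hzb : ∀ s ∈ N, |z s| ≤ ζ := by
    intro s hs
    have h1 := abs_real_inner_le_norm (x : EuclideanSpace ℝ (Fin d))
      (s : EuclideanSpace ℝ (Fin d))
    change _ ≤ ‖x‖ * ‖s‖ at h1
    have h2 := hsR s hs
    have h3 : ‖x‖ * ‖s‖ ≤ r * R := by gcongr
    have h4 : ‖s‖ ^ 2 ≤ r * R := by
      rw [sq]; gcongr; exact h2.trans hr
    rw [hzeq, abs_div, abs_neg, abs_of_pos (show 0 < r ^ 2 * ψ x by positivity), hζ,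
      div_le_div_iff₀ (by positivity) (by positivity)]
    have h5 : |2 * inner ℝ (x : EuclideanSpace ℝ (Fin d)) (s : EuclideanSpace ℝ (Fin d)) +
        ‖s‖ ^ 2| ≤ 3 * (r * R) := by
      refine (abs_add_le _ _).trans ?_
      rw [abs_mul, abs_two, abs_of_nonneg (sq_nonneg ‖s‖)]
      linarith
    calc _ ≤ 3 * (r * R) * (r * ψ x) := by gcongr
      _ = _ := by ring
  have hψs : ∀ s ∈ N, 0 < ψ (x + s) := by
    intro s hs
    have h1 := (abs_le.1 ((hzb s hs).trans hζ1)).1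
    have h2 : ψ (x + s) = (1 + z s) * ψ x := by simp only [hz]; field_simp; ring
    rw [h2]
    exact mul_pos (by linarith) hψx
  have hharms : ∀ s ∈ N, avg p (fun z => w z ^ 2) (x + s) = w (x + s) ^ 2 := fun s hs =>
    hharm _ (hlt _ (hψs s hs))
  have hen := hp.energy_le_avg_energy hc₀ hc₁ hc hw (hharm x hxr) hharms
  have ha2 := hp.sum_ratio_sq (hw x) (hharm x hxr)
  have ha1 := hp.sum_ratio_sub_one_sq (hw x) (hharm x hxr)
  change ∑ s ∈ N, q s * a s ^ 2 = 1 at ha2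
  change ∑ s ∈ N, q s * (a s - 1) ^ 2 = 2 * Q x at ha1
  have hQ0 : 0 ≤ Q x := hp.defect_nonneg (hw x) (hharm x hxr)
  -- the curvature inequality, divided by `w x ^ 2`, at the maximum point
  have hmain : Q x + c₀ ^ 2 / 2 * Q x ^ 2 ≤
      Q x * ∑ s ∈ N, q s * (a s ^ 2 * (1 / (1 + z s) ^ 2)) := by
    rw [hp.avg_eq_sum] at hen
    have hwx : 0 < w x ^ 2 := pow_pos (hw x) 2
    have h1 : ∑ s ∈ N, q s * (w (x + s) ^ 2 * Q (x + s)) ≤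
        w x ^ 2 * (Q x * ∑ s ∈ N, q s * (a s ^ 2 * (1 / (1 + z s) ^ 2))) := by
      rw [Finset.mul_sum, Finset.mul_sum]
      refine Finset.sum_le_sum fun s hs => ?_
      have h2 := hmax (x + s) (hlt _ (hψs s hs))
      change ψ (x + s) ^ 2 * Q (x + s) ≤ ψ x ^ 2 * Q x at h2
      have h3 : Q (x + s) ≤ Q x * (1 / (1 + z s) ^ 2) := by
        have h4 : 1 + z s = ψ (x + s) / ψ x := by simp only [hz]; ring
        rw [h4, div_pow, one_div_div, ← mul_div_assoc, le_div_iff₀ (pow_pos (hψs s hs) 2)]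
        linarith
      calc q s * (w (x + s) ^ 2 * Q (x + s))
          ≤ q s * (w (x + s) ^ 2 * (Q x * (1 / (1 + z s) ^ 2))) := by
            have := hq s
            gcongr
        _ = _ := by
            have := (hw x).ne'
            simp only [a]; field_simp
    have h5 := hen.trans h1
    have h6 : w x ^ 2 * (Q x + c₀ ^ 2 / 2 * Q x ^ 2) ≤
        w x ^ 2 * (Q x * ∑ s ∈ N, q s * (a s ^ 2 * (1 / (1 + z s) ^ 2))) := by
      refine le_trans (le_of_eq ?_) h5
      ring
    exact le_of_mul_le_mul_left h6 hwx
  have hB0 : 0 ≤ (288 * R ^ 2 / c₀ ^ 2 + 90 * R ^ 2 + 2 * d) / r ^ 2 := by positivity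
  rcases hQ0.eq_or_lt with h0 | hQpos
  · rw [← h0]; simpa using hB0
  have hmain2 : 1 + c₀ ^ 2 / 2 * Q x ≤ ∑ s ∈ N, q s * (a s ^ 2 * (1 / (1 + z s) ^ 2)) := by
    refine le_of_mul_le_mul_left ?_ hQpos
    calc _ = Q x + c₀ ^ 2 / 2 * Q x ^ 2 := by ring
      _ ≤ _ := hmain
  set κ : ℝ := c₀ ^ 2 / 8 with hκ
  have hκ0 : 0 < κ := by positivity
  -- Young's inequality absorbs the first order term
  have hterm : ∀ s ∈ N, q s * (a s ^ 2 * (1 / (1 + z s) ^ 2)) ≤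
      q s * a s ^ 2 + κ * (q s * (a s - 1) ^ 2) + (2 * ζ ^ 2 / κ + 10 * ζ ^ 2) * (q s * a s ^ 2) +
        2 * ζ ^ 2 / κ * q s + (-2) * (q s * z s) := by
    intro s hs
    have hzs := hzb s hs
    have h1 := inv_one_add_sq_le (hzs.trans hζ1)
    have h2 : z s ^ 2 ≤ ζ ^ 2 := by
      rw [← sq_abs (z s)]; gcongr
    have h3 : (a s ^ 2 - 1) * (-2 * z s) ≤ κ * (a s - 1) ^ 2 + (2 * a s ^ 2 + 2) * ζ ^ 2 / κ := by
      have h4 : 0 ≤ (κ * (a s - 1) + (a s + 1) * z s) ^ 2 / κ := by positivity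
      have h5 : (κ * (a s - 1) + (a s + 1) * z s) ^ 2 / κ = κ * (a s - 1) ^ 2 +
          2 * (a s ^ 2 - 1) * z s + (a s + 1) ^ 2 * z s ^ 2 / κ := by field_simp; ring
      have h6 : (a s + 1) ^ 2 * z s ^ 2 / κ ≤ (2 * a s ^ 2 + 2) * ζ ^ 2 / κ := by
        gcongr
        nlinarith [sq_nonneg (a s - 1)]
      linarith
    have h7 : a s ^ 2 * (1 / (1 + z s) ^ 2) ≤ a s ^ 2 + κ * (a s - 1) ^ 2 +
        (2 * ζ ^ 2 / κ + 10 * ζ ^ 2) * a s ^ 2 + 2 * ζ ^ 2 / κ + (-2) * z s := by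
      calc a s ^ 2 * (1 / (1 + z s) ^ 2) ≤ a s ^ 2 * (1 - 2 * z s + 10 * z s ^ 2) := by gcongr
        _ = a s ^ 2 + (a s ^ 2 - 1) * (-2 * z s) + (-2) * z s + 10 * z s ^ 2 * a s ^ 2 := by ring
        _ ≤ a s ^ 2 + (κ * (a s - 1) ^ 2 + (2 * a s ^ 2 + 2) * ζ ^ 2 / κ) + (-2) * z s +
            10 * ζ ^ 2 * a s ^ 2 := by gcongr
        _ = _ := by ring
    calc _ ≤ q s * (a s ^ 2 + κ * (a s - 1) ^ 2 +
        (2 * ζ ^ 2 / κ + 10 * ζ ^ 2) * a s ^ 2 + 2 * ζ ^ 2 / κ + (-2) * z s) :=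
          mul_le_mul_of_nonneg_left h7 (hq s)
      _ = _ := by ring
  have hzsum : ∑ s ∈ N, q s * z s = -(d / (r ^ 2 * ψ x)) := by
    have h1 : ∀ s : Λ, q s * z s = -(1 / (r ^ 2 * ψ x)) * (2 * (q s * inner ℝ
        (x : EuclideanSpace ℝ (Fin d)) (s : EuclideanSpace ℝ (Fin d))) + q s * ‖s‖ ^ 2) :=
      fun s => by rw [hzeq]; ring
    simp_rw [h1]
    rw [← Finset.mul_sum, Finset.sum_add_distrib, ← Finset.mul_sum]
    have h2 := hp.sum_inner (x : EuclideanSpace ℝ (Fin d))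
    have h3 := hp.sum_norm_sq
    change ∑ s ∈ N, q s * _ = _ at h2
    change ∑ s ∈ N, q s * _ = _ at h3
    rw [h2, h3]
    ring
  have hsum := hmain2.trans (Finset.sum_le_sum hterm)
  have hone : ∑ s ∈ N, q s = 1 := hp.sum_steps
  simp only [Finset.sum_add_distrib, ← Finset.mul_sum, ha2, ha1, hone, hzsum] at hsum
  have hfin : c₀ ^ 2 / 4 * Q x ≤ 32 * ζ ^ 2 / c₀ ^ 2 + 10 * ζ ^ 2 + 2 * (d / (r ^ 2 * ψ x)) := by
    have h8 : 2 * ζ ^ 2 / κ = 16 * ζ ^ 2 / c₀ ^ 2 := by rw [hκ]; field_simp; norm_num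
    rw [h8] at hsum
    have h9 : 32 * ζ ^ 2 / c₀ ^ 2 = 16 * ζ ^ 2 / c₀ ^ 2 + 16 * ζ ^ 2 / c₀ ^ 2 := by ring
    have h10 : κ * (2 * Q x) = c₀ ^ 2 / 4 * Q x := by rw [hκ]; ring
    linarith
  calc c₀ ^ 2 / 4 * (ψ x ^ 2 * Q x) = ψ x ^ 2 * (c₀ ^ 2 / 4 * Q x) := by ring
    _ ≤ ψ x ^ 2 * (32 * ζ ^ 2 / c₀ ^ 2 + 10 * ζ ^ 2 + 2 * (d / (r ^ 2 * ψ x))) := by gcongr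
    _ = (288 * R ^ 2 / c₀ ^ 2 + 90 * R ^ 2 + 2 * d * ψ x) / r ^ 2 := by
      rw [hζ]; field_simp; ring
    _ ≤ _ := by
      have : 2 * (d : ℝ) * ψ x ≤ 2 * d := mul_le_of_le_one_right (by positivity) hψ1
      gcongr

variable [DiscreteTopology Λ]

/-- Gradient estimate: a positive function that is harmonic on a ball of radius `r` changes by a
factor of at most `exp (C / r)` along each step in the half ball. -/
theorem exists_gradient_bound : ∃ C : ℝ, 0 < C ∧ ∀ (r : ℝ) (u : Λ → ℝ), 0 < r →
    (∀ x, 0 < u x) → (∀ x, ‖x‖ < r → avg p u x = u x) →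
    ∀ x, ‖x‖ ≤ r / 2 → ∀ s ∈ hp.steps, u (x + s) ≤ Real.exp (C / r) * u x := by
  obtain ⟨c₀, hc₀, hc₁, hc⟩ := hp.exists_lower_bound
  obtain ⟨R, hR, hsR⟩ := hp.exists_bound
  set B : ℝ := 64 * R ^ 2 + 4 / c₀ ^ 2 * (288 * R ^ 2 / c₀ ^ 2 + 90 * R ^ 2 + 2 * d) with hB
  have hB0 : 0 < B := by positivity
  refine ⟨R / c₀ + 2 * √(4 * B / c₀), by positivity, fun r u hr hu hharm x hx s hs => ?_⟩
  have hxr : ‖x‖ < r := by linarith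
  have hcs := hc s hs
  rcases lt_or_ge r R with hrR | hrR
  · -- for bounded radius, harmonicity at `x` alone suffices
    have h1 : (p s).toReal * u (x + s) ≤ u x := by
      rw [← hharm x hxr, hp.avg_eq_sum]
      exact Finset.single_le_sum (f := fun t => (p t).toReal * u (x + t))
        (fun t _ => mul_nonneg ENNReal.toReal_nonneg (hu _).le) hs
    have h2 : c₀ * u (x + s) ≤ u x := le_trans (by gcongr; exact (hu _).le) h1
    have h3 : 1 / c₀ ≤ Real.exp ((R / c₀ + 2 * √(4 * B / c₀)) / r) := by
      refine le_trans ?_ (Real.add_one_le_exp _ |> le_trans (le_add_of_nonneg_right zero_le_one))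
      rw [le_div_iff₀ hr]
      calc 1 / c₀ * r ≤ 1 / c₀ * R := by gcongr
        _ ≤ _ := by
          have : 0 ≤ 2 * √(4 * B / c₀) := by positivity
          rw [one_div_mul_eq_div]; linarith
    calc u (x + s) = 1 / c₀ * (c₀ * u (x + s)) := by field_simp
      _ ≤ 1 / c₀ * u x := by gcongr
      _ ≤ _ := by
        have := (hu x).le
        gcongr
  set w : Λ → ℝ := fun y => √(u y) with hwdef
  have hw : ∀ y, 0 < w y := fun y => Real.sqrt_pos.2 (hu y)
  have hw2 : ∀ y, w y ^ 2 = u y := fun y => Real.sq_sqrt (hu y).le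
  have hharm' : ∀ y, ‖y‖ < r → avg p (fun z => w z ^ 2) y = w y ^ 2 := fun y hy => by
    simp_rw [hw2]; exact hharm y hy
  obtain ⟨x₀, hx₀, hmax⟩ := (ball Λ r).exists_max_image
    (fun y => (1 - ‖y‖ ^ 2 / r ^ 2) ^ 2 * defect p w y) (finite_ball r) ⟨x, hxr⟩
  have hG : (1 - ‖x₀‖ ^ 2 / r ^ 2) ^ 2 * defect p w x₀ ≤ B / r ^ 2 := by
    rcases le_total (8 * R / r) (1 - ‖x₀‖ ^ 2 / r ^ 2) with h | h
    · have h1 := hp.cutoff_mul_defect_le hc₀ hc₁ hc hR hsR hrR hw hharm' h hmax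
      calc _ = 4 / c₀ ^ 2 * (c₀ ^ 2 / 4 * ((1 - ‖x₀‖ ^ 2 / r ^ 2) ^ 2 * defect p w x₀)) := by
            field_simp
        _ ≤ 4 / c₀ ^ 2 * ((288 * R ^ 2 / c₀ ^ 2 + 90 * R ^ 2 + 2 * d) / r ^ 2) := by gcongr
        _ ≤ B / r ^ 2 := by
            rw [← mul_div_assoc]
            gcongr
            rw [hB]
            have : 0 ≤ 64 * R ^ 2 := by positivity
            linarith
    · have h0 : 0 ≤ 1 - ‖x₀‖ ^ 2 / r ^ 2 := by
        have h2 : ‖x₀‖ < r := hx₀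
        have h3 : ‖x₀‖ ^ 2 / r ^ 2 ≤ 1 := by
          rw [div_le_one (by positivity)]; gcongr
        linarith
      calc _ ≤ (8 * R / r) ^ 2 * 1 := by
            gcongr
            · exact hp.defect_nonneg (hw _) (hharm' _ hx₀)
            · exact hp.defect_le_one hw _
        _ = 64 * R ^ 2 / r ^ 2 := by ring
        _ ≤ B / r ^ 2 := by
            gcongr
            rw [hB]
            have : 0 ≤ 4 / c₀ ^ 2 * (288 * R ^ 2 / c₀ ^ 2 + 90 * R ^ 2 + 2 * d) := by positivity
            linarith
  have hQx : 1 / 2 * defect p w x ≤ B / r ^ 2 := by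
    refine le_trans ?_ ((hmax x hxr).trans hG)
    have h1 : 3 / 4 ≤ 1 - ‖x‖ ^ 2 / r ^ 2 := by
      have : ‖x‖ ^ 2 / r ^ 2 ≤ 1 / 4 := by
        rw [div_le_iff₀ (by positivity)]
        calc ‖x‖ ^ 2 ≤ (r / 2) ^ 2 := by gcongr
          _ = _ := by ring
      linarith
    have := hp.defect_nonneg (hw x) (hharm' x hxr)
    gcongr
    nlinarith
  have hratio : (w (x + s) / w x - 1) ^ 2 ≤ 4 * B / c₀ / r ^ 2 := by
    have h1 : (p s).toReal * (w (x + s) / w x - 1) ^ 2 ≤ 2 * defect p w x := by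
      rw [← hp.sum_ratio_sub_one_sq (hw x) (hharm' x hxr)]
      exact Finset.single_le_sum (f := fun t => (p t).toReal * (w (x + t) / w x - 1) ^ 2)
        (fun t _ => mul_nonneg ENNReal.toReal_nonneg (sq_nonneg _)) hs
    have h2 : c₀ * (w (x + s) / w x - 1) ^ 2 ≤ 4 * (B / r ^ 2) := by
      calc _ ≤ (p s).toReal * (w (x + s) / w x - 1) ^ 2 := by gcongr
        _ ≤ _ := by linarith
    rw [div_div, le_div_iff₀ (by positivity)]
    calc _ = c₀ * (w (x + s) / w x - 1) ^ 2 * r ^ 2 := by ring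
      _ ≤ 4 * (B / r ^ 2) * r ^ 2 := by gcongr
      _ = 4 * B := by field_simp
  have ha : w (x + s) / w x ≤ Real.exp (√(4 * B / c₀) / r) := by
    have h1 : w (x + s) / w x - 1 ≤ √(4 * B / c₀) / r := by
      refine (Real.le_sqrt_of_sq_le hratio).trans (le_of_eq ?_)
      rw [Real.sqrt_div' _ (by positivity), Real.sqrt_sq hr.le]
    linarith [Real.add_one_le_exp (√(4 * B / c₀) / r)]
  calc u (x + s) = (w (x + s) / w x) ^ 2 * u x := by
        rw [div_pow, hw2, hw2]; field_simp [(hu x).ne']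
    _ ≤ Real.exp (√(4 * B / c₀) / r) ^ 2 * u x := by
        have := hu x
        have := div_pos (hw (x + s)) (hw x)
        gcongr
    _ = Real.exp (2 * √(4 * B / c₀) / r) * u x := by
        rw [← Real.exp_nat_mul]; congr 2; push_cast; ring
    _ ≤ _ := by
        have := (hu x).le
        gcongr
        have : 0 ≤ R / c₀ := by positivity
        linarith

variable [IsZLattice ℝ Λ]

/-- Harnack inequality: a nonnegative function that is harmonic on the ball of radius `r` around
`a` is comparable to its value at `a`, with a constant that tends to `1` at the centre. -/
theorem exists_harnack : ∃ C : ℝ, 1 ≤ C ∧ ∀ (r : ℝ) (u : Λ → ℝ) (a : Λ), 0 < r →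
    (∀ x, 0 ≤ u x) → (∀ x, ‖x - a‖ < r → avg p u x = u x) → ∀ x, C * ‖x - a‖ ≤ r →
    u x ≤ Real.exp (C * ‖x - a‖ / r) * u a ∧ u a ≤ Real.exp (C * ‖x - a‖ / r) * u x := by
  obtain ⟨C₁, hC₁, hgrad⟩ := hp.exists_gradient_bound
  obtain ⟨R, hR, hsR⟩ := hp.exists_bound
  have hirr : AddSubgroup.closure (hp.steps : Set Λ) = ⊤ := by
    rw [← hp.irreducible]; congr 1; ext s; simp [steps]
  obtain ⟨C₂, hC₂, hword⟩ := exists_hasWord (N := (hp.steps : Set Λ))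
    (fun s hs => hp.neg_mem_steps hs) hirr
  -- the case of a positive function, along a path
  have hpath : ∀ (r : ℝ) (u : Λ → ℝ) (a : Λ), 0 < r → (∀ x, 0 < u x) →
      (∀ x, ‖x - a‖ < r → avg p u x = u x) → ∀ L : List Λ, (∀ s ∈ L, s ∈ hp.steps) →
      ∀ z : Λ, ‖z‖ + R * L.length ≤ r / 2 →
      u (a + z + L.sum) ≤ Real.exp (C₁ * L.length / r) * u (a + z) ∧
      u (a + z) ≤ Real.exp (C₁ * L.length / r) * u (a + z + L.sum) := by
    intro r u a hr hu hharm L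
    have hg := hgrad r (fun x => u (a + x)) hr (fun x => hu _) (fun x hx => by
      have := hharm (a + x) (by simpa using hx)
      rw [← this, hp.avg_eq_sum, hp.avg_eq_sum]
      simp_rw [add_assoc])
    induction L with
    | nil => intro _ z _; simp
    | cons s L ih =>
      intro hL z hz
      have hs : s ∈ hp.steps := hL s (by simp)
      have hsn := hsR s hs
      push_cast [List.length_cons] at hz ⊢
      have hlen : 0 ≤ R * (L.length : ℝ) := by positivity
      have hzs : ‖z + s‖ ≤ ‖z‖ + R := (norm_add_le _ _).trans (by linarith)
      obtain ⟨h1, h2⟩ := ih (fun t ht => hL t (by simp [ht])) (z + s) (by linarith)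
      have h3 := hg z (by linarith) s hs
      have h4 := hg (z + s) (by linarith) (-s) (hp.neg_mem_steps hs)
      simp only [add_neg_cancel_right] at h4
      have he : Real.exp (C₁ * (L.length + 1) / r) =
          Real.exp (C₁ * L.length / r) * Real.exp (C₁ / r) := by
        rw [← Real.exp_add]; ring_nf
      rw [List.sum_cons, ← add_assoc, add_assoc a z s, he]
      constructor
      · calc _ ≤ Real.exp (C₁ * L.length / r) * u (a + (z + s)) := h1
          _ ≤ Real.exp (C₁ * L.length / r) * (Real.exp (C₁ / r) * u (a + z)) := by gcongr
          _ = _ := by ring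
      · calc _ ≤ Real.exp (C₁ / r) * u (a + (z + s)) := h4
          _ ≤ Real.exp (C₁ / r) * (Real.exp (C₁ * L.length / r) * u (a + (z + s) + L.sum)) := by
            gcongr
          _ = _ := by ring
  refine ⟨C₁ * C₂ + 2 * R * C₂ + 1, by nlinarith [mul_pos hC₁ (by linarith : 0 < C₂)],
    fun r u a hr hu hharm x hx => ?_⟩
  set C : ℝ := C₁ * C₂ + 2 * R * C₂ + 1
  obtain ⟨k, ⟨L, hL, hsum, hlen⟩, hk⟩ := hword (x - a)
  have hlen' : (L.length : ℝ) ≤ C₂ * ‖x - a‖ := le_trans (by exact_mod_cast hlen) hk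
  have hn : 0 ≤ ‖x - a‖ := norm_nonneg _
  have hC₁₂ : 0 ≤ C₁ * C₂ * ‖x - a‖ := by positivity
  have hRC : 0 ≤ 2 * R * C₂ * ‖x - a‖ := by positivity
  have hexpand : C * ‖x - a‖ = C₁ * C₂ * ‖x - a‖ + 2 * R * C₂ * ‖x - a‖ + ‖x - a‖ := by
    simp only [C]; ring
  -- the positive case is applied to `u + ε`
  have hε : ∀ ε : ℝ, 0 < ε →
      u x + ε ≤ Real.exp (C * ‖x - a‖ / r) * (u a + ε) ∧
      u a + ε ≤ Real.exp (C * ‖x - a‖ / r) * (u x + ε) := by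
    intro ε hε
    have h := hpath r (fun y => u y + ε) a hr (fun y => by have := hu y; linarith)
      (fun y hy => by
        rw [← hharm y hy, hp.avg_eq_sum, hp.avg_eq_sum]
        simp_rw [mul_add, Finset.sum_add_distrib, ← Finset.sum_mul, hp.sum_steps, one_mul])
      L hL 0 (by
        have : R * (L.length : ℝ) ≤ R * (C₂ * ‖x - a‖) := by gcongr
        rw [norm_zero]
        linarith)
    rw [add_zero, hsum, add_sub_cancel] at h
    have hexp : Real.exp (C₁ * L.length / r) ≤ Real.exp (C * ‖x - a‖ / r) := by
      have : C₁ * (L.length : ℝ) ≤ C * ‖x - a‖ := by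
        calc C₁ * (L.length : ℝ) ≤ C₁ * (C₂ * ‖x - a‖) := by gcongr
          _ ≤ _ := by linarith
      gcongr
    exact ⟨h.1.trans (mul_le_mul_of_nonneg_right hexp (by have := hu a; linarith)),
      h.2.trans (mul_le_mul_of_nonneg_right hexp (by have := hu x; linarith))⟩
  have hlim : ∀ α β K : ℝ, (∀ ε : ℝ, 0 < ε → α + ε ≤ K * (β + ε)) → α ≤ K * β := by
    intro α β K h
    have hlim : Filter.Tendsto (fun ε : ℝ => K * (β + ε) - ε) (nhdsWithin 0 (Set.Ioi 0))
        (nhds (K * (β + 0) - 0)) :=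
      (Continuous.tendsto (by fun_prop) 0).mono_left nhdsWithin_le_nhds
    rw [add_zero, sub_zero] at hlim
    exact ge_of_tendsto hlim (Filter.eventually_of_mem self_mem_nhdsWithin fun ε hε => by
      have := h ε hε; linarith)
  exact ⟨hlim _ _ _ fun ε h => (hε ε h).1, hlim _ _ _ fun ε h => (hε ε h).2⟩

end IsStepDistribution

end Harnack

end LatticeWalk

namespace LatticeWalk

/-! ### Comparison of conditioned and unconditioned escape probabilities -/

section Comparison

variable {d : ℕ} {Λ : Submodule ℤ (EuclideanSpace ℝ (Fin d))} {p : PMF Λ}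

namespace IsStepDistribution

variable (hp : IsStepDistribution p)
include hp

lemma avg_const (c : ℝ) (x : Λ) : avg p (fun _ => c) x = c := by
  rw [hp.avg_eq_sum, ← Finset.sum_mul, hp.sum_steps, one_mul]

lemma avg_sub (f g : Λ → ℝ) (x : Λ) : avg p (fun z => f z - g z) x = avg p f x - avg p g x := by
  simp_rw [hp.avg_eq_sum, mul_sub, Finset.sum_sub_distrib]

lemma avg_add (f g : Λ → ℝ) (x : Λ) : avg p (fun z => f z + g z) x = avg p f x + avg p g x := by
  simp_rw [hp.avg_eq_sum, mul_add, Finset.sum_add_distrib]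

lemma avg_mul_const (f : Λ → ℝ) (c : ℝ) (x : Λ) : avg p (fun z => f z * c) x = avg p f x * c := by
  simp_rw [hp.avg_eq_sum, ← mul_assoc, Finset.sum_mul]

lemma avg_sum {ι : Type*} (t : Finset ι) (f : ι → Λ → ℝ) (x : Λ) :
    avg p (fun z => ∑ i ∈ t, f i z) x = ∑ i ∈ t, avg p (f i) x := by
  simp_rw [hp.avg_eq_sum, Finset.mul_sum]
  exact Finset.sum_comm

/-- A finite set disjoint from `D` that contains every point outside `D` which the walk can reach
from `D` in one step. -/
def IsBoundary (D : Set Λ) (T : Finset Λ) : Prop :=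
  Disjoint (T : Set Λ) D ∧ ∀ x ∈ D, ∀ s ∈ hp.steps, x + s ∉ D → x + s ∈ T

/-- The smallest choice of a boundary of a finite set. -/
lemma exists_isBoundary {D : Set Λ} (hD : D.Finite) :
    ∃ T : Finset Λ, hp.IsBoundary D T ∧ ∀ u ∈ T, ∃ x ∈ D, ∃ s ∈ hp.steps, u = x + s := by
  classical
  refine ⟨((hD.toFinset ×ˢ hp.steps).image fun x => x.1 + x.2).filter (· ∉ D), ⟨?_, ?_⟩, ?_⟩
  · exact Set.disjoint_left.2 fun x hx => (Finset.mem_filter.1 hx).2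
  · intro x hx s hs h
    exact Finset.mem_filter.2 ⟨Finset.mem_image.2 ⟨(x, s), by simp [hx, hs], rfl⟩, h⟩
  · intro u hu
    obtain ⟨⟨x, s⟩, h, rfl⟩ := Finset.mem_image.1 (Finset.mem_filter.1 hu).1
    simp only [Finset.mem_product, Set.Finite.mem_toFinset] at h
    exact ⟨x, h.1, s, h.2, rfl⟩

lemma IsBoundary.sdiff [DecidableEq Λ] {D : Set Λ} {T : Finset Λ} (h : hp.IsBoundary D T)
    (η : Finset Λ) : hp.IsBoundary (D \ η) (T ∪ η) := by
  refine ⟨?_, fun x hx s hs hxs => ?_⟩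
  · rw [Set.disjoint_left]
    intro x hx hxD
    rcases Finset.mem_union.1 (Finset.mem_coe.1 hx) with hT | hη
    · exact Set.disjoint_left.1 h.1 hT hxD.1
    · exact hxD.2 hη
  · by_cases hmem : x + s ∈ D
    · have : x + s ∈ η := by
        by_contra hn
        exact hxs ⟨hmem, hn⟩
      exact Finset.mem_union_right _ this
    · exact Finset.mem_union_left _ (h.2 x hx.1 s hs hmem)

variable [DiscreteTopology Λ]

/-- The Poisson formula: a harmonic function on a finite set is the average of its boundary values
over the exit distribution. -/
lemma eq_sum_hit (hd : 0 < d) {D : Set Λ} (hD : D.Finite) {T : Finset Λ}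
    (hT : hp.IsBoundary D T) {f : Λ → ℝ} (hf : ∀ x ∈ D, f x = avg p f x) {x : Λ} (hx : x ∈ D) :
    f x = ∑ u ∈ T, hit p D {u} x * f u := by
  set F : Λ → ℝ := fun z => ∑ u ∈ T, hit p D {u} z * f u with hF
  have hFh : ∀ z ∈ D, F z = avg p F z := by
    intro z hz
    rw [hF, hp.avg_sum]
    refine Finset.sum_congr rfl fun u hu => ?_
    rw [hp.avg_mul_const, ← hit_eq_avg p _ hz]
    exact Set.disjoint_singleton_left.2 fun h => Set.disjoint_left.1 hT.1 hu h
  have hbd : ∀ z ∈ D, ∀ s ∈ hp.steps, z + s ∉ D → F (z + s) = f (z + s) := by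
    intro z hz s hs h
    have hmem := hT.2 z hz s hs h
    simp only [hF]
    rw [Finset.sum_eq_single_of_mem _ hmem, hit_of_mem p (Set.mem_singleton _), one_mul]
    intro u _ hne
    rw [hit_of_notMem p h (fun h' => hne (Set.mem_singleton_iff.1 h').symm), zero_mul]
  have h1 := hp.nonpos_of_subharmonic hd hD (u := fun z => f z - F z)
    (fun z hz => by rw [hp.avg_sub, ← hf z hz, ← hFh z hz])
    (fun z hz s hs h => by rw [hbd z hz s hs h, sub_self]) x hx
  have h2 := hp.nonpos_of_subharmonic hd hD (u := fun z => F z - f z)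
    (fun z hz => by rw [hp.avg_sub, ← hf z hz, ← hFh z hz])
    (fun z hz s hs h => by rw [hbd z hz s hs h, sub_self]) x hx
  linarith

/-- The average over the exit distribution from a finite set `D`, seen from `0`, of the probability
of leaving `K` in `A` before hitting `η`, compared with the probability of leaving `K` in `A`:
their quotient is, up to constants, the probability `q` of not returning to `η`, whatever `A`. -/
lemma sum_exit_mul_escape_comparable (hd : 0 < d) {K A D : Set Λ} (hA : Disjoint A K)
    {η U : Finset Λ} (hD : D.Finite) (hDK : D ⊆ K) (hηD : ↑η ⊆ D) (h0 : (0 : Λ) ∈ η)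
    (hU : hp.IsBoundary D U) {a : ℝ} (ha : 0 ≤ a)
    (hHar : ∀ v ∈ η, ∀ u ∈ U, hit p D {u} 0 ≤ a * hit p D {u} v ∧
      hit p D {u} v ≤ a * hit p D {u} 0) :
    (hit p K A 0 * ∑ u ∈ U, hit p D {u} 0 * (1 - ∑ v ∈ η, hit p (K \ η) {v} u) ≤
      a ^ 2 * ∑ u ∈ U, hit p D {u} 0 * hit p (K \ η) A u) ∧
    (∑ u ∈ U, hit p D {u} 0 * hit p (K \ η) A u ≤
      a ^ 2 * (hit p K A 0 * ∑ u ∈ U, hit p D {u} 0 *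
        (1 - ∑ v ∈ η, hit p (K \ η) {v} u))) := by
  set h := hit p K A
  set g := hit p (K \ η) A
  set m : Λ → ℝ := fun u => hit p D {u} 0
  set π : Λ → Λ → ℝ := fun v u => hit p (K \ η) {v} u
  have hg0 : ∀ u, 0 ≤ g u := hit_nonneg p _ _
  have hh0 : ∀ u, 0 ≤ h u := hit_nonneg p _ _
  have hm0 : ∀ u, 0 ≤ m u := fun u => hit_nonneg p _ _ _
  have hπ0 : ∀ v u, 0 ≤ π v u := fun v u => hit_nonneg p _ _ _
  have hπ1 : ∀ u, 0 ≤ 1 - ∑ v ∈ η, π v u := fun u =>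
    sub_nonneg.2 (sum_hit_singleton_le_one p (K \ η) η (Set.disjoint_left.2 fun x hx h => h.2 hx) u)
  have hH0 : ∀ v u, 0 ≤ hit p D {u} v := fun v u => hit_nonneg p _ _ _
  have hpois : ∀ v ∈ η, h v = ∑ u ∈ U, hit p D {u} v * h u := fun v hv =>
    hp.eq_sum_hit hd hD hU (fun x hx => hit_eq_avg p hA (hDK hx)) (hηD hv)
  have hone : ∀ v ∈ η, ∑ u ∈ U, hit p D {u} v = 1 := fun v hv => by
    have := hp.eq_sum_hit hd hD hU (f := fun _ => 1) (fun x _ => (hp.avg_const 1 x).symm) (hηD hv)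
    simpa using this.symm
  have hdec : ∀ u, h u = g u + ∑ v ∈ η, π v u * h v := fun u =>
    hit_eq_hit_sdiff_add p K A hA η (hηD.trans hDK) u
  constructor
  · obtain ⟨v₁, hv₁, hmax⟩ := η.exists_max_image h ⟨0, h0⟩
    have h1 : ∀ u, h u ≤ g u + (∑ v ∈ η, π v u) * h v₁ := fun u => by
      rw [hdec u, Finset.sum_mul]
      gcongr with v hv
      · exact hπ0 v u
      · exact hmax v hv
    have h2 : h v₁ * ∑ u ∈ U, hit p D {u} v₁ * (1 - ∑ v ∈ η, π v u) ≤
        ∑ u ∈ U, hit p D {u} v₁ * g u := by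
      have h3 : ∑ u ∈ U, hit p D {u} v₁ * h u ≤
          ∑ u ∈ U, hit p D {u} v₁ * (g u + (∑ v ∈ η, π v u) * h v₁) := by
        gcongr with u hu
        · exact hH0 _ _
        · exact h1 u
      rw [← hpois v₁ hv₁] at h3
      have h4 : h v₁ * ∑ u ∈ U, hit p D {u} v₁ * (1 - ∑ v ∈ η, π v u) =
          h v₁ * (∑ u ∈ U, hit p D {u} v₁) -
            ∑ u ∈ U, hit p D {u} v₁ * ((∑ v ∈ η, π v u) * h v₁) := by
        rw [← mul_comm (∑ u ∈ U, hit p D {u} v₁) (h v₁), mul_comm (h v₁), Finset.sum_mul,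
          Finset.sum_mul, ← Finset.sum_sub_distrib]
        exact Finset.sum_congr rfl fun u _ => by ring
      rw [h4, hone v₁ hv₁, mul_one]
      simp_rw [mul_add, Finset.sum_add_distrib] at h3
      linarith
    calc h 0 * ∑ u ∈ U, m u * (1 - ∑ v ∈ η, π v u)
        ≤ h v₁ * ∑ u ∈ U, (a * hit p D {u} v₁) * (1 - ∑ v ∈ η, π v u) := by
          gcongr with u hu
          · exact Finset.sum_nonneg fun u _ => mul_nonneg (hm0 u) (hπ1 u)
          · exact hh0 _
          · exact hmax 0 h0
          · exact hπ1 u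
          · exact (hHar v₁ hv₁ u hu).1
      _ = a * (h v₁ * ∑ u ∈ U, hit p D {u} v₁ * (1 - ∑ v ∈ η, π v u)) := by
          simp_rw [mul_assoc a, ← Finset.mul_sum]; ring
      _ ≤ a * ∑ u ∈ U, hit p D {u} v₁ * g u := by gcongr
      _ ≤ a * ∑ u ∈ U, (a * m u) * g u := by
          gcongr with u hu
          · exact hg0 u
          · exact (hHar v₁ hv₁ u hu).2
      _ = a ^ 2 * ∑ u ∈ U, m u * g u := by
          simp_rw [mul_assoc a, ← Finset.mul_sum]; ring
  · obtain ⟨v₁, hv₁, hmin⟩ := η.exists_min_image h ⟨0, h0⟩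
    have h1 : ∀ u, g u + (∑ v ∈ η, π v u) * h v₁ ≤ h u := fun u => by
      rw [hdec u, Finset.sum_mul]
      gcongr with v hv
      · exact hπ0 v u
      · exact hmin v hv
    have h2 : ∑ u ∈ U, hit p D {u} v₁ * g u ≤
        h v₁ * ∑ u ∈ U, hit p D {u} v₁ * (1 - ∑ v ∈ η, π v u) := by
      have h3 : ∑ u ∈ U, hit p D {u} v₁ * (g u + (∑ v ∈ η, π v u) * h v₁) ≤
          ∑ u ∈ U, hit p D {u} v₁ * h u := by
        gcongr with u hu
        · exact hH0 _ _
        · exact h1 u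
      rw [← hpois v₁ hv₁] at h3
      have h4 : h v₁ * ∑ u ∈ U, hit p D {u} v₁ * (1 - ∑ v ∈ η, π v u) =
          h v₁ * (∑ u ∈ U, hit p D {u} v₁) -
            ∑ u ∈ U, hit p D {u} v₁ * ((∑ v ∈ η, π v u) * h v₁) := by
        rw [← mul_comm (∑ u ∈ U, hit p D {u} v₁) (h v₁), mul_comm (h v₁), Finset.sum_mul,
          Finset.sum_mul, ← Finset.sum_sub_distrib]
        exact Finset.sum_congr rfl fun u _ => by ring
      rw [h4, hone v₁ hv₁, mul_one]
      simp_rw [mul_add, Finset.sum_add_distrib] at h3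
      linarith
    calc ∑ u ∈ U, m u * g u ≤ ∑ u ∈ U, (a * hit p D {u} v₁) * g u := by
          gcongr with u hu
          · exact hg0 u
          · exact (hHar v₁ hv₁ u hu).1
      _ = a * ∑ u ∈ U, hit p D {u} v₁ * g u := by simp_rw [mul_assoc a, ← Finset.mul_sum]
      _ ≤ a * (h v₁ * ∑ u ∈ U, hit p D {u} v₁ * (1 - ∑ v ∈ η, π v u)) := by gcongr
      _ ≤ a * (h 0 * ∑ u ∈ U, (a * m u) * (1 - ∑ v ∈ η, π v u)) := by
          gcongr with u hu
          · exact Finset.sum_nonneg fun u _ => mul_nonneg (hH0 _ _) (hπ1 u)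
          · exact hh0 _
          · exact hmin 0 h0
          · exact hπ1 u
          · exact (hHar v₁ hv₁ u hu).2
      _ = a ^ 2 * (h 0 * ∑ u ∈ U, m u * (1 - ∑ v ∈ η, π v u)) := by
          simp_rw [mul_assoc a, ← Finset.mul_sum]; ring

/-- If the exit distribution from `D` seen from any point of `η` is comparable with the one seen
from `0`, and the one seen from the boundary `W` of `D₀` and restricted to the paths avoiding `η`
is comparable with a multiple of it, then for the walk started at `y ∈ D₀`, leaving `K` in `A` and
leaving `K` before hitting `η` are almost independent, up to constants. -/
theorem escape_comparable (hd : 0 < d) {K A D D₀ : Set Λ} (hA : Disjoint A K)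
    (hK : hit p K Kᶜ 0 = 1) {η U W : Finset Λ} (hD : D.Finite) (hDK : D ⊆ K) (hηD : ↑η ⊆ D)
    (h0 : (0 : Λ) ∈ η) (hU : hp.IsBoundary D U) {a b : ℝ} (ha : 0 ≤ a) (hb : 0 ≤ b)
    (hHar : ∀ v ∈ η, ∀ u ∈ U, hit p D {u} 0 ≤ a * hit p D {u} v ∧
      hit p D {u} v ≤ a * hit p D {u} 0)
    (hD₀D : D₀ ⊆ D) (hW : hp.IsBoundary D₀ W) (hηD₀ : ↑η ⊆ D₀) (hWD : ↑W ⊆ D) (t : Λ → ℝ)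
    (hesc : ∀ w ∈ W, 0 ≤ t w ∧ ∀ u ∈ U, t w * hit p D {u} 0 ≤ b * hit p (D \ η) {u} w ∧
      hit p (D \ η) {u} w ≤ b * (t w * hit p D {u} 0)) {y : Λ} (hy : y ∈ D₀) (hyη : y ∉ η) :
    hit p (K \ η) A y ≤ a ^ 4 * b ^ 2 * (hit p K A 0 * hit p (K \ η) Kᶜ y) ∧
      hit p K A 0 * hit p (K \ η) Kᶜ y ≤ a ^ 4 * b ^ 2 * hit p (K \ η) A y := by
  classical
  set m : Λ → ℝ := fun u => hit p D {u} 0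
  have hm0 : ∀ u, 0 ≤ m u := fun u => hit_nonneg p _ _ _
  set q := ∑ u ∈ U, m u * (1 - ∑ v ∈ η, hit p (K \ η) {v} u) with hq
  have hηK : ↑η ⊆ K := hηD.trans hDK
  -- the escape probability is a mixture of its values on a surrounding boundary
  have hmix : ∀ (A' E : Set Λ) (T : Finset Λ), Disjoint A' K → E.Finite → E ⊆ K → ↑η ⊆ E →
      hp.IsBoundary E T → ∀ x ∈ E, x ∉ η →
      hit p (K \ η) A' x = ∑ w ∈ T, hit p (E \ η) {w} x * hit p (K \ η) A' w := by
    intro A' E T hA' hE hEK hηE hT x hx hxη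
    have hdis : Disjoint T η := by
      rw [Finset.disjoint_left]
      exact fun w hw hwη => Set.disjoint_left.1 hT.1 hw (hηE hwη)
    rw [hp.eq_sum_hit hd (hE.subset Set.sdiff_subset) (hT.sdiff hp η)
      (fun z hz => hit_eq_avg p (hA'.mono_right Set.sdiff_subset)
        (show z ∈ K \ (η : Set Λ) from ⟨hEK hz.1, hz.2⟩)) (show x ∈ E \ (η : Set Λ) from ⟨hx, hxη⟩),
      Finset.sum_union hdis, add_eq_left]
    refine Finset.sum_eq_zero fun v hv => ?_
    rw [hit_of_notMem p (fun h => h.2 hv) (fun h => Set.disjoint_left.1 hA' h (hηK hv)), mul_zero]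
  have hWη : ∀ w ∈ W, w ∉ η := fun w hw hwη => Set.disjoint_left.1 hW.1 hw (hηD₀ hwη)
  -- comparison at the points of `W`, for every target set `A'`
  have hWb : ∀ A' : Set Λ, Disjoint A' K → ∀ w ∈ W,
      hit p (K \ η) A' w ≤ a ^ 2 * b * (t w * (hit p K A' 0 * q)) ∧
      t w * (hit p K A' 0 * q) ≤ a ^ 2 * b * hit p (K \ η) A' w := by
    intro A' hA' w hw
    obtain ⟨h1, h2⟩ := hp.sum_exit_mul_escape_comparable hd hA' hD hDK hηD h0 hU ha hHar
    have h3 := hmix A' D U hA' hD hDK hηD hU w (hWD hw) (hWη w hw)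
    obtain ⟨ht, hk⟩ := hesc w hw
    have hg0 : ∀ u, 0 ≤ hit p (K \ η) A' u := hit_nonneg p _ _
    constructor
    · rw [h3]
      calc _ ≤ ∑ u ∈ U, (b * (t w * m u)) * hit p (K \ η) A' u := by
            gcongr with u hu
            · exact hg0 u
            · exact (hk u hu).2
        _ = b * (t w * ∑ u ∈ U, m u * hit p (K \ η) A' u) := by
            simp_rw [mul_assoc, ← Finset.mul_sum]
        _ ≤ b * (t w * (a ^ 2 * (hit p K A' 0 * q))) := by gcongr
        _ = _ := by ring
    · calc t w * (hit p K A' 0 * q) ≤ t w * (a ^ 2 * ∑ u ∈ U, m u * hit p (K \ η) A' u) := by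
            gcongr
        _ = a ^ 2 * ∑ u ∈ U, (t w * m u) * hit p (K \ η) A' u := by
            simp_rw [mul_assoc, ← Finset.mul_sum]; ring
        _ ≤ a ^ 2 * ∑ u ∈ U, (b * hit p (D \ η) {u} w) * hit p (K \ η) A' u := by
            refine mul_le_mul_of_nonneg_left (Finset.sum_le_sum fun u hu => ?_) (sq_nonneg a)
            exact mul_le_mul_of_nonneg_right (hk u hu).1 (hg0 u)
        _ = a ^ 2 * (b * hit p (K \ η) A' w) := by
            rw [h3]; simp_rw [mul_assoc, ← Finset.mul_sum]
        _ = _ := by ring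
  have hKc : Disjoint Kᶜ K := disjoint_compl_left
  have hh0 : 0 ≤ hit p K A 0 := hit_nonneg p _ _ _
  have hWc : ∀ w ∈ W, hit p (K \ η) A w ≤ a ^ 4 * b ^ 2 * (hit p K A 0 * hit p (K \ η) Kᶜ w) ∧
      hit p K A 0 * hit p (K \ η) Kᶜ w ≤ a ^ 4 * b ^ 2 * hit p (K \ η) A w := by
    intro w hw
    obtain ⟨h1, h2⟩ := hWb A hA w hw
    obtain ⟨h3, h4⟩ := hWb Kᶜ hKc w hw
    rw [hK, one_mul] at h3 h4
    constructor
    · calc _ ≤ a ^ 2 * b * (t w * (hit p K A 0 * q)) := h1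
        _ = a ^ 2 * b * (hit p K A 0 * (t w * q)) := by ring
        _ ≤ a ^ 2 * b * (hit p K A 0 * (a ^ 2 * b * hit p (K \ η) Kᶜ w)) := by gcongr
        _ = _ := by ring
    · calc _ ≤ hit p K A 0 * (a ^ 2 * b * (t w * q)) := by gcongr
        _ = a ^ 2 * b * (t w * (hit p K A 0 * q)) := by ring
        _ ≤ a ^ 2 * b * (a ^ 2 * b * hit p (K \ η) A w) := by gcongr
        _ = _ := by ring
  have hyA := hmix A D₀ W hA (hD.subset hD₀D) (hD₀D.trans hDK) hηD₀ hW y hy hyη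
  have hyK := hmix Kᶜ D₀ W hKc (hD.subset hD₀D) (hD₀D.trans hDK) hηD₀ hW y hy hyη
  have hw0 : ∀ w, 0 ≤ hit p (D₀ \ η) {w} y := fun w => hit_nonneg p _ _ _
  rw [hyA, hyK, Finset.mul_sum, Finset.mul_sum, Finset.mul_sum]
  constructor
  · refine Finset.sum_le_sum fun w hw => ?_
    calc _ ≤ hit p (D₀ \ η) {w} y * (a ^ 4 * b ^ 2 * (hit p K A 0 * hit p (K \ η) Kᶜ w)) :=
          mul_le_mul_of_nonneg_left (hWc w hw).1 (hw0 w)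
      _ = _ := by ring
  · refine Finset.sum_le_sum fun w hw => ?_
    calc _ = hit p (D₀ \ η) {w} y * (hit p K A 0 * hit p (K \ η) Kᶜ w) := by ring
      _ ≤ hit p (D₀ \ η) {w} y * (a ^ 4 * b ^ 2 * hit p (K \ η) A w) :=
          mul_le_mul_of_nonneg_left (hWc w hw).2 (hw0 w)
      _ = _ := by ring

end IsStepDistribution

end Comparison

end LatticeWalk

namespace LatticeWalk

/-! ### Radial sub- and superharmonic functions -/

section Radial

variable {d : ℕ} {Λ : Submodule ℤ (EuclideanSpace ℝ (Fin d))} {p : PMF Λ}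

/-- Third order Taylor bound for the fourth root `t` of `t ^ 4`. -/
lemma taylor_fourth_root {t : ℝ} (ht : 0 ≤ t) :
    1 + (t ^ 4 - 1) / 4 - 3 / 32 * (t ^ 4 - 1) ^ 2 - 15 * |t ^ 4 - 1| ^ 3 ≤ t := by
  have key : t - (1 + (t ^ 4 - 1) / 4 - 3 / 32 * (t ^ 4 - 1) ^ 2) = (t - 1) ^ 3 *
      (3 * t ^ 5 + 9 * t ^ 4 + 18 * t ^ 3 + 30 * t ^ 2 + 31 * t + 21) / 32 := by ring
  have habs : 0 ≤ |t ^ 4 - 1| ^ 3 := by positivity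
  rcases le_total 1 t with h | h
  · have : 0 ≤ (t - 1) ^ 3 *
      (3 * t ^ 5 + 9 * t ^ 4 + 18 * t ^ 3 + 30 * t ^ 2 + 31 * t + 21) / 32 := by
      have := sub_nonneg.2 h
      positivity
    linarith
  · have h1 : (1 - t) ^ 3 ≤ |t ^ 4 - 1| ^ 3 := by
      have h0 : 0 ≤ 1 - t := by linarith
      have : 1 - t ≤ |t ^ 4 - 1| := by
        rw [abs_sub_comm]
        refine le_trans ?_ (le_abs_self _)
        have : t ^ 4 ≤ t ^ 1 := pow_le_pow_of_le_one ht h (by norm_num)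
        linarith
      gcongr
    have h2 : 3 * t ^ 5 + 9 * t ^ 4 + 18 * t ^ 3 + 30 * t ^ 2 + 31 * t + 21 ≤ 480 := by
      have := pow_le_one₀ (n := 5) ht h
      have := pow_le_one₀ (n := 4) ht h
      have := pow_le_one₀ (n := 3) ht h
      have := pow_le_one₀ (n := 2) ht h
      linarith
    have h3 : (1 - t) ^ 3 * (3 * t ^ 5 + 9 * t ^ 4 + 18 * t ^ 3 + 30 * t ^ 2 + 31 * t + 21) ≤
        |t ^ 4 - 1| ^ 3 * 480 := by gcongr
    have h4 : (t - 1) ^ 3 = -(1 - t) ^ 3 := by ring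
    rw [h4] at key
    linarith

/-- Third order Taylor bound for the inverse fourth root. -/
lemma taylor_inv_fourth_root {t : ℝ} (ht : 1 / 2 ≤ t) :
    1 / t ≤ 1 - (t ^ 4 - 1) / 4 + 5 / 32 * (t ^ 4 - 1) ^ 2 + 15 * |t ^ 4 - 1| ^ 3 := by
  have ht0 : 0 < t := by linarith
  rw [div_le_iff₀ ht0]
  have key : (1 - (t ^ 4 - 1) / 4 + 5 / 32 * (t ^ 4 - 1) ^ 2) * t - 1 = (t - 1) ^ 3 *
      (5 * t ^ 6 + 15 * t ^ 5 + 30 * t ^ 4 + 50 * t ^ 3 + 57 * t ^ 2 + 51 * t + 32) / 32 := by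
    ring
  have habs : 0 ≤ |t ^ 4 - 1| ^ 3 := by positivity
  rcases le_total 1 t with h | h
  · have : 0 ≤ (t - 1) ^ 3 *
      (5 * t ^ 6 + 15 * t ^ 5 + 30 * t ^ 4 + 50 * t ^ 3 + 57 * t ^ 2 + 51 * t + 32) / 32 := by
      have := sub_nonneg.2 h
      positivity
    nlinarith [mul_nonneg habs ht0.le]
  · have h1 : (1 - t) ^ 3 ≤ |t ^ 4 - 1| ^ 3 := by
      have h0 : 0 ≤ 1 - t := by linarith
      have : 1 - t ≤ |t ^ 4 - 1| := by
        rw [abs_sub_comm]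
        refine le_trans ?_ (le_abs_self _)
        have : t ^ 4 ≤ t ^ 1 := pow_le_pow_of_le_one ht0.le h (by norm_num)
        linarith
      gcongr
    have h2 : 5 * t ^ 6 + 15 * t ^ 5 + 30 * t ^ 4 + 50 * t ^ 3 + 57 * t ^ 2 + 51 * t + 32 ≤
        240 := by
      have := pow_le_one₀ (n := 6) ht0.le h
      have := pow_le_one₀ (n := 5) ht0.le h
      have := pow_le_one₀ (n := 4) ht0.le h
      have := pow_le_one₀ (n := 3) ht0.le h
      have := pow_le_one₀ (n := 2) ht0.le h
      linarith
    have h3 : (1 - t) ^ 3 *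
        (5 * t ^ 6 + 15 * t ^ 5 + 30 * t ^ 4 + 50 * t ^ 3 + 57 * t ^ 2 + 51 * t + 32) ≤
        |t ^ 4 - 1| ^ 3 * 240 := by gcongr
    have h4 : (t - 1) ^ 3 = -(1 - t) ^ 3 := by ring
    rw [h4] at key
    nlinarith [mul_le_mul_of_nonneg_left ht habs]

namespace IsStepDistribution

variable (hp : IsStepDistribution p)
include hp

/-- The moments of the relative increment of `‖x‖ ^ 2` along a step. -/
lemma relative_increment_moments {R : ℝ} (hR : 1 ≤ R) (hsR : ∀ s ∈ hp.steps, ‖s‖ ≤ R) {x : Λ}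
    (hx : 6 * R ≤ ‖x‖) :
    (∀ s ∈ hp.steps, |‖x + s‖ ^ 2 / ‖x‖ ^ 2 - 1| ≤ 1 / 2) ∧
    ∑ s ∈ hp.steps, (p s).toReal * (‖x + s‖ ^ 2 / ‖x‖ ^ 2 - 1) = d / ‖x‖ ^ 2 ∧
    ∑ s ∈ hp.steps, (p s).toReal * (‖x + s‖ ^ 2 / ‖x‖ ^ 2 - 1) ^ 2 ≤
      4 / ‖x‖ ^ 2 + R ^ 4 / ‖x‖ ^ 4 ∧
    ∑ s ∈ hp.steps, (p s).toReal * |‖x + s‖ ^ 2 / ‖x‖ ^ 2 - 1| ^ 3 ≤ 27 * R ^ 3 / ‖x‖ ^ 3 := by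
  have hx0 : 0 < ‖x‖ := by linarith
  set i : Λ → ℝ := fun s => inner ℝ (x : EuclideanSpace ℝ (Fin d)) (s : EuclideanSpace ℝ (Fin d))
  have hz : ∀ s : Λ, ‖x + s‖ ^ 2 / ‖x‖ ^ 2 - 1 = (2 * i s + ‖s‖ ^ 2) / ‖x‖ ^ 2 := fun s => by
    rw [norm_add_sq_coe]; field_simp; ring
  have hzb : ∀ s ∈ hp.steps, |‖x + s‖ ^ 2 / ‖x‖ ^ 2 - 1| ≤ 3 * R / ‖x‖ := by
    intro s hs
    have h1 := abs_real_inner_le_norm (x : EuclideanSpace ℝ (Fin d))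
      (s : EuclideanSpace ℝ (Fin d))
    change |i s| ≤ ‖x‖ * ‖s‖ at h1
    have h2 := hsR s hs
    have h3 : ‖x‖ * ‖s‖ ≤ ‖x‖ * R := by gcongr
    have h4 : ‖s‖ ^ 2 ≤ ‖x‖ * R := by
      rw [sq]; gcongr; linarith
    rw [hz, abs_div, abs_of_pos (show 0 < ‖x‖ ^ 2 by positivity),
      div_le_div_iff₀ (by positivity) hx0]
    have h5 : |2 * i s + ‖s‖ ^ 2| ≤ 3 * R * ‖x‖ := by
      refine (abs_add_le _ _).trans ?_
      rw [abs_mul, abs_two, abs_of_nonneg (sq_nonneg ‖s‖)]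
      linarith
    calc _ ≤ 3 * R * ‖x‖ * ‖x‖ := by gcongr
      _ = _ := by ring
  have hsum1 := hp.sum_inner (x : EuclideanSpace ℝ (Fin d))
  have hsum2 := hp.sum_norm_sq
  have hsum3 := hp.sum_inner_sq (x : EuclideanSpace ℝ (Fin d))
  change ∑ s ∈ hp.steps, (p s).toReal * i s = 0 at hsum1
  change ∑ s ∈ hp.steps, (p s).toReal * i s ^ 2 = ‖x‖ ^ 2 at hsum3
  refine ⟨fun s hs => (hzb s hs).trans ?_, ?_, ?_, ?_⟩
  · rw [div_le_div_iff₀ hx0 two_pos]; linarith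
  · have h1 : ∀ s : Λ, (p s).toReal * (‖x + s‖ ^ 2 / ‖x‖ ^ 2 - 1) =
        (2 / ‖x‖ ^ 2) * ((p s).toReal * i s) + (1 / ‖x‖ ^ 2) * ((p s).toReal * ‖s‖ ^ 2) :=
      fun s => by rw [hz]; ring
    simp_rw [h1, Finset.sum_add_distrib, ← Finset.mul_sum, hsum1, hsum2]
    ring
  · have hodd : ∑ s ∈ hp.steps, (p s).toReal * (i s * ‖s‖ ^ 2) = 0 := by
      have h := hp.sum_steps_neg fun s => i s * ‖s‖ ^ 2
      have h' : ∀ s : Λ, i (-s) = -i s := fun s => by simp [i]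
      simp only [h', norm_neg, neg_mul, mul_neg, Finset.sum_neg_distrib] at h
      linarith
    have h1 : ∀ s : Λ, (p s).toReal * (‖x + s‖ ^ 2 / ‖x‖ ^ 2 - 1) ^ 2 =
        (4 / ‖x‖ ^ 4) * ((p s).toReal * i s ^ 2) +
        (4 / ‖x‖ ^ 4) * ((p s).toReal * (i s * ‖s‖ ^ 2)) +
        (1 / ‖x‖ ^ 4) * ((p s).toReal * ‖s‖ ^ 4) :=
      fun s => by rw [hz]; ring
    have h4 : ∑ s ∈ hp.steps, (p s).toReal * ‖s‖ ^ 4 ≤ R ^ 4 := by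
      calc _ ≤ ∑ s ∈ hp.steps, (p s).toReal * R ^ 4 := by
            gcongr with s hs; exact hsR s hs
        _ = R ^ 4 := by rw [← Finset.sum_mul, hp.sum_steps, one_mul]
    simp_rw [h1, Finset.sum_add_distrib, ← Finset.mul_sum, hsum3, hodd]
    calc _ ≤ 4 / ‖x‖ ^ 4 * ‖x‖ ^ 2 + 4 / ‖x‖ ^ 4 * 0 + 1 / ‖x‖ ^ 4 * R ^ 4 := by gcongr
      _ = _ := by field_simp; ring
  · calc _ ≤ ∑ s ∈ hp.steps, (p s).toReal * (3 * R / ‖x‖) ^ 3 := by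
          gcongr with s hs; exact hzb s hs
      _ = _ := by rw [← Finset.sum_mul, hp.sum_steps]; ring

/-- In the plane, `‖x‖ ^ (1/2)` is subharmonic away from the origin. -/
lemma exists_sqrt_norm_subharmonic (hd : d = 2) :
    ∃ M : ℝ, 1 ≤ M ∧ ∀ x : Λ, M ≤ ‖x‖ → √‖x‖ ≤ avg p (fun y => √‖y‖) x := by
  obtain ⟨R, hR, hsR⟩ := hp.exists_bound
  refine ⟨8 * (R ^ 4 + 405 * R ^ 3) + 6 * R, ?_, fun x hx => ?_⟩
  · have : 0 ≤ 8 * (R ^ 4 + 405 * R ^ 3) := by positivity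
    linarith
  have h8 : 0 ≤ 8 * (R ^ 4 + 405 * R ^ 3) := by positivity
  obtain ⟨hm0, hm1, hm2, hm3⟩ := hp.relative_increment_moments hR hsR (x := x) (by linarith)
  have hx0 : 0 < ‖x‖ := by linarith
  set z : Λ → ℝ := fun s => ‖x + s‖ ^ 2 / ‖x‖ ^ 2 - 1
  have hterm : ∀ s ∈ hp.steps, (p s).toReal * (√‖x‖ * (1 + z s / 4 - 3 / 32 * z s ^ 2 -
      15 * |z s| ^ 3)) ≤ (p s).toReal * √‖x + s‖ := by
    intro s _
    have h1 := taylor_fourth_root (t := √‖x + s‖ / √‖x‖) (by positivity)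
    have h2 : (√‖x + s‖ / √‖x‖) ^ 4 - 1 = z s := by
      rw [show 4 = 2 * 2 from rfl, pow_mul, div_pow, Real.sq_sqrt (norm_nonneg _),
        Real.sq_sqrt hx0.le, div_pow]
    rw [h2, le_div_iff₀ (by positivity)] at h1
    refine mul_le_mul_of_nonneg_left ?_ ENNReal.toReal_nonneg
    linarith
  rw [hp.avg_eq_sum]
  refine le_trans ?_ (Finset.sum_le_sum hterm)
  have h1 : ∑ s ∈ hp.steps, (p s).toReal * (√‖x‖ * (1 + z s / 4 - 3 / 32 * z s ^ 2 -
      15 * |z s| ^ 3)) = √‖x‖ * (1 + 1 / 4 * ∑ s ∈ hp.steps, (p s).toReal * z s -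
      3 / 32 * ∑ s ∈ hp.steps, (p s).toReal * z s ^ 2 -
      15 * ∑ s ∈ hp.steps, (p s).toReal * |z s| ^ 3) := by
    have h0 : (1 : ℝ) + 1 / 4 * ∑ s ∈ hp.steps, (p s).toReal * z s =
        ∑ s ∈ hp.steps, (p s).toReal + 1 / 4 * ∑ s ∈ hp.steps, (p s).toReal * z s := by
      rw [hp.sum_steps]
    rw [h0]
    simp_rw [Finset.mul_sum, ← Finset.sum_add_distrib, ← Finset.sum_sub_distrib, Finset.mul_sum]
    exact Finset.sum_congr rfl fun s _ => by ring
  rw [h1]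
  refine le_mul_of_one_le_right (Real.sqrt_nonneg _) ?_
  have h2 : 3 / 32 * (R ^ 4 / ‖x‖ ^ 4) + 15 * (27 * R ^ 3 / ‖x‖ ^ 3) ≤ 1 / 8 / ‖x‖ ^ 2 := by
    have h3 : R ^ 4 / ‖x‖ ^ 4 ≤ R ^ 4 / ‖x‖ ^ 3 := by
      gcongr
      · linarith
      · norm_num
    have h4 : (R ^ 4 + 405 * R ^ 3) / ‖x‖ ^ 3 ≤ 1 / 8 / ‖x‖ ^ 2 := by
      rw [div_le_div_iff₀ (by positivity) (by positivity)]
      have : (R ^ 4 + 405 * R ^ 3) ≤ 1 / 8 * ‖x‖ := by linarith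
      calc _ ≤ 1 / 8 * ‖x‖ * ‖x‖ ^ 2 := by gcongr
        _ = _ := by ring
    have h5 : (R ^ 4 + 405 * R ^ 3) / ‖x‖ ^ 3 =
        R ^ 4 / ‖x‖ ^ 3 + 15 * (27 * R ^ 3 / ‖x‖ ^ 3) := by ring
    have h6 : 0 ≤ R ^ 4 / ‖x‖ ^ 4 := by positivity
    linarith
  rw [hm1]
  subst hd
  have h7 : (1 : ℝ) / 4 * ((2 : ℕ) / ‖x‖ ^ 2) = 3 / 32 * (4 / ‖x‖ ^ 2) + 1 / 8 / ‖x‖ ^ 2 := by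
    push_cast; ring
  linarith

/-- In dimension at least three, `‖x‖ ^ (-1/2)` is superharmonic away from the origin. -/
lemma exists_inv_sqrt_norm_superharmonic (hd : 3 ≤ d) :
    ∃ M : ℝ, 1 ≤ M ∧ ∀ x : Λ, M ≤ ‖x‖ → avg p (fun y => 1 / √‖y‖) x ≤ 1 / √‖x‖ := by
  obtain ⟨R, hR, hsR⟩ := hp.exists_bound
  refine ⟨8 * (R ^ 4 + 405 * R ^ 3) + 6 * R, ?_, fun x hx => ?_⟩
  · have : 0 ≤ 8 * (R ^ 4 + 405 * R ^ 3) := by positivity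
    linarith
  have h8 : 0 ≤ 8 * (R ^ 4 + 405 * R ^ 3) := by positivity
  obtain ⟨hm0, hm1, hm2, hm3⟩ := hp.relative_increment_moments hR hsR (x := x) (by linarith)
  have hx0 : 0 < ‖x‖ := by linarith
  set z : Λ → ℝ := fun s => ‖x + s‖ ^ 2 / ‖x‖ ^ 2 - 1
  have hterm : ∀ s ∈ hp.steps, (p s).toReal * (1 / √‖x + s‖) ≤
      (p s).toReal * (1 / √‖x‖ * (1 - z s / 4 + 5 / 32 * z s ^ 2 + 15 * |z s| ^ 3)) := by
    intro s hs
    have h2 : (√‖x + s‖ / √‖x‖) ^ 4 - 1 = z s := by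
      rw [show 4 = 2 * 2 from rfl, pow_mul, div_pow, Real.sq_sqrt (norm_nonneg _),
        Real.sq_sqrt hx0.le, div_pow]
    have h1 := taylor_inv_fourth_root (t := √‖x + s‖ / √‖x‖) (by
      by_contra! hlt
      have h3 : (√‖x + s‖ / √‖x‖) ^ 4 ≤ (1 / 2) ^ 4 := by gcongr
      have h4 := (abs_le.1 (hm0 s hs)).1
      change _ ≤ z s at h4
      rw [← h2] at h4
      linarith)
    rw [h2] at h1
    refine mul_le_mul_of_nonneg_left ?_ ENNReal.toReal_nonneg
    calc 1 / √‖x + s‖ = 1 / √‖x‖ * (1 / (√‖x + s‖ / √‖x‖)) := by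
          have : √‖x‖ ≠ 0 := by positivity
          rw [one_div_div]; field_simp
      _ ≤ _ := by gcongr
  rw [hp.avg_eq_sum]
  refine (Finset.sum_le_sum hterm).trans ?_
  have h1 : ∑ s ∈ hp.steps, (p s).toReal * (1 / √‖x‖ * (1 - z s / 4 + 5 / 32 * z s ^ 2 +
      15 * |z s| ^ 3)) = 1 / √‖x‖ * (1 - 1 / 4 * ∑ s ∈ hp.steps, (p s).toReal * z s +
      5 / 32 * ∑ s ∈ hp.steps, (p s).toReal * z s ^ 2 +
      15 * ∑ s ∈ hp.steps, (p s).toReal * |z s| ^ 3) := by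
    have h0 : (1 : ℝ) - 1 / 4 * ∑ s ∈ hp.steps, (p s).toReal * z s =
        ∑ s ∈ hp.steps, (p s).toReal - 1 / 4 * ∑ s ∈ hp.steps, (p s).toReal * z s := by
      rw [hp.sum_steps]
    rw [h0]
    simp_rw [Finset.mul_sum, ← Finset.sum_sub_distrib, ← Finset.sum_add_distrib, Finset.mul_sum]
    exact Finset.sum_congr rfl fun s _ => by ring
  rw [h1]
  refine mul_le_of_le_one_right (by positivity) ?_
  have h2 : 5 / 32 * (R ^ 4 / ‖x‖ ^ 4) + 15 * (27 * R ^ 3 / ‖x‖ ^ 3) ≤ 1 / 8 / ‖x‖ ^ 2 := by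
    have h3 : R ^ 4 / ‖x‖ ^ 4 ≤ R ^ 4 / ‖x‖ ^ 3 := by
      gcongr
      · linarith
      · norm_num
    have h4 : (R ^ 4 + 405 * R ^ 3) / ‖x‖ ^ 3 ≤ 1 / 8 / ‖x‖ ^ 2 := by
      rw [div_le_div_iff₀ (by positivity) (by positivity)]
      have : (R ^ 4 + 405 * R ^ 3) ≤ 1 / 8 * ‖x‖ := by linarith
      calc _ ≤ 1 / 8 * ‖x‖ * ‖x‖ ^ 2 := by gcongr
        _ = _ := by ring
    have h5 : (R ^ 4 + 405 * R ^ 3) / ‖x‖ ^ 3 =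
        R ^ 4 / ‖x‖ ^ 3 + 15 * (27 * R ^ 3 / ‖x‖ ^ 3) := by ring
    have h6 : 0 ≤ R ^ 4 / ‖x‖ ^ 4 := by positivity
    linarith
  rw [hm1]
  have h7 : 5 / 32 * (4 / ‖x‖ ^ 2) + 1 / 8 / ‖x‖ ^ 2 ≤ (1 : ℝ) / 4 * (d / ‖x‖ ^ 2) := by
    have h9 : 5 / 32 * (4 / ‖x‖ ^ 2) + 1 / 8 / ‖x‖ ^ 2 = (1 : ℝ) / 4 * (3 / ‖x‖ ^ 2) := by ring
    rw [h9]
    have : (3 : ℝ) ≤ d := by exact_mod_cast hd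
    gcongr
  linarith

end IsStepDistribution

end Radial

end LatticeWalk

namespace LatticeWalk

/-! ### Escape from a ball much larger than the initial one -/

section LargeRatio

variable {d : ℕ} {Λ : Submodule ℤ (EuclideanSpace ℝ (Fin d))} {p : PMF Λ}

/-- The lower bound for the probability of leaving the ball of radius `n * l` before hitting the
ball of radius `l`: of order `n ^ (-1/2)` in the plane, and of order one in higher dimensions. -/
noncomputable def escapeRate (d : ℕ) (n : ℝ) : ℝ :=
  if d = 2 then 1 / √(2 * n) else 1 / 2

/-- The arithmetic of one exit point `u`: `m` is the probability of leaving the ball at `u` from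
`0`, `k` that of leaving it at `u` while avoiding `η`, `S` that of leaving it at `u` after a visit
to `η`, and `τ` the probability of avoiding `η`. If `k + S` is close to `m` and `S` to
`(1 - τ) * m`, with relative errors `ε`, then `k` is close to `τ * m`, with a relative error of
order `ε / θ`, where `θ` is a lower bound for `τ`. -/
lemma escape_scalar_bounds {ε θ τ m k S : ℝ} (hε0 : 0 ≤ ε) (hθ0 : 0 < θ) (ht : θ ≤ τ)
    (hτ1 : τ ≤ 1) (hεθ : 4 * ε ≤ θ) (hm : 0 ≤ m) (hS0 : 0 ≤ S) (hkS : 0 ≤ k + S)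
    (hw1 : m ≤ (1 + ε) * (k + S)) (hw2 : k + S ≤ (1 + ε) * m)
    (hS1 : S ≤ (1 - τ) * ((1 + ε) * m)) (hS2 : (1 - τ) * m ≤ (1 + ε) * S) :
    τ * m ≤ (1 + 4 * (ε / θ)) * k ∧ k ≤ (1 + 4 * (ε / θ)) * (τ * m) := by
  have hετm : ε * m ≤ ε / θ * (τ * m) := by
    rw [div_mul_eq_mul_div, le_div_iff₀ hθ0]
    nlinarith [mul_nonneg hε0 hm]
  have hεm : 0 ≤ ε * m := mul_nonneg hε0 hm
  have hS3 : (1 - τ) * m - ε * m ≤ S := by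
    have h1 : (1 - ε) * ((1 - τ) * m) ≤ (1 - ε) * ((1 + ε) * S) :=
      mul_le_mul_of_nonneg_left hS2 (by linarith)
    have h2 : ε * ((1 - τ) * m) ≤ ε * (1 * m) := by gcongr; linarith
    nlinarith [mul_nonneg (mul_nonneg hε0 hε0) hS0]
  have hk_up : k ≤ τ * m + 2 * (ε * m) := by nlinarith
  have hw3 : m - ε * m ≤ k + S := by
    have h1 : (1 - ε) * m ≤ (1 - ε) * ((1 + ε) * (k + S)) :=
      mul_le_mul_of_nonneg_left hw1 (by linarith)
    nlinarith [mul_nonneg (mul_nonneg hε0 hε0) hkS]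
  have hk_lo : τ * m - 2 * (ε * m) ≤ k := by
    have h2 : (1 - τ) * (ε * m) ≤ 1 * (ε * m) := by gcongr; linarith
    nlinarith
  have hx4 : ε / θ ≤ 1 / 4 := by rw [div_le_iff₀ hθ0]; linarith
  have hx0 : 0 ≤ ε / θ := by positivity
  have hτm : 0 ≤ τ * m := mul_nonneg (hθ0.le.trans ht) hm
  constructor
  · have h1 : τ * m * (1 - 2 * (ε / θ)) ≤ k := by nlinarith
    have h2 : (1 + 4 * (ε / θ)) * (τ * m * (1 - 2 * (ε / θ))) ≤ (1 + 4 * (ε / θ)) * k := by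
      gcongr
    refine le_trans ?_ h2
    have h3 : 1 ≤ (1 + 4 * (ε / θ)) * (1 - 2 * (ε / θ)) := by nlinarith
    nlinarith
  · nlinarith [mul_nonneg hx0 hτm]

namespace IsStepDistribution

variable (hp : IsStepDistribution p)
include hp

variable [DiscreteTopology Λ]

/-- The probability of hitting `η ⊆ B` before leaving `D` is dominated on `D \ B` by a
superharmonic function that dominates it on the boundary. -/
lemma sum_hit_le_of_superharmonic (hd : 0 < d) {D B : Set Λ} (hD : D.Finite) {η : Finset Λ}
    (hηD : ↑η ⊆ D) (hηB : ↑η ⊆ B) {ψ : Λ → ℝ} (hψ : ∀ x ∈ D \ B, avg p ψ x ≤ ψ x)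
    (hin : ∀ x ∈ D \ B, ∀ s ∈ hp.steps, x + s ∈ B → 1 ≤ ψ (x + s))
    (hout : ∀ x ∈ D \ B, ∀ s ∈ hp.steps, x + s ∉ D → 0 ≤ ψ (x + s)) :
    ∀ w ∈ D \ B, ∑ v ∈ η, hit p (D \ η) {v} w ≤ ψ w := by
  have hdis : Disjoint (η : Set Λ) (D \ η) := Set.disjoint_left.2 fun v hv h => h.2 hv
  set π : Λ → ℝ := fun z => ∑ v ∈ η, hit p (D \ η) {v} z with hπ
  have h := hp.nonpos_of_subharmonic hd (hD.subset (Set.sdiff_subset (t := B)))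
    (u := fun z => π z - ψ z) (fun z hz => ?_) (fun z hz s hs h => ?_)
  · intro w hw
    have := h w hw
    linarith
  · have hzη : z ∈ D \ (η : Set Λ) := ⟨hz.1, fun h => hz.2 (hηB h)⟩
    have h1 : avg p π z = π z := by
      rw [hπ, hp.avg_sum]
      refine Finset.sum_congr rfl fun v hv => (hit_eq_avg p ?_ hzη).symm
      exact Set.disjoint_singleton_left.2 (Set.disjoint_left.1 hdis hv)
    rw [hp.avg_sub, h1]
    linarith [hψ z hz]
  · by_cases hB : z + s ∈ B
    · have h1 := hin z hz s hs hB
      have h2 := sum_hit_singleton_le_one p (D \ η) η hdis (z + s)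
      change π (z + s) ≤ 1 at h2
      linarith
    · have hnD : z + s ∉ D := fun h' => h ⟨h', hB⟩
      have h1 := hout z hz s hs hnD
      have h2 : π (z + s) = 0 := Finset.sum_eq_zero fun v hv =>
        hit_of_notMem p (fun h' => hnD h'.1) (fun h' => hnD (by
          rw [Set.mem_singleton_iff.1 h']; exact hηD hv))
      linarith

/-- From the outside of the ball of radius `4 * M * l`, the walk leaves the ball of radius `n * l`
before hitting the ball of radius `M * l` with probability at least `escapeRate d n`. -/
lemma exists_escape_bound (hd : 2 ≤ d) : ∃ M : ℝ, 1 ≤ M ∧ (∀ s ∈ hp.steps, ‖s‖ ≤ M) ∧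
    ∀ (l n : ℝ), 1 ≤ l → M ≤ n →
    ∀ η : Finset Λ, ↑η ⊆ ball Λ (M * l) → ∀ w : Λ, 4 * M * l ≤ ‖w‖ → ‖w‖ < n * l →
    ∑ v ∈ η, hit p (ball Λ (n * l) \ η) {v} w ≤ 1 - escapeRate d n := by
  obtain ⟨R, hR, hsR⟩ := hp.exists_bound
  have hd0 : 0 < d := by omega
  rcases eq_or_ne d 2 with h2 | h2
  · obtain ⟨M, hM, hsub⟩ := hp.exists_sqrt_norm_subharmonic h2
    refine ⟨max M R, le_max_of_le_left hM, fun s hs => le_max_of_le_right (hsR s hs),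
      fun l n hl hn η hη w hw hwn => ?_⟩
    set M' := max M R with hM'
    have hM'1 : 1 ≤ M' := le_max_of_le_left hM
    have hRn : R ≤ n := (le_max_right _ _).trans hn
    set A := √(M' * l)
    set B := √(n * l + R)
    have hAB : A < B := by
      refine Real.sqrt_lt_sqrt (by positivity) ?_
      have : M' * l ≤ n * l := by gcongr
      linarith
    have hBA : 0 < B - A := sub_pos.2 hAB
    have hηD : ↑η ⊆ ball Λ (n * l) := hη.trans fun x hx => lt_of_lt_of_le hx
      (mul_le_mul_of_nonneg_right hn (by linarith))
    have h := hp.sum_hit_le_of_superharmonic hd0 (finite_ball (n * l)) hηD hη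
      (ψ := fun x => (B - √‖x‖) * (B - A)⁻¹) (fun x hx => ?_) (fun x hx s hs h => ?_)
      (fun x hx s hs h => ?_) w ⟨hwn, ?_⟩
    · refine h.trans ?_
      rw [escapeRate, if_pos h2, ← div_eq_mul_inv, div_le_iff₀ hBA]
      have h1 : 2 * A ≤ √‖w‖ := by
        refine Real.le_sqrt_of_sq_le ?_
        rw [mul_pow, Real.sq_sqrt (by positivity)]
        linarith
      have h3 : 1 / √(2 * n) * B ≤ A := by
        rw [one_div_mul_eq_div, ← Real.sqrt_div' _ (by linarith)]
        refine Real.sqrt_le_sqrt ?_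
        rw [div_le_iff₀ (by linarith)]
        have h4 : R ≤ n * l := by nlinarith
        have h5 : n * l ≤ M' * l * n := by
          have : 1 * (n * l) ≤ M' * (n * l) := by
            have : 0 ≤ n * l := by linarith
            gcongr
          linarith
        linarith
      have h6 : 0 ≤ 1 / √(2 * n) * A := by positivity
      linarith
    · have hx1 : M ≤ ‖x‖ := by
        have h1 : M' * l ≤ ‖x‖ := not_lt.1 hx.2
        have h3 : M ≤ M' := le_max_left _ _
        nlinarith
      rw [hp.avg_mul_const, hp.avg_sub, hp.avg_const]
      have := hsub x hx1
      have : 0 ≤ (B - A)⁻¹ := by positivity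
      gcongr
    · rw [← div_eq_mul_inv, one_le_div hBA]
      have : √‖x + s‖ ≤ A := Real.sqrt_le_sqrt (le_of_lt h)
      linarith
    · refine mul_nonneg ?_ (by positivity)
      have : √‖x + s‖ ≤ B := by
        refine Real.sqrt_le_sqrt ((norm_add_le _ _).trans ?_)
        have h1 : ‖x‖ < n * l := hx.1
        have h3 := hsR s hs
        linarith
      linarith
    · intro h
      have : ‖w‖ < M' * l := h
      have : 0 < M' * l := by positivity
      linarith
  · obtain ⟨M, hM, hsup⟩ := hp.exists_inv_sqrt_norm_superharmonic (by omega)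
    refine ⟨max M (R + 1), le_max_of_le_left hM,
      fun s hs => le_max_of_le_right ((hsR s hs).trans (by linarith)),
    fun l n hl hn η hη w hw hwn => ?_⟩
    set M' := max M (R + 1) with hM'
    have hM'1 : 1 ≤ M' := le_max_of_le_left hM
    set A := √(M' * l)
    have hA : 0 < A := Real.sqrt_pos.2 (by positivity)
    have hηD : ↑η ⊆ ball Λ (n * l) := hη.trans fun x hx => lt_of_lt_of_le hx
      (mul_le_mul_of_nonneg_right hn (by linarith))
    have h := hp.sum_hit_le_of_superharmonic hd0 (finite_ball (n * l)) hηD hη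
      (ψ := fun x => 1 / √‖x‖ * A) (fun x hx => ?_) (fun x hx s hs h => ?_)
      (fun x hx s hs h => ?_) w ⟨hwn, ?_⟩
    · refine h.trans ?_
      rw [escapeRate, if_neg h2]
      have h1 : 2 * A ≤ √‖w‖ := by
        refine Real.le_sqrt_of_sq_le ?_
        rw [mul_pow, Real.sq_sqrt (by positivity)]
        linarith
      rw [one_div_mul_eq_div, div_le_iff₀ (by linarith)]
      linarith
    · have hx1 : M ≤ ‖x‖ := by
        have h1 : M' * l ≤ ‖x‖ := not_lt.1 hx.2
        have h3 : M ≤ M' := le_max_left _ _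
        nlinarith
      rw [hp.avg_mul_const]
      have := hsup x hx1
      gcongr
    · have h1 : R + 1 ≤ ‖x‖ := by
        have h1 : M' * l ≤ ‖x‖ := not_lt.1 hx.2
        have h3 : R + 1 ≤ M' := le_max_right _ _
        nlinarith
      have h3 : 0 < ‖x + s‖ := by
        have h4 := norm_sub_le (x + s) s
        rw [add_sub_cancel_right] at h4
        have h5 := hsR s hs
        linarith
      rw [one_div_mul_eq_div, one_le_div (Real.sqrt_pos.2 h3)]
      exact Real.sqrt_le_sqrt (le_of_lt h)
    · positivity
    · intro h
      have : ‖w‖ < M' * l := h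
      have : 0 < M' * l := by positivity
      linarith

variable [IsZLattice ℝ Λ]

/-- For `n` large, escaping `η` and leaving `K` in `A` are independent up to a relative error of
order `1 / (n * escapeRate d n)`. -/
lemma exists_escape_comparable_of_large (hd : 2 ≤ d) : ∃ C n₀ : ℝ, 0 < C ∧ 4 ≤ n₀ ∧
    ∀ (l n : ℝ) (K A : Set Λ), 1 ≤ l → n₀ ≤ n → ball Λ (n * l) ⊆ K → Disjoint A K →
    hit p K Kᶜ 0 = 1 → ∀ η : Finset Λ, ↑η ⊆ ball Λ l → (0 : Λ) ∈ η → ∀ y ∉ η,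
    (∃ x ∈ ball Λ l, ∃ s ∈ hp.steps, y = x + s) →
    hit p (K \ η) A y ≤ (1 + C / (n * escapeRate d n)) ^ 6 *
        (hit p K A 0 * hit p (K \ η) Kᶜ y) ∧
      hit p K A 0 * hit p (K \ η) Kᶜ y ≤
        (1 + C / (n * escapeRate d n)) ^ 6 * hit p (K \ η) A y := by
  obtain ⟨M, hM, hsM, hesc⟩ := hp.exists_escape_bound hd
  obtain ⟨H, hH, hhar⟩ := hp.exists_harnack
  obtain ⟨R, hR, hsR⟩ := hp.exists_bound
  set M₂ := 4 * M + R with hM₂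
  -- the relative errors of the Harnack inequality are at most `ε = 2 * H * M₂ / n`
  set E := 2 * (H * M₂) with hE
  have hE0 : 0 < E := by positivity
  refine ⟨4 * E, max (32 * E ^ 2) (8 * E) + M₂ + M + 4, by positivity, ?_,
    fun l n K A hl hn hK hA hKc η hη h0 y hyη hy => ?_⟩
  · have : 0 ≤ max (32 * E ^ 2) (8 * E) := le_max_of_le_left (by positivity)
    have : 0 < M₂ := by positivity
    linarith
  have hn1 : 32 * E ^ 2 ≤ n := by
    have := le_max_left (32 * E ^ 2) (8 * E)
    have : 0 < M₂ := by positivity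
    linarith
  have hn2 : 8 * E ≤ n := by
    have := le_max_right (32 * E ^ 2) (8 * E)
    have : 0 < M₂ := by positivity
    linarith
  have hn3 : M₂ + M + 4 ≤ n := by
    have := le_max_right (32 * E ^ 2) (8 * E)
    linarith
  have hn0 : 0 < n := by linarith
  have hl0 : 0 < l := by linarith
  have hd0 : 0 < d := by omega
  obtain ⟨U, hU, hUmem⟩ := hp.exists_isBoundary (finite_ball (Λ := Λ) (n * l))
  obtain ⟨W, hW, hWmem⟩ := hp.exists_isBoundary (finite_ball (Λ := Λ) (4 * M * l))
  set ε := E / n with hε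
  have hε0 : 0 < ε := by positivity
  set θ := escapeRate d n with hθ
  have hθ0 : 0 < θ := by
    rw [hθ, escapeRate]; split_ifs <;> positivity
  have hθ1 : θ ≤ 1 := by
    rw [hθ, escapeRate]
    split_ifs
    · rw [div_le_one (by positivity), Real.one_le_sqrt]; linarith
    · norm_num
  have hεθ : 4 * ε ≤ θ := by
    rw [hε, hθ, escapeRate]
    split_ifs
    · rw [← mul_div_assoc, div_le_div_iff₀ hn0 (by positivity), one_mul]
      have h1 : 4 * E ≤ √(n / 2) := Real.le_sqrt_of_sq_le (by linarith)
      calc 4 * E * √(2 * n) ≤ √(n / 2) * √(2 * n) := by gcongr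
        _ = n := by
          rw [← Real.sqrt_mul (by positivity), show n / 2 * (2 * n) = n ^ 2 by ring,
            Real.sqrt_sq hn0.le]
    · rw [← mul_div_assoc, div_le_div_iff₀ hn0 two_pos]; linarith
  -- Harnack's inequality for the exit distributions
  have hHar : ∀ u ∈ U, ∀ x : Λ, ‖x‖ ≤ M₂ * l →
      hit p (ball Λ (n * l)) {u} 0 ≤ (1 + ε) * hit p (ball Λ (n * l)) {u} x ∧
      hit p (ball Λ (n * l)) {u} x ≤ (1 + ε) * hit p (ball Λ (n * l)) {u} 0 := by
    intro u hu x hx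
    have hudis : Disjoint {u} (ball Λ (n * l)) :=
      Set.disjoint_singleton_left.2 fun h => Set.disjoint_left.1 hU.1 hu h
    have h1 : H * ‖x‖ ≤ H * M₂ * l := by rw [mul_assoc]; gcongr
    have h1n : H * M₂ * l ≤ n * l := by gcongr; linarith
    have h2 := hhar (n * l) (hit p (ball Λ (n * l)) {u}) 0 (by positivity)
      (hit_nonneg p _ _) (fun z hz => (hit_eq_avg p hudis (by rwa [sub_zero] at hz)).symm) x
      (by rw [sub_zero]; exact h1.trans h1n)
    rw [sub_zero] at h2
    have h3 : Real.exp (H * ‖x‖ / (n * l)) ≤ 1 + ε := by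
      have h4 : H * ‖x‖ / (n * l) ≤ ε / 2 := by
        rw [hε, div_div, div_le_div_iff₀ (by positivity) (by positivity)]
        calc H * ‖x‖ * (n * 2) ≤ H * M₂ * l * (n * 2) := by gcongr
          _ = E * (n * l) := by rw [hE]; ring
      have h5 : ε ≤ 1 := by linarith
      calc Real.exp (H * ‖x‖ / (n * l)) ≤ Real.exp (ε / 2) := Real.exp_le_exp.2 h4
        _ ≤ 1 + ε := by
          have h6 := Real.abs_exp_sub_one_le (x := ε / 2) (by
            rw [abs_of_pos (by linarith)]; linarith)
          have h7 := (abs_le.1 h6).2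
          rw [abs_of_pos (show 0 < ε / 2 by linarith)] at h7
          linarith
    exact ⟨h2.2.trans (mul_le_mul_of_nonneg_right h3 (hit_nonneg p _ _ _)),
      h2.1.trans (mul_le_mul_of_nonneg_right h3 (hit_nonneg p _ _ _))⟩
  have hηM₂ : ∀ v ∈ η, ‖v‖ ≤ M₂ * l := fun v hv => by
    have h1 : ‖v‖ < l := hη hv
    nlinarith
  have hηM : ↑η ⊆ ball Λ (M * l) := fun v hv => by
    have h1 : ‖v‖ < l := hη hv
    change ‖v‖ < M * l
    nlinarith
  have hsub1 : ball Λ (M * l) ⊆ ball Λ (4 * M * l) := fun x hx => by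
    change ‖x‖ < 4 * M * l
    have h1 : ‖x‖ < M * l := hx
    have : 0 < M * l := by positivity
    linarith
  have hsub2 : ball Λ (4 * M * l) ⊆ ball Λ (n * l) := fun x hx => by
    change ‖x‖ < n * l
    refine lt_of_lt_of_le hx ?_
    gcongr
    linarith
  have hWn : ∀ w ∈ W, 4 * M * l ≤ ‖w‖ ∧ ‖w‖ ≤ M₂ * l := fun w hw => by
    refine ⟨not_lt.1 fun h => Set.disjoint_left.1 hW.1 hw h, ?_⟩
    obtain ⟨x, hx, s, hs, rfl⟩ := hWmem w hw
    have h1 : ‖x‖ < 4 * M * l := hx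
    have h3 := hsR s hs
    have h4 := norm_add_le x s
    nlinarith
  have hM₂n : M₂ * l < n * l := by gcongr; linarith
  obtain ⟨x, hx, s, hs, rfl⟩ := hy
  have hyD : x + s ∈ ball Λ (4 * M * l) := by
    have h1 : ‖x‖ < l := hx
    have h3 := hsM s hs
    have h4 := norm_add_le x s
    change ‖x + s‖ < 4 * M * l
    nlinarith
  set t : Λ → ℝ := fun w => 1 - ∑ v ∈ η, hit p (ball Λ (n * l) \ η) {v} w
  have hcmp := hp.escape_comparable hd0 hA hKc
    (finite_ball (n * l)) hK ((hηM.trans hsub1).trans hsub2) h0 hU (a := 1 + ε)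
    (b := 1 + 4 * (ε / θ)) (by positivity) (by positivity)
    (fun v hv u hu => hHar u hu v (hηM₂ v hv)) hsub2 hW (hηM.trans hsub1)
    (fun w hw => lt_of_le_of_lt (hWn w hw).2 hM₂n) t (fun w hw => by
      have ht : θ ≤ t w := by
        have := hesc l n hl (by linarith) η hηM w (hWn w hw).1
          (lt_of_le_of_lt (hWn w hw).2 hM₂n)
        change θ ≤ 1 - _
        linarith
      have ht0 : 0 < t w := hθ0.trans_le ht
      refine ⟨ht0.le, fun u hu => ?_⟩
      have hudis : Disjoint {u} (ball Λ (n * l)) :=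
        Set.disjoint_singleton_left.2 fun h => Set.disjoint_left.1 hU.1 hu h
      have hdec := hit_eq_hit_sdiff_add p (ball Λ (n * l)) {u} hudis η
        ((hηM.trans hsub1).trans hsub2) w
      set m := hit p (ball Λ (n * l)) {u} 0
      have hm : 0 ≤ m := hit_nonneg p _ _ _
      obtain ⟨hw1, hw2⟩ := hHar u hu w (hWn w hw).2
      set k := hit p (ball Λ (n * l) \ η) {u} w
      set π := ∑ v ∈ η, hit p (ball Λ (n * l) \ η) {v} w with hπ
      have htπ : t w = 1 - π := rfl
      have hπ0 : 0 ≤ π := Finset.sum_nonneg fun v _ => hit_nonneg p _ _ _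
      set S := ∑ v ∈ η, hit p (ball Λ (n * l) \ η) {v} w * hit p (ball Λ (n * l)) {u} v
      have hS1 : S ≤ π * ((1 + ε) * m) := by
        rw [hπ, Finset.sum_mul]
        refine Finset.sum_le_sum fun v hv => ?_
        exact mul_le_mul_of_nonneg_left (hHar u hu v (hηM₂ v hv)).2 (hit_nonneg p _ _ _)
      have hS2 : π * m ≤ (1 + ε) * S := by
        rw [hπ, Finset.sum_mul, Finset.mul_sum]
        refine Finset.sum_le_sum fun v hv => ?_
        have := mul_le_mul_of_nonneg_left (hHar u hu v (hηM₂ v hv)).1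
          (hit_nonneg p (ball Λ (n * l) \ η) {v} w)
        linarith
      refine escape_scalar_bounds (S := S) hε0.le hθ0 ht (by rw [htπ]; linarith) hεθ hm
        ?_ ?_ ?_ ?_ ?_ ?_
      · exact Finset.sum_nonneg fun v _ => mul_nonneg (hit_nonneg p _ _ _) (hit_nonneg p _ _ _)
      · rw [← hdec]; exact hit_nonneg p _ _ _
      · rw [← hdec]; exact hw1
      · rw [← hdec]; exact hw2
      · rwa [htπ, sub_sub_cancel]
      · rwa [htπ, sub_sub_cancel]) hyD hyη
  have hfac : (1 + ε) ^ 4 * (1 + 4 * (ε / θ)) ^ 2 ≤ (1 + 4 * E / (n * θ)) ^ 6 := by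
    have h1 : 4 * E / (n * θ) = 4 * (ε / θ) := by rw [hε]; field_simp
    have h2 : ε ≤ 4 * (ε / θ) := by
      have : ε ≤ ε / θ := by rw [le_div_iff₀ hθ0]; nlinarith
      linarith
    rw [h1]
    calc (1 + ε) ^ 4 * (1 + 4 * (ε / θ)) ^ 2
        ≤ (1 + 4 * (ε / θ)) ^ 4 * (1 + 4 * (ε / θ)) ^ 2 := by gcongr
      _ = _ := by ring
  have hh0 : 0 ≤ hit p K A 0 * hit p (K \ η) Kᶜ (x + s) :=
    mul_nonneg (hit_nonneg p _ _ _) (hit_nonneg p _ _ _)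
  exact ⟨hcmp.1.trans (mul_le_mul_of_nonneg_right hfac hh0),
    hcmp.2.trans (mul_le_mul_of_nonneg_right hfac (hit_nonneg p _ _ _))⟩

end IsStepDistribution

end LargeRatio

end LatticeWalk

namespace LatticeWalk

/-! ### Escape from a ball of comparable radius -/

section BoundedRatio

variable {d : ℕ} {Λ : Submodule ℤ (EuclideanSpace ℝ (Fin d))} {p : PMF Λ}

lemma isPreconnected_annulus (hd : 2 ≤ d) {r r' : ℝ} (hr : 0 < r) :
    IsPreconnected {x : EuclideanSpace ℝ (Fin d) | r ≤ ‖x‖ ∧ ‖x‖ ≤ r'} := by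
  have hrank : 1 < Module.rank ℝ (EuclideanSpace ℝ (Fin d)) := by
    rw [← Module.finrank_eq_rank, finrank_euclideanSpace_fin]
    exact_mod_cast hd
  have h1 := ((isPreconnected_sphere hrank (0 : EuclideanSpace ℝ (Fin d)) 1).prod
    (isPreconnected_Icc (a := r) (b := r'))).image (fun z => z.2 • z.1)
    (Continuous.continuousOn (by fun_prop))
  convert h1 using 1
  ext x
  constructor
  · rintro ⟨h2, h3⟩
    have h0 : ‖x‖ ≠ 0 := by linarith
    refine ⟨(‖x‖⁻¹ • x, ‖x‖), ⟨?_, h2, h3⟩, ?_⟩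
    · simp [norm_smul, h0]
    · simp [smul_smul, h0]
  · rintro ⟨⟨y, t⟩, ⟨h2, h3, h4⟩, rfl⟩
    have h5 : ‖y‖ = 1 := by simpa using h2
    have h6 : ‖t • y‖ = t := by
      rw [norm_smul, h5, mul_one, Real.norm_of_nonneg]
      exact hr.le.trans h3
    exact ⟨h6.symm ▸ h3, h6.symm ▸ h4⟩

namespace IsStepDistribution

variable (hp : IsStepDistribution p)
include hp

variable [DiscreteTopology Λ] [IsZLattice ℝ Λ]

/-- Harnack inequality on a compact connected set, uniformly over large dilations. -/
theorem exists_harnack_of_isPreconnected {S U : Set (EuclideanSpace ℝ (Fin d))}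
    (hS : IsCompact S) (hSc : IsPreconnected S) (hU : IsOpen U) (hSU : S ⊆ U) :
    ∃ C l₀ : ℝ, 0 < C ∧ 0 < l₀ ∧ ∀ l : ℝ, l₀ ≤ l → ∀ f : Λ → ℝ, (∀ x, 0 ≤ f x) →
      (∀ x : Λ, l⁻¹ • (x : EuclideanSpace ℝ (Fin d)) ∈ U → avg p f x = f x) →
      ∀ a b : Λ, l⁻¹ • (a : EuclideanSpace ℝ (Fin d)) ∈ S →
        l⁻¹ • (b : EuclideanSpace ℝ (Fin d)) ∈ S → f a ≤ C * f b := by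
  obtain ⟨H, hH, hhar⟩ := hp.exists_harnack
  obtain ⟨ρ, hρ, hcov⟩ := exists_covering_radius (Λ := Λ)
  obtain ⟨δ, hδ, hthick⟩ := hS.exists_thickening_subset_open hU hSU
  set κ := δ / (6 * H) with hκ
  have hκ0 : 0 < κ := by positivity
  have hκδ : κ ≤ δ / 6 := by
    rw [hκ]
    gcongr
    linarith
  have h3κ : H * (3 * κ) = δ / 2 := by rw [hκ]; field_simp; norm_num
  have hscale : ∀ (l : ℝ), 0 < l → ∀ (a : Λ) (x : EuclideanSpace ℝ (Fin d)),
      ‖l⁻¹ • (a : EuclideanSpace ℝ (Fin d)) - x‖ =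
        ‖(a : EuclideanSpace ℝ (Fin d)) - l • x‖ / l := by
    intro l hl a x
    have : l⁻¹ • (a : EuclideanSpace ℝ (Fin d)) - x =
        l⁻¹ • ((a : EuclideanSpace ℝ (Fin d)) - l • x) := by
      rw [smul_sub, smul_smul, inv_mul_cancel₀ hl.ne', one_smul]
    rw [this, norm_smul, norm_inv, Real.norm_of_nonneg hl.le]
    ring
  -- lattice points near `l • x` and near `l • y` have comparable values
  let P : EuclideanSpace ℝ (Fin d) → EuclideanSpace ℝ (Fin d) → Prop := fun x y =>
    ∃ C l₀ : ℝ, 0 < C ∧ 0 < l₀ ∧ ∀ l : ℝ, l₀ ≤ l → ∀ f : Λ → ℝ, (∀ x, 0 ≤ f x) →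
      (∀ x : Λ, l⁻¹ • (x : EuclideanSpace ℝ (Fin d)) ∈ U → avg p f x = f x) →
      ∀ a b : Λ, ‖(a : EuclideanSpace ℝ (Fin d)) - l • x‖ ≤ κ * l →
        ‖(b : EuclideanSpace ℝ (Fin d)) - l • y‖ ≤ κ * l → f a ≤ C * f b ∧ f b ≤ C * f a
  have hP : ∀ x ∈ S, ∀ y ∈ S, P x y := by
    intro x hx y hy
    refine hSc.induction₂ P ?_ ?_ ?_ hx hy
    · intro x hx
      refine Filter.eventually_of_mem (inter_mem_nhdsWithin S (Metric.ball_mem_nhds x hκ0)) ?_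
      rintro y ⟨hy, hxy⟩
      refine ⟨Real.exp 1, 1, Real.exp_pos 1, one_pos, fun l hl f hf hharm a b ha hb => ?_⟩
      have hl0 : 0 < l := by linarith
      have hab : ‖a - b‖ ≤ 3 * κ * l := by
        have h1 : (a : EuclideanSpace ℝ (Fin d)) - b = ((a : EuclideanSpace ℝ (Fin d)) - l • x) +
            l • (x - y) - ((b : EuclideanSpace ℝ (Fin d)) - l • y) := by
          rw [smul_sub]; abel
        have h2 : ‖l • (x - y)‖ ≤ κ * l := by
          rw [norm_smul, Real.norm_of_nonneg hl0.le, mul_comm, norm_sub_rev, ← dist_eq_norm]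
          have := (Metric.mem_ball.1 hxy).le
          gcongr
        change ‖(a : EuclideanSpace ℝ (Fin d)) - b‖ ≤ _
        rw [h1]
        have h3 := norm_sub_le (((a : EuclideanSpace ℝ (Fin d)) - l • x) +
            l • (x - y)) ((b : EuclideanSpace ℝ (Fin d)) - l • y)
        have h4 := norm_add_le ((a : EuclideanSpace ℝ (Fin d)) - l • x) (l • (x - y))
        linarith
      have hHab : H * ‖a - b‖ ≤ δ / 2 * l := by
        calc H * ‖a - b‖ ≤ H * (3 * κ * l) := by gcongr
          _ = δ / 2 * l := by rw [← h3κ]; ring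
      have hr : 0 < δ / 2 * l := by positivity
      have h := hhar (δ / 2 * l) f b hr hf (fun z hz => hharm z (hthick ?_)) a hHab
      · have hexp : Real.exp (H * ‖a - b‖ / (δ / 2 * l)) ≤ Real.exp 1 :=
          Real.exp_le_exp.2 ((div_le_one hr).2 hHab)
        exact ⟨h.1.trans (mul_le_mul_of_nonneg_right hexp (hf b)),
          h.2.trans (mul_le_mul_of_nonneg_right hexp (hf a))⟩
      · refine Metric.mem_thickening_iff.2 ⟨y, hy, ?_⟩
        rw [dist_eq_norm, hscale l hl0, div_lt_iff₀ hl0]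
        have h1 : (z : EuclideanSpace ℝ (Fin d)) - l • y = ((z : EuclideanSpace ℝ (Fin d)) - b) +
            ((b : EuclideanSpace ℝ (Fin d)) - l • y) := by abel
        rw [h1]
        have h2 := norm_add_le ((z : EuclideanSpace ℝ (Fin d)) - b)
          ((b : EuclideanSpace ℝ (Fin d)) - l • y)
        have h3 : ‖(z : EuclideanSpace ℝ (Fin d)) - b‖ < δ / 2 * l := hz
        have h4 : κ * l ≤ δ / 6 * l := by gcongr
        have h5 : 0 < δ * l := by positivity
        linarith
    · rintro x y z - - - ⟨C₁, l₁, hC₁, hl₁, h₁⟩ ⟨C₂, l₂, hC₂, hl₂, h₂⟩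
      refine ⟨C₁ * C₂, l₁ + l₂ + ρ / κ, by positivity, by positivity,
        fun l hl f hf hharm a b ha hb => ?_⟩
      have hρκ : 0 < ρ / κ := by positivity
      obtain ⟨c, hc⟩ := hcov (l • y)
      have hc' : ‖(c : EuclideanSpace ℝ (Fin d)) - l • y‖ ≤ κ * l := by
        refine hc.trans ?_
        rw [mul_comm, ← div_le_iff₀ hκ0]
        linarith
      obtain ⟨h3, h4⟩ := h₁ l (by linarith) f hf hharm a c ha hc'
      obtain ⟨h5, h6⟩ := h₂ l (by linarith) f hf hharm c b hc' hb
      constructor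
      · calc f a ≤ C₁ * f c := h3
          _ ≤ C₁ * (C₂ * f b) := by gcongr
          _ = _ := by ring
      · calc f b ≤ C₂ * f c := h6
          _ ≤ C₂ * (C₁ * f a) := by gcongr
          _ = _ := by ring
    · rintro x y - - ⟨C, l₀, hC, hl₀, h⟩
      exact ⟨C, l₀, hC, hl₀, fun l hl f hf hharm a b ha hb =>
        (h l hl f hf hharm b a hb ha).symm⟩
  obtain ⟨t, htS, htf, hcover⟩ := hS.finite_cover_balls hκ0
  have hPt : ∀ z : t × t, P z.1 z.2 := fun z => hP _ (htS z.1.2) _ (htS z.2.2)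
  choose C l₀ hC hl₀ h using hPt
  have := htf.fintype
  refine ⟨∑ z, C z + 1, ∑ z, l₀ z + 1, ?_, ?_, fun l hl f hf hharm a b ha hb => ?_⟩
  · have : 0 ≤ ∑ z, C z := Finset.sum_nonneg fun z _ => (hC z).le
    linarith
  · have : 0 ≤ ∑ z, l₀ z := Finset.sum_nonneg fun z _ => (hl₀ z).le
    linarith
  have hl0 : 0 < l := by
    have : 0 ≤ ∑ z, l₀ z := Finset.sum_nonneg fun z _ => (hl₀ z).le
    linarith
  obtain ⟨x, hx, hax⟩ := Set.mem_iUnion₂.1 (hcover ha)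
  obtain ⟨y, hy, hby⟩ := Set.mem_iUnion₂.1 (hcover hb)
  have hnear : ∀ (a : Λ) (x : EuclideanSpace ℝ (Fin d)),
      l⁻¹ • (a : EuclideanSpace ℝ (Fin d)) ∈ Metric.ball x κ →
      ‖(a : EuclideanSpace ℝ (Fin d)) - l • x‖ ≤ κ * l := by
    intro a x h
    rw [Metric.mem_ball, dist_eq_norm, hscale l hl0, div_lt_iff₀ hl0] at h
    exact h.le
  have hlz : l₀ (⟨x, hx⟩, ⟨y, hy⟩) ≤ l := by
    have := Finset.single_le_sum (f := l₀) (fun z _ => (hl₀ z).le)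
      (Finset.mem_univ ((⟨x, hx⟩, ⟨y, hy⟩) : t × t))
    linarith
  refine (h (⟨x, hx⟩, ⟨y, hy⟩) l hlz f hf hharm a b (hnear a x hax) (hnear b y hby)).1.trans ?_
  refine mul_le_mul_of_nonneg_right ?_ (hf b)
  have := Finset.single_le_sum (f := C) (fun z _ => (hC z).le)
    (Finset.mem_univ ((⟨x, hx⟩, ⟨y, hy⟩) : t × t))
  linarith

/-- Up to a constant, the walk started at distance about `2 * l` leaves the ball of radius `4 * l`
at any given point without visiting the ball of radius `l` as likely as the walk started
at `0` leaves at that point. -/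
lemma exists_hit_zero_le_hit_annulus (hd : 2 ≤ d) : ∃ C l₀ : ℝ, 0 < C ∧ 0 < l₀ ∧
    ∀ l : ℝ, l₀ ≤ l → ∀ u ∉ ball Λ (4 * l), ∀ w : Λ, 2 * l ≤ ‖w‖ → ‖w‖ ≤ 5 / 2 * l →
    hit p (ball Λ (4 * l)) {u} 0 ≤ C * hit p (ball Λ (4 * l) \ ball Λ l) {u} w := by
  obtain ⟨R, hR, hsR⟩ := hp.exists_bound
  have hd0 : 0 < d := by omega
  obtain ⟨C, l₁, hC, hl₁, hharn⟩ := hp.exists_harnack_of_isPreconnected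
    (S := {x | 2 ≤ ‖x‖ ∧ ‖x‖ ≤ 5 / 2}) (U := {x | 1 < ‖x‖ ∧ ‖x‖ < 4})
    ((isCompact_closedBall (0 : EuclideanSpace ℝ (Fin d)) (5 / 2)).of_isClosed_subset
      ((isClosed_le continuous_const continuous_norm).inter
        (isClosed_le continuous_norm continuous_const))
      fun x hx => by simpa using hx.2)
    (isPreconnected_annulus hd two_pos)
    ((isOpen_lt continuous_const continuous_norm).inter
      (isOpen_lt continuous_norm continuous_const))
    fun x hx => ⟨by linarith [hx.1], by linarith [hx.2]⟩
  refine ⟨8 * C, l₁ + 2 * R, by positivity, by positivity, fun l hl u hu w hw hw' => ?_⟩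
  have hl0 : 0 < l := by linarith
  have hlR : 2 * R ≤ l := by linarith
  have hnorm : ∀ x : Λ, ‖l⁻¹ • (x : EuclideanSpace ℝ (Fin d))‖ = ‖x‖ / l := fun x => by
    rw [norm_smul, norm_inv, Real.norm_of_nonneg hl0.le]
    change l⁻¹ * ‖x‖ = _
    ring
  set H := hit p (ball Λ (4 * l)) {u}
  set k := hit p (ball Λ (4 * l) \ ball Λ l) {u}
  have hudis : Disjoint {u} (ball Λ (4 * l)) := Set.disjoint_singleton_left.2 hu
  have hHharm : ∀ x ∈ ball Λ (4 * l), avg p H x = H x := fun x hx => (hit_eq_avg p hudis hx).symm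
  have hkharm : ∀ x ∈ ball Λ (4 * l) \ ball Λ l, avg p k x = k x := fun x hx =>
    (hit_eq_avg p (hudis.mono_right Set.sdiff_subset) hx).symm
  -- a maximum point of `H` on the shell
  obtain ⟨w₁, ⟨hw₁, hw₁'⟩, hmax⟩ := Set.exists_max_image
    {x : Λ | 2 * l ≤ ‖x‖ ∧ ‖x‖ ≤ 5 / 2 * l} H
    ((finite_ball (4 * l)).subset fun x hx => by
      change ‖x‖ < 4 * l
      linarith [hx.2]) ⟨w, hw, hw'⟩
  have hmaxin : ∀ x ∈ ball Λ (2 * l), H x ≤ H w₁ := by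
    intro x hx
    have := hp.nonpos_of_subharmonic hd0 (finite_ball (Λ := Λ) (2 * l))
      (u := fun x => H x - H w₁) (fun z hz => ?_) (fun z hz s hs h => ?_) x hx
    · linarith
    · rw [hp.avg_sub, hp.avg_const, hHharm z]
      change ‖z‖ < 4 * l
      have : ‖z‖ < 2 * l := hz
      linarith
    · have h1 : ‖z‖ < 2 * l := hz
      have h2 := hsR s hs
      have h3 := norm_add_le z s
      exact sub_nonpos.2 (hmax _ ⟨not_lt.1 h, by linarith⟩)
  have hHw₁ : 0 ≤ H w₁ := hit_nonneg p _ _ _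
  -- `H` exceeds `k` at most by a superharmonic function `ψ` that is at least `H w₁` on the inner
  -- ball, nonnegative where the walk can leave the outer ball, and at most `7 / 8 * H w₁` at `w₁`
  set B := (4 * l + R) ^ 2 - l ^ 2 with hB
  have hB0 : 0 < B := by rw [hB]; nlinarith
  set ψ : Λ → ℝ := fun x => ((4 * l + R) ^ 2 - ‖x‖ ^ 2) * (H w₁ / B) with hψ
  have hHB : 0 ≤ H w₁ / B := by positivity
  have hcmp := hp.nonpos_of_subharmonic hd0
    ((finite_ball (Λ := Λ) (4 * l)).subset (Set.sdiff_subset (t := ball Λ l)))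
    (u := fun x => H x - (k x + ψ x)) (fun z hz => ?_) (fun z hz s hs h => ?_)
  · have hw₁D : w₁ ∈ ball Λ (4 * l) \ ball Λ l := by
      refine ⟨?_, fun h => ?_⟩
      · change ‖w₁‖ < 4 * l
        linarith
      · have : ‖w₁‖ < l := h
        linarith
    have h1 := hcmp w₁ hw₁D
    have h2 : ψ w₁ ≤ 7 / 8 * H w₁ := by
      simp only [hψ]
      rw [← mul_div_assoc, div_le_iff₀ hB0]
      have h3 : (2 * l) ^ 2 ≤ ‖w₁‖ ^ 2 := by gcongr
      have h4 : (4 * l + R) ^ 2 - ‖w₁‖ ^ 2 ≤ 7 / 8 * B := by rw [hB]; nlinarith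
      calc _ ≤ 7 / 8 * B * H w₁ := by gcongr
        _ = _ := by ring
    have h5 : H w₁ ≤ 8 * k w₁ := by linarith
    have hS : ∀ x : Λ, 2 * l ≤ ‖x‖ → ‖x‖ ≤ 5 / 2 * l →
        l⁻¹ • (x : EuclideanSpace ℝ (Fin d)) ∈
          {x : EuclideanSpace ℝ (Fin d) | 2 ≤ ‖x‖ ∧ ‖x‖ ≤ 5 / 2} := fun x h h' => by
      refine ⟨?_, ?_⟩
      · rw [hnorm, le_div_iff₀ hl0]; exact h
      · rw [hnorm, div_le_iff₀ hl0]; exact h'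
    have h6 := hharn l (by linarith) k (hit_nonneg p _ _) (fun x hx => hkharm x (by
      obtain ⟨h7, h8⟩ := hx
      rw [hnorm, lt_div_iff₀ hl0, one_mul] at h7
      rw [hnorm, div_lt_iff₀ hl0] at h8
      exact ⟨h8, not_lt.2 h7.le⟩)) w₁ w (hS _ hw₁ hw₁') (hS _ hw hw')
    have h7 : H 0 ≤ H w₁ := hmaxin 0 (by
      change ‖(0 : Λ)‖ < 2 * l
      rw [norm_zero]; positivity)
    linarith
  · have h1 : avg p ψ z = ψ z - d * (H w₁ / B) := by
      rw [hψ, hp.avg_mul_const, hp.avg_sub, hp.avg_const, hp.avg_norm_sq]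
      ring
    rw [hp.avg_sub, hp.avg_add, hHharm z hz.1, hkharm z hz, h1]
    have : 0 ≤ d * (H w₁ / B) := by positivity
    linarith
  · by_cases hin : z + s ∈ ball Λ l
    · have h1 : ‖z + s‖ < l := hin
      have h2 : H (z + s) ≤ H w₁ := hmaxin _ (by change ‖z + s‖ < 2 * l; linarith)
      have h3 : H w₁ ≤ ψ (z + s) := by
        simp only [hψ]
        rw [← mul_div_assoc, le_div_iff₀ hB0, mul_comm]
        have h5 : ‖z + s‖ ^ 2 ≤ l ^ 2 := by gcongr
        have h6 : B ≤ (4 * l + R) ^ 2 - ‖z + s‖ ^ 2 := by rw [hB]; linarith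
        gcongr
      have h4 : 0 ≤ k (z + s) := hit_nonneg p _ _ _
      linarith
    · have hout : z + s ∉ ball Λ (4 * l) := fun h' => h ⟨h', hin⟩
      have h1 : H (z + s) = k (z + s) := by
        by_cases hus : z + s ∈ ({u} : Set Λ)
        · simp only [H, k]
          rw [hit_of_mem p hus, hit_of_mem p hus]
        · simp only [H, k]
          rw [hit_of_notMem p hout hus, hit_of_notMem p h hus]
      have h2 : 0 ≤ ψ (z + s) := by
        refine mul_nonneg ?_ hHB
        have h3 : ‖z‖ < 4 * l := hz.1
        have h4 := norm_add_le z s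
        have h5 := hsR s hs
        have : ‖z + s‖ ^ 2 ≤ (4 * l + R) ^ 2 := by gcongr; linarith
        linarith
      linarith

/-- For `l` large, escaping `η` and leaving `K` in `A` are independent up to a constant. -/
lemma exists_escape_comparable_of_scale (hd : 2 ≤ d) : ∃ C l₀ : ℝ, 0 < C ∧ 0 < l₀ ∧
    ∀ (l : ℝ) (K A : Set Λ), l₀ ≤ l → ball Λ (4 * l) ⊆ K → Disjoint A K →
    hit p K Kᶜ 0 = 1 → ∀ η : Finset Λ, ↑η ⊆ ball Λ l → (0 : Λ) ∈ η → ∀ y ∉ η,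
    (∃ x ∈ ball Λ l, ∃ s ∈ hp.steps, y = x + s) →
    hit p (K \ η) A y ≤ C * (hit p K A 0 * hit p (K \ η) Kᶜ y) ∧
      hit p K A 0 * hit p (K \ η) Kᶜ y ≤ C * hit p (K \ η) A y := by
  obtain ⟨R, hR, hsR⟩ := hp.exists_bound
  have hd0 : 0 < d := by omega
  obtain ⟨a, l₁, ha, hl₁, hharn⟩ := hp.exists_harnack_of_isPreconnected
    (S := Metric.closedBall 0 (5 / 2)) (U := Metric.ball 0 4)
    (isCompact_closedBall (0 : EuclideanSpace ℝ (Fin d)) (5 / 2))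
    (convex_closedBall _ _).isPreconnected Metric.isOpen_ball
    (Metric.closedBall_subset_ball (by norm_num))
  obtain ⟨C₂, l₂, hC₂, hl₂, hann⟩ := hp.exists_hit_zero_le_hit_annulus hd
  refine ⟨a ^ 4 * (a + C₂) ^ 2, l₁ + l₂ + 2 * R, by positivity, by positivity,
    fun l K A hl hK hA hKc η hη h0 y hyη hy => ?_⟩
  have hl0 : 0 < l := by linarith
  have hnorm : ∀ x : Λ, ‖x‖ ≤ 5 / 2 * l →
      l⁻¹ • (x : EuclideanSpace ℝ (Fin d)) ∈ Metric.closedBall 0 (5 / 2) := fun x hx => by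
    rw [mem_closedBall_zero_iff, norm_smul, norm_inv, Real.norm_of_nonneg hl0.le,
      inv_mul_le_iff₀ hl0]
    linarith [show ‖(x : EuclideanSpace ℝ (Fin d))‖ ≤ 5 / 2 * l from hx]
  obtain ⟨U, hU, -⟩ := hp.exists_isBoundary (finite_ball (Λ := Λ) (4 * l))
  obtain ⟨W, hW, hWmem⟩ := hp.exists_isBoundary (finite_ball (Λ := Λ) (2 * l))
  have hHar : ∀ u ∈ U, ∀ x z : Λ, ‖x‖ ≤ 5 / 2 * l → ‖z‖ ≤ 5 / 2 * l →
      hit p (ball Λ (4 * l)) {u} x ≤ a * hit p (ball Λ (4 * l)) {u} z := by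
    intro u hu x z hx hz
    have hudis : Disjoint {u} (ball Λ (4 * l)) :=
      Set.disjoint_singleton_left.2 fun h => Set.disjoint_left.1 hU.1 hu h
    refine hharn l (by linarith) _ (hit_nonneg p _ _) (fun w hw => (hit_eq_avg p hudis ?_).symm)
      x z (hnorm x hx) (hnorm z hz)
    rw [mem_ball_zero_iff, norm_smul, norm_inv, Real.norm_of_nonneg hl0.le,
      inv_mul_lt_iff₀ hl0, mul_comm] at hw
    exact hw
  have h0n : ‖(0 : Λ)‖ ≤ 5 / 2 * l := by rw [norm_zero]; positivity
  have hηn : ∀ v ∈ η, ‖v‖ ≤ 5 / 2 * l := fun v hv => by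
    have : ‖v‖ < l := hη hv
    linarith
  have hsub1 : ball Λ l ⊆ ball Λ (2 * l) := fun x hx => by
    change ‖x‖ < 2 * l
    linarith [show ‖x‖ < l from hx]
  have hsub2 : ball Λ (2 * l) ⊆ ball Λ (4 * l) := fun x hx => by
    change ‖x‖ < 4 * l
    linarith [show ‖x‖ < 2 * l from hx]
  have hWn : ∀ w ∈ W, 2 * l ≤ ‖w‖ ∧ ‖w‖ ≤ 5 / 2 * l := fun w hw => by
    refine ⟨not_lt.1 fun h => Set.disjoint_left.1 hW.1 hw h, ?_⟩
    obtain ⟨x, hx, s, hs, rfl⟩ := hWmem w hw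
    have h1 : ‖x‖ < 2 * l := hx
    have h3 := hsR s hs
    have h4 := norm_add_le x s
    linarith
  refine hp.escape_comparable hd0 hA hKc (finite_ball (4 * l)) hK
    ((hη.trans hsub1).trans hsub2) h0 hU ha.le (b := a + C₂) (by positivity)
    (fun v hv u hu => ⟨hHar u hu _ _ h0n (hηn v hv), hHar u hu _ _ (hηn v hv) h0n⟩)
    hsub2 hW (hη.trans hsub1) (fun w hw => ?_) (fun _ => 1)
    (fun w hw => ⟨zero_le_one, fun u hu => ?_⟩) ?_ hyη
  · change ‖w‖ < 4 * l
    linarith [(hWn w hw).2]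
  · have hu' : u ∉ ball Λ (4 * l) := fun h => Set.disjoint_left.1 hU.1 hu h
    rw [one_mul]
    constructor
    · have h1 := hann l (by linarith) u hu' w (hWn w hw).1 (hWn w hw).2
      have h2 : hit p (ball Λ (4 * l) \ ball Λ l) {u} w ≤ hit p (ball Λ (4 * l) \ η) {u} w :=
        hit_mono p (Set.sdiff_subset_sdiff_right hη) le_rfl w
      have h3 : 0 ≤ hit p (ball Λ (4 * l) \ η) {u} w := hit_nonneg p _ _ _
      calc _ ≤ C₂ * hit p (ball Λ (4 * l) \ η) {u} w := h1.trans (by gcongr)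
        _ ≤ _ := by gcongr; linarith
    · have h1 : hit p (ball Λ (4 * l) \ η) {u} w ≤ hit p (ball Λ (4 * l)) {u} w :=
        hit_mono p Set.sdiff_subset le_rfl w
      have h2 := hHar u hu w 0 (hWn w hw).2 h0n
      have h3 : 0 ≤ hit p (ball Λ (4 * l)) {u} 0 := hit_nonneg p _ _ _
      calc _ ≤ a * hit p (ball Λ (4 * l)) {u} 0 := h1.trans h2
        _ ≤ _ := by gcongr; linarith
  · obtain ⟨x, hx, s, hs, rfl⟩ := hy
    have h1 : ‖x‖ < l := hx
    have h3 := hsR s hs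
    have h4 := norm_add_le x s
    change ‖x + s‖ < 2 * l
    linarith

end IsStepDistribution

end BoundedRatio

end LatticeWalk

namespace LatticeWalk

/-! ### Small scales: the exterior of a ball is connected -/

section SmallScale

variable {d : ℕ} {Λ : Submodule ℤ (EuclideanSpace ℝ (Fin d))} {p : PMF Λ}

namespace IsStepDistribution

variable (hp : IsStepDistribution p)
include hp

lemma hit_pos_of_reflTransGen [DiscreteTopology Λ] {D A : Set Λ} (hA : Disjoint A D) {x v : Λ}
    (h : Relation.ReflTransGen (fun x y => x ∈ D ∪ A ∧ y - x ∈ hp.steps) x v) (hv : v ∈ A) :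
    0 < hit p D A x := by
  induction h using Relation.ReflTransGen.head_induction_on with
  | refl => rw [hit_of_mem p hv]; exact one_pos
  | @head a b hab _ ih =>
    obtain ⟨haD | haA, hs⟩ := hab
    · rw [hit_eq_avg p hA haD, hp.avg_eq_sum]
      refine Finset.sum_pos' (fun s _ => mul_nonneg ENNReal.toReal_nonneg (hit_nonneg p _ _ _))
        ⟨b - a, hs, mul_pos (hp.toReal_pos hs) ?_⟩
      rwa [add_sub_cancel]
    · rw [hit_of_mem p haA]; exact one_pos

/-- There are two linearly independent steps, so that an integer combination of them is large as
soon as one of its coefficients is. -/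
lemma exists_independent_steps (hd : 2 ≤ d) : ∃ s ∈ hp.steps, ∃ t ∈ hp.steps, ∃ c : ℝ, 0 < c ∧
    ∀ a b : ℤ, c * |(a : ℝ)| ≤ ‖a • s + b • t‖ ∧ c * |(b : ℝ)| ≤ ‖a • s + b • t‖ := by
  obtain ⟨s, hs, hs0⟩ := hp.exists_norm_lt (by omega) 0
  rw [norm_zero, zero_add] at hs0
  have hd' : (2 : ℝ) ≤ d := by exact_mod_cast hd
  -- otherwise the covariance would be of rank one
  obtain ⟨t, ht, hst⟩ : ∃ t ∈ hp.steps,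
      inner ℝ (s : EuclideanSpace ℝ (Fin d)) (t : EuclideanSpace ℝ (Fin d)) ^ 2 <
        ‖s‖ ^ 2 * ‖t‖ ^ 2 := by
    by_contra! h
    have h1 := hp.sum_inner_sq (s : EuclideanSpace ℝ (Fin d))
    have h2 : ∑ t ∈ hp.steps, (p t).toReal * (‖s‖ ^ 2 * ‖t‖ ^ 2) ≤ ∑ t ∈ hp.steps,
        (p t).toReal *
          inner ℝ (s : EuclideanSpace ℝ (Fin d)) (t : EuclideanSpace ℝ (Fin d)) ^ 2 := by
      gcongr with t ht
      exact h t ht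
    have h3 : ∑ t ∈ hp.steps, (p t).toReal * (‖s‖ ^ 2 * ‖t‖ ^ 2) = ‖s‖ ^ 2 * d := by
      rw [← hp.sum_norm_sq, Finset.mul_sum]
      exact Finset.sum_congr rfl fun t _ => by ring
    have h4 : ‖(s : EuclideanSpace ℝ (Fin d))‖ = ‖s‖ := rfl
    rw [h1, h3, h4] at h2
    nlinarith [sq_pos_of_pos hs0]
  have ht0 : 0 < ‖t‖ := by
    rcases (norm_nonneg t).eq_or_lt with h | h
    · rw [← h] at hst
      nlinarith [sq_nonneg (inner ℝ (s : EuclideanSpace ℝ (Fin d)) (t : EuclideanSpace ℝ (Fin d)))]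
    · exact h
  set g := inner ℝ (s : EuclideanSpace ℝ (Fin d)) (t : EuclideanSpace ℝ (Fin d)) with hg
  set G := ‖s‖ ^ 2 * ‖t‖ ^ 2 - g ^ 2 with hG
  have hG0 : 0 < G := by linarith
  set q := max ‖s‖ ‖t‖ with hq
  have hq0 : 0 < q := lt_max_of_lt_left hs0
  have hnorm : ∀ a b : ℤ, ‖a • s + b • t‖ ^ 2 =
      a ^ 2 * ‖s‖ ^ 2 + 2 * a * b * g + b ^ 2 * ‖t‖ ^ 2 := fun a b => by
    rw [norm_add_sq_coe]
    have h1 : ((a • s : Λ) : EuclideanSpace ℝ (Fin d)) = (a : ℝ) • (s : EuclideanSpace ℝ (Fin d)) :=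
      by rw [Submodule.coe_smul, Int.cast_smul_eq_zsmul]
    have h2 : ((b • t : Λ) : EuclideanSpace ℝ (Fin d)) = (b : ℝ) • (t : EuclideanSpace ℝ (Fin d)) :=
      by rw [Submodule.coe_smul, Int.cast_smul_eq_zsmul]
    have h3 : ‖a • s‖ = |(a : ℝ)| * ‖s‖ := by
      rw [Submodule.coe_norm, h1, norm_smul, Real.norm_eq_abs]; rfl
    have h4 : ‖b • t‖ = |(b : ℝ)| * ‖t‖ := by
      rw [Submodule.coe_norm, h2, norm_smul, Real.norm_eq_abs]; rfl
    rw [h1, h2, h3, h4, real_inner_smul_left, real_inner_smul_right, mul_pow, mul_pow, sq_abs,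
      sq_abs]
    ring
  have key : ∀ x y u w : ℝ, 0 ≤ y → 0 < u → u ≤ q → x ^ 2 * G ≤ y ^ 2 * u ^ 2 → w = |x| →
      √G / q * w ≤ y := fun x y u w hy hu huq h hw => by
    rw [hw, div_mul_eq_mul_div, div_le_iff₀ hq0]
    refine (pow_le_pow_iff_left₀ (by positivity) (by positivity) two_ne_zero).1 ?_
    rw [mul_pow, mul_pow, Real.sq_sqrt hG0.le, sq_abs, mul_comm]
    refine h.trans ?_
    gcongr
  refine ⟨s, hs, t, ht, √G / q, by positivity, fun a b => ⟨?_, ?_⟩⟩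
  · refine key a _ ‖t‖ _ (norm_nonneg _) ht0 (le_max_right _ _) ?_ rfl
    rw [hnorm]
    nlinarith [sq_nonneg (a * g + b * ‖t‖ ^ 2)]
  · refine key b _ ‖s‖ _ (norm_nonneg _) hs0 (le_max_left _ _) ?_ rfl
    rw [hnorm]
    nlinarith [sq_nonneg (b * g + a * ‖s‖ ^ 2)]

/-- A possible step between two points of norm at least `r`. -/
def OutsideStep (r : ℝ) (x y : Λ) : Prop := r ≤ ‖x‖ ∧ r ≤ ‖y‖ ∧ y - x ∈ hp.steps

lemma outsideStep_symm (r : ℝ) : Std.Symm (hp.OutsideStep r) :=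
  ⟨fun x y ⟨h1, h2, h3⟩ => ⟨h2, h1, by simpa using hp.neg_mem_steps h3⟩⟩

lemma reflTransGen_outsideStep_symm {r : ℝ} {x y : Λ}
    (h : Relation.ReflTransGen (hp.OutsideStep r) x y) :
    Relation.ReflTransGen (hp.OutsideStep r) y x := by
  have := hp.outsideStep_symm r
  exact (inferInstance : Std.Symm (Relation.ReflTransGen (hp.OutsideStep r))).symm _ _ h

lemma reflTransGen_ray {r : ℝ} {x u : Λ} (hu : u ∈ hp.steps) (M : ℕ)
    (h : ∀ i ≤ M, r ≤ ‖x + i • u‖) :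
    Relation.ReflTransGen (hp.OutsideStep r) x (x + M • u) := by
  induction M with
  | zero => simpa using Relation.ReflTransGen.refl
  | succ M ih =>
    refine (ih fun i hi => h i (by omega)).tail ⟨h M (by omega), h (M + 1) le_rfl, ?_⟩
    rw [succ_nsmul]
    simpa [add_sub_add_left_eq_sub] using hu

lemma reflTransGen_ray_of_inner_nonneg {r : ℝ} {x u : Λ} (hu : u ∈ hp.steps) (hx : r ≤ ‖x‖)
    (h : 0 ≤ inner ℝ (x : EuclideanSpace ℝ (Fin d)) (u : EuclideanSpace ℝ (Fin d))) (M : ℕ) :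
    Relation.ReflTransGen (hp.OutsideStep r) x (x + M • u) := by
  refine hp.reflTransGen_ray hu M fun i _ => hx.trans ?_
  refine (pow_le_pow_iff_left₀ (norm_nonneg _) (norm_nonneg _) two_ne_zero).1 ?_
  rw [norm_add_sq_coe]
  have : ((i • u : Λ) : EuclideanSpace ℝ (Fin d)) = (i : ℝ) • (u : EuclideanSpace ℝ (Fin d)) := by
    rw [Nat.cast_smul_eq_nsmul]; rfl
  rw [this, real_inner_smul_right]
  have : 0 ≤ (i : ℝ) * inner ℝ (x : EuclideanSpace ℝ (Fin d)) (u : EuclideanSpace ℝ (Fin d)) := by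
    positivity
  nlinarith [sq_nonneg ‖i • u‖]

lemma reflTransGen_word {r : ℝ} (L : List Λ) (hL : ∀ s ∈ L, s ∈ hp.steps) {R : ℝ}
    (hR : ∀ s ∈ hp.steps, ‖s‖ ≤ R) (x : Λ) (hx : r + L.length * R ≤ ‖x‖) :
    Relation.ReflTransGen (hp.OutsideStep r) x (x + L.sum) := by
  induction L generalizing x with
  | nil => simpa using Relation.ReflTransGen.refl
  | cons s L ih =>
    have hs := hL s (by simp)
    have h1 := hR s hs
    have h0 := (norm_nonneg s).trans h1
    have h2 : ‖x‖ - ‖s‖ ≤ ‖x + s‖ := by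
      have := norm_sub_le (x + s) s
      rw [add_sub_cancel_right] at this
      linarith
    rw [List.length_cons] at hx
    push_cast at hx
    have h3 : 0 ≤ (L.length : ℝ) * R := by positivity
    rw [List.sum_cons, ← add_assoc]
    exact (ih (fun t ht => hL t (by simp [ht])) (x + s) (by linarith)).head
      ⟨by linarith, by linarith, by simpa using hs⟩

/-- The exterior of a ball is connected by possible steps: from a point outside the ball one can
move to infinity along one of the directions `s`, `-s`, and these are joined far away along a
square with sides in the directions `s` and `t`. -/
lemma reflTransGen_outsideStep [DiscreteTopology Λ] [IsZLattice ℝ Λ] (hd : 2 ≤ d) {r : ℝ}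
    {x z : Λ} (hx : r ≤ ‖x‖) (hz : r ≤ ‖z‖) :
    Relation.ReflTransGen (hp.OutsideStep r) x z := by
  obtain ⟨s, hs, t, ht, c, hc, hst⟩ := hp.exists_independent_steps hd
  obtain ⟨R, hR1, hR⟩ := hp.exists_bound
  have hlow : ∀ (x : Λ) (a b : ℤ) (m : ℝ), m + ‖x‖ ≤ c * |(a : ℝ)| ∨ m + ‖x‖ ≤ c * |(b : ℝ)| →
      m ≤ ‖x + a • s + b • t‖ := fun x a b m h => by
    have h1 := norm_sub_le (x + a • s + b • t) x
    rw [show x + a • s + b • t - x = a • s + b • t by abel] at h1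
    obtain ⟨h2, h3⟩ := hst a b
    rcases h with h | h <;> linarith
  have hfar : ∀ x : Λ, r ≤ ‖x‖ → ∃ M₀ : ℕ, ∀ M ≥ M₀,
      Relation.ReflTransGen (hp.OutsideStep r) x (x + M • s) := by
    intro x hx
    obtain ⟨M₀, hM₀⟩ := exists_nat_ge ((r + ‖x‖) / c)
    refine ⟨M₀, fun M hM => ?_⟩
    rcases le_total 0 (inner ℝ (x : EuclideanSpace ℝ (Fin d)) (s : EuclideanSpace ℝ (Fin d)))
      with h | h
    · exact hp.reflTransGen_ray_of_inner_nonneg hs hx h M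
    · have hMc : r + ‖x‖ ≤ c * M := by
        rw [div_le_iff₀ hc, mul_comm] at hM₀
        refine hM₀.trans ?_
        gcongr
      have e0 := hp.reflTransGen_ray_of_inner_nonneg (hp.neg_mem_steps hs) hx
        (by rw [Submodule.coe_neg, inner_neg_right]; linarith) M
      have e1 : Relation.ReflTransGen (hp.OutsideStep r) (x + M • -s) (x + M • -s + M • t) := by
        refine hp.reflTransGen_ray ht M fun i _ => ?_
        have := hlow x (-M) i r (Or.inl (by push_cast; rwa [abs_neg, Nat.abs_cast]))
        simpa using this
      have e2 : Relation.ReflTransGen (hp.OutsideStep r) (x + M • -s + M • t)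
          (x + M • -s + M • t + (2 * M) • s) := by
        refine hp.reflTransGen_ray hs _ fun i _ => ?_
        have := hlow x (-M + i) M r (Or.inr (by push_cast; rwa [Nat.abs_cast]))
        convert this using 2
        simp only [add_smul, neg_smul, natCast_zsmul, smul_neg]
        abel
      have e3 : Relation.ReflTransGen (hp.OutsideStep r) (x + M • -s + M • t + (2 * M) • s)
          (x + M • -s + M • t + (2 * M) • s + M • -t) := by
        refine hp.reflTransGen_ray (hp.neg_mem_steps ht) _ fun i _ => ?_
        have := hlow x M (M - i) r (Or.inl (by push_cast; rwa [Nat.abs_cast]))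
        convert this using 2
        simp only [sub_smul, natCast_zsmul, smul_neg, two_mul, add_smul]
        abel
      have e : x + M • -s + M • t + (2 * M) • s + M • -t = x + M • s := by
        simp only [smul_neg, two_mul, add_smul]; abel
      rw [e] at e3
      exact ((e0.trans e1).trans e2).trans e3
  obtain ⟨C, -, hC⟩ := exists_hasWord (N := (hp.steps : Set Λ))
    (fun s h => hp.neg_mem_steps h) (by
      have := hp.irreducible
      rwa [show (hp.steps : Set Λ) = p.support by simp [steps]])
  obtain ⟨k, ⟨L, hL, hsum, -⟩, -⟩ := hC (z - x)
  obtain ⟨M₁, hM₁⟩ := hfar x hx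
  obtain ⟨M₂, hM₂⟩ := hfar z hz
  obtain ⟨M₃, hM₃⟩ := exists_nat_ge ((r + L.length * R + ‖x‖) / c)
  let M := max M₁ (max M₂ M₃)
  have e1 := hM₁ M (le_max_left _ _)
  have e2 := hM₂ M ((le_max_left _ _).trans (le_max_right _ _))
  have e3 := hp.reflTransGen_word (r := r) L hL hR (x + M • s) (by
    rw [div_le_iff₀ hc, mul_comm _ c] at hM₃
    have h1 : (M₃ : ℝ) ≤ M := by
      exact_mod_cast (le_max_right _ _).trans (le_max_right _ _)
    have := hlow x M 0 (r + L.length * R) (Or.inl (by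
      push_cast
      rw [Nat.abs_cast]
      exact hM₃.trans (by gcongr)))
    simpa using this)
  rw [hsum, show x + M • s + (z - x) = z + M • s by abel] at e3
  exact (e1.trans e3).trans (hp.reflTransGen_outsideStep_symm e2)

/-- At a fixed scale, if `K` misses some point `z` of a given ball, then `hit p (K \ η) Kᶜ y` is
bounded below, since the walk can reach `z` outside the ball of radius `l`. As the walk can go
from `0` to `y` inside this ball, `hit p K A 0` is at least a constant times `hit p K A y`. -/
lemma exists_escape_le_of_missing [DiscreteTopology Λ] [IsZLattice ℝ Λ] (hd : 2 ≤ d) (l N : ℝ) :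
    ∃ C : ℝ, 0 < C ∧ ∀ K A : Set Λ, ball Λ l ⊆ K → Disjoint A K → (∃ z ∈ ball Λ N, z ∉ K) →
    ∀ η : Set Λ, η ⊆ ball Λ l → ∀ y ∉ ball Λ l, y ∈ ball Λ N → 0 < hit p (ball Λ l) {y} 0 →
    hit p (K \ η) A y ≤ C * (hit p K A 0 * hit p (K \ η) Kᶜ y) := by
  let f : Λ × Λ → ℝ := fun q => hit p (ball Λ l) {q.1} 0 * hit p (ball Λ l ∪ {q.2})ᶜ {q.2} q.1
  obtain ⟨c, hc, hcf⟩ : ∃ c : ℝ, 0 < c ∧ ∀ q ∈ ball Λ N ×ˢ ball Λ N, 0 < f q → c ≤ f q := by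
    have hfin : ((ball Λ N ×ˢ ball Λ N) ∩ {q | 0 < f q}).Finite :=
      ((finite_ball N).prod (finite_ball N)).inter_of_left _
    rcases Set.eq_empty_or_nonempty ((ball Λ N ×ˢ ball Λ N) ∩ {q | 0 < f q}) with h | h
    · exact ⟨1, one_pos, fun q hq hq' => absurd (show q ∈ (_ ∩ _ : Set _) from ⟨hq, hq'⟩)
        (by rw [h]; exact Set.notMem_empty q)⟩
    · obtain ⟨q, hq, hmin⟩ := Set.exists_min_image _ f hfin h
      exact ⟨f q, hq.2, fun q' h1 h2 => hmin q' ⟨h1, h2⟩⟩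
  refine ⟨c⁻¹, by positivity, ?_⟩
  rintro K A hK hA ⟨z, hzN, hzK⟩ η hη y hy hyN hpos
  have hzl : z ∉ ball Λ l := fun h => hzK (hK h)
  have h1 : 0 < hit p (ball Λ l ∪ {z})ᶜ {z} y := by
    refine hp.hit_pos_of_reflTransGen ?_ (v := z) (Relation.ReflTransGen.mono ?_ _ _
      (hp.reflTransGen_outsideStep hd (r := l) (not_lt.1 hy) (not_lt.1 hzl))) rfl
    · exact Set.disjoint_singleton_left.2 fun h => h (Or.inr rfl)
    · rintro a b ⟨h1, -, h2⟩
      refine ⟨?_, h2⟩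
      by_cases haz : a = z
      · exact Or.inr haz
      · exact Or.inl fun h => h.elim (fun h => not_lt.2 h1 h) haz
  have h2 : hit p (ball Λ l) {y} 0 * hit p K A y ≤ hit p K A 0 := by
    rw [← measure_exitEvent_inter p hK (hA.mono_right hK) hy 0]
    exact measureReal_mono Set.inter_subset_left
  have h3 : hit p (ball Λ l ∪ {z})ᶜ {z} y ≤ hit p (K \ η) Kᶜ y := by
    refine measureReal_mono ?_
    rintro X ⟨j, hj, hj'⟩
    classical
    have hex : ∃ i, y + walk X i ∉ K := ⟨j, by
      rw [Set.mem_singleton_iff] at hj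
      rwa [hj]⟩
    refine ⟨Nat.find hex, Nat.find_spec hex, fun i hi => ⟨not_not.1 (Nat.find_min hex hi), ?_⟩⟩
    have hij : i < j := hi.trans_le (Nat.find_min' hex (by
      rw [Set.mem_singleton_iff] at hj
      rwa [hj]))
    exact fun h => hj' i hij (Or.inl (hη h))
  have h4 : hit p (K \ η) A y ≤ hit p K A y := hit_mono p Set.sdiff_subset le_rfl y
  have h5 := hcf (y, z) ⟨hyN, hzN⟩ (mul_pos hpos h1)
  have h6 := hit_nonneg p K A y
  have h7 := hit_nonneg p K A 0
  rw [inv_mul_eq_div, le_div_iff₀ hc]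
  calc hit p (K \ η) A y * c ≤ hit p K A y * f (y, z) := by gcongr
    _ = (hit p (ball Λ l) {y} 0 * hit p K A y) * hit p (ball Λ l ∪ {z})ᶜ {z} y := by
      simp only [f]; ring
    _ ≤ hit p K A 0 * hit p (K \ η) Kᶜ y := by gcongr

end IsStepDistribution

end SmallScale

end LatticeWalk

namespace LatticeWalk

/-! ### Loop-erasure and last visits -/

section LoopErasure

variable {α : Type*} [DecidableEq α]

lemma eraseTime_le (w : ℕ → α) (m i : ℕ) : eraseTime w m i ≤ m := by
  cases i <;> exact Nat.findGreatest_le m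

lemma eraseTime_lt_succ {w : ℕ → α} {m i : ℕ} (h : eraseTime w m i < m) :
    eraseTime w m i < eraseTime w m (i + 1) :=
  Nat.le_findGreatest (P := fun j => w j = w (eraseTime w m i + 1)) h rfl

lemma apply_eraseTime_succ {w : ℕ → α} {m i : ℕ} (h : eraseTime w m i < m) :
    w (eraseTime w m (i + 1)) = w (eraseTime w m i + 1) :=
  Nat.findGreatest_spec (P := fun j => w j = w (eraseTime w m i + 1)) h rfl

lemma apply_eraseTime_zero (w : ℕ → α) (m : ℕ) : w (eraseTime w m 0) = w 0 :=
  Nat.findGreatest_spec (P := fun j => w j = w 0) (Nat.zero_le m) rfl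

/-- As long as the erasure has not ended, `eraseTime w m i` is the time of a last visit. -/
lemma apply_ne_of_eraseTime_lt {w : ℕ → α} {m i j : ℕ} (h : ∀ i' < i, eraseTime w m i' < m)
    (hj : eraseTime w m i < j) (hjm : j ≤ m) : w j ≠ w (eraseTime w m i) := by
  cases i with
  | zero =>
    rw [apply_eraseTime_zero w m]
    exact Nat.findGreatest_is_greatest hj hjm
  | succ i =>
    rw [apply_eraseTime_succ (h i (Nat.lt_succ_self i))]
    exact Nat.findGreatest_is_greatest hj hjm

lemma eraseTime_eraseLength (w : ℕ → α) (m : ℕ) : eraseTime w m (eraseLength w m) = m := by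
  refine Nat.sInf_mem (s := {i | eraseTime w m i = m}) ?_
  by_contra h
  have hlt : ∀ i, eraseTime w m i < m := fun i =>
    lt_of_le_of_ne (eraseTime_le w m i) fun he => h ⟨i, he⟩
  have hge : ∀ i, i ≤ eraseTime w m i := fun i => by
    induction i with
    | zero => exact Nat.zero_le _
    | succ i ih => exact Nat.succ_le_of_lt (ih.trans_lt (eraseTime_lt_succ (hlt i)))
  exact absurd (hge m) (not_le.2 (hlt m))

lemma eraseTime_lt_of_lt_eraseLength {w : ℕ → α} {m i : ℕ} (h : i < eraseLength w m) :
    eraseTime w m i < m :=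
  lt_of_le_of_ne (eraseTime_le w m i)
    (Nat.notMem_of_lt_sInf (s := {i | eraseTime w m i = m}) h)

/-- The loop-erasure begins with the path `v 0, …, v k`, which leaves `B` at its last step, iff for
each `i < k` the last visit of `w` to `v i` is followed by a step to `v (i + 1)`. -/
lemma loopErasedUntilExit_eq_iff {B : Set α} {w v : ℕ → α} {m k : ℕ} (hk : 1 ≤ k)
    (hv0 : v 0 = w 0) (hvB : ∀ i < k, v i ∈ B) (hvk : v k ∉ B) :
    loopErasedUntilExit B w m = (List.range (k + 1)).map v ↔
      ∃ τ : ℕ → ℕ, ∀ i < k, τ i < m ∧ τ i ≤ τ (k - 1) ∧ w (τ i) = v i ∧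
        w (τ i + 1) = v (i + 1) ∧ ∀ j, τ i < j → j ≤ m → w j ≠ v i := by
  set J := sInf {j | 1 ≤ j ∧ j ≤ eraseLength w m ∧ w (eraseTime w m j) ∉ B} with hJ
  have hiff : loopErasedUntilExit B w m = (List.range (k + 1)).map v ↔
      J = k ∧ ∀ i ≤ k, w (eraseTime w m i) = v i := by
    rw [loopErasedUntilExit, ← hJ]
    constructor
    · intro h
      have hlen := congrArg List.length h
      simp only [List.length_map, List.length_range, add_left_inj] at hlen
      rw [hlen, List.map_inj_left] at h
      exact ⟨hlen, fun i hi => h i (List.mem_range.2 (Nat.lt_succ_of_le hi))⟩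
    · rintro ⟨h1, h2⟩
      rw [h1, List.map_inj_left]
      exact fun i hi => h2 i (Nat.lt_succ_iff.1 (List.mem_range.1 hi))
  rw [hiff]
  constructor
  · rintro ⟨hJk, hw⟩
    have hmem := Nat.sInf_mem (Nat.nonempty_of_pos_sInf (hJ ▸ hJk ▸ hk : 0 < sInf _))
    rw [← hJ, hJk] at hmem
    have hkr : k ≤ eraseLength w m := hmem.2.1
    have hlt : ∀ i < k, eraseTime w m i < m := fun i hi =>
      eraseTime_lt_of_lt_eraseLength (hi.trans_le hkr)
    have hmono : ∀ i j, i + j < k → eraseTime w m i ≤ eraseTime w m (i + j) := fun i j => by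
      induction j with
      | zero => simp
      | succ j ih =>
        intro h
        exact (ih (by omega)).trans (eraseTime_lt_succ (hlt (i + j) (by omega))).le
    refine ⟨eraseTime w m, fun i hi => ⟨hlt i hi, ?_, hw i hi.le, ?_, fun j hj hjm => ?_⟩⟩
    · have := hmono i (k - 1 - i) (by omega)
      rwa [show i + (k - 1 - i) = k - 1 by omega] at this
    · rw [← apply_eraseTime_succ (hlt i hi), hw (i + 1) hi]
    · rw [← hw i hi.le]
      exact apply_ne_of_eraseTime_lt (fun i' hi' => hlt i' (hi'.trans hi)) hj hjm
  · rintro ⟨τ, hτ⟩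
    have heq : ∀ i < k, eraseTime w m i = τ i := fun i => by
      induction i with
      | zero =>
        intro hi
        obtain ⟨h1, -, h2, -, h3⟩ := hτ 0 hi
        rw [hv0] at h2 h3
        exact Nat.findGreatest_eq_iff.2 ⟨h1.le, fun _ => h2, fun n hn hn' => h3 n hn hn'⟩
      | succ i ih =>
        intro hi
        have e := ih (by omega)
        obtain ⟨-, -, -, h0, -⟩ := hτ i (by omega)
        obtain ⟨h1, -, h2, -, h3⟩ := hτ (i + 1) hi
        refine Nat.findGreatest_eq_iff.2 ⟨h1.le, fun _ => ?_, fun n hn hn' => ?_⟩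
        · rw [e, h0, h2]
        · rw [e, h0]; exact h3 n hn hn'
    have hlt : ∀ i < k, eraseTime w m i < m := fun i hi => by rw [heq i hi]; exact (hτ i hi).1
    have hkr : k ≤ eraseLength w m := by
      by_contra! h
      exact absurd (eraseTime_eraseLength w m) (hlt _ h).ne
    have hw : ∀ i ≤ k, w (eraseTime w m i) = v i := fun i hi => by
      rcases hi.lt_or_eq with h | rfl
      · rw [heq i h]; exact (hτ i h).2.2.1
      · obtain ⟨j, rfl⟩ := Nat.exists_eq_add_of_le' hk
        rw [apply_eraseTime_succ (hlt j (by omega)), heq j (by omega)]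
        exact (hτ j (by omega)).2.2.2.1
    refine ⟨le_antisymm (Nat.sInf_le ⟨hk, hkr, by rwa [hw k le_rfl]⟩) ?_, hw⟩
    refine le_csInf ⟨k, hk, hkr, by rwa [hw k le_rfl]⟩ fun j hj => ?_
    by_contra! h
    exact hj.2.2 (by rw [hw j h.le]; exact hvB j h)

end LoopErasure

/-! ### The law of the loop-erased walk -/

section ExitTime

variable {d : ℕ} {Λ : Submodule ℤ (EuclideanSpace ℝ (Fin d))}

/-- `m` is the first time `≥ 1` at which `w` is outside `K`. -/
def IsExitTime (K : Set Λ) (w : ℕ → Λ) (m : ℕ) : Prop :=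
  1 ≤ m ∧ w m ∉ K ∧ ∀ i, 1 ≤ i → i < m → w i ∈ K

lemma exitTime_eq_coe_iff {K : Set Λ} {w : ℕ → Λ} {m : ℕ} :
    exitTime K w = m ↔ IsExitTime K w m := by
  constructor
  · intro h
    have hne : {t : ℕ∞ | ∃ j : ℕ, 1 ≤ j ∧ w j ∉ K ∧ t = j}.Nonempty := by
      by_contra hne
      rw [exitTime, Set.not_nonempty_iff_eq_empty.1 hne, sInf_empty] at h
      exact ENat.top_ne_natCast m h
    obtain ⟨j, hj1, hj2, hj3⟩ := csInf_mem hne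
    rw [← exitTime, h, Nat.cast_inj] at hj3
    subst hj3
    refine ⟨hj1, hj2, fun i hi him => ?_⟩
    by_contra hiK
    have : exitTime K w ≤ i := sInf_le ⟨i, hi, hiK, rfl⟩
    rw [h, Nat.cast_le] at this
    omega
  · rintro ⟨h1, h2, h3⟩
    refine le_antisymm (sInf_le ⟨m, h1, h2, rfl⟩) (le_sInf ?_)
    rintro _ ⟨j, hj1, hj2, rfl⟩
    rw [Nat.cast_le]
    by_contra! h
    exact hj2 (h3 j hj1 h)

lemma IsExitTime.unique {K : Set Λ} {w : ℕ → Λ} {m m' : ℕ} (h : IsExitTime K w m)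
    (h' : IsExitTime K w m') : m = m' := by
  rw [← exitTime_eq_coe_iff] at h h'
  exact_mod_cast h.symm.trans h'

lemma exitTime_lt_top_iff {K : Set Λ} {w : ℕ → Λ} :
    exitTime K w < ⊤ ↔ ∃ m, IsExitTime K w m := by
  simp_rw [← exitTime_eq_coe_iff, lt_top_iff_ne_top, ENat.ne_top_iff_exists, eq_comm]

lemma exists_isExitTime {K : Set Λ} {w : ℕ → Λ} {j : ℕ} (hj : 1 ≤ j) (hjK : w j ∉ K) :
    ∃ m ≤ j, IsExitTime K w m := by
  classical
  have hex : ∃ j, 1 ≤ j ∧ w j ∉ K := ⟨j, hj, hjK⟩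
  refine ⟨Nat.find hex, Nat.find_min' hex ⟨hj, hjK⟩, (Nat.find_spec hex).1, (Nat.find_spec hex).2,
    fun i hi hi' => ?_⟩
  by_contra h
  exact Nat.find_min hex hi' ⟨hi, h⟩

lemma coe_lt_exitTime_iff {K : Set Λ} {w : ℕ → Λ} {m : ℕ} :
    (m : ℕ∞) < exitTime K w ↔ ∀ j, 1 ≤ j → j ≤ m → w j ∈ K := by
  constructor
  · intro h j hj hjm
    by_contra hjK
    have : exitTime K w ≤ j := sInf_le ⟨j, hj, hjK, rfl⟩
    exact absurd ((h.trans_le this).trans_le (Nat.cast_le.2 hjm)) (lt_irrefl _)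
  · intro h
    by_contra! h'
    obtain ⟨j, hj⟩ := exitTime_lt_top_iff.1 (h'.trans_lt (ENat.natCast_lt_top m))
    rw [exitTime_eq_coe_iff.2 hj, Nat.cast_le] at h'
    exact hj.2.1 (h j hj.1 h')

/-- If the starting point is in `K`, it does not matter whether time `0` is allowed as exit
time. -/
lemma mem_exitEvent_zero_iff {K A : Set Λ} (h0 : (0 : Λ) ∈ K) (hA : Disjoint A K) {X : ℕ → Λ} :
    X ∈ exitEvent K A 0 ↔ ∃ m, IsExitTime K (walk X) m ∧ walk X m ∈ A := by
  simp only [exitEvent, Set.mem_ofPred_eq, zero_add]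
  constructor
  · rintro ⟨j, hj, hj'⟩
    have hjK : walk X j ∉ K := fun h => Set.disjoint_left.1 hA hj h
    refine ⟨j, ⟨?_, hjK, fun i _ hi => hj' i hi⟩, hj⟩
    by_contra h
    obtain rfl : j = 0 := by omega
    exact hjK (by simpa using h0)
  · rintro ⟨m, ⟨h1, h2, h3⟩, hm⟩
    refine ⟨m, hm, fun i hi => ?_⟩
    rcases Nat.eq_zero_or_pos i with rfl | hi0
    · simpa using h0
    · exact h3 i hi0 hi

lemma mem_leavesBefore_iff {K₁ K₂ : Set Λ} {X : ℕ → Λ} :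
    X ∈ leavesBefore K₁ K₂ ↔
      ∃ m, IsExitTime K₁ (walk X) m ∧ ∀ j, 1 ≤ j → j ≤ m → walk X j ∈ K₂ := by
  constructor
  · intro h
    have h : exitTime K₁ (walk X) < exitTime K₂ (walk X) := h
    obtain ⟨m, hm⟩ := exitTime_lt_top_iff.1 (h.trans_le le_top)
    rw [exitTime_eq_coe_iff.2 hm] at h
    exact ⟨m, hm, coe_lt_exitTime_iff.1 h⟩
  · rintro ⟨m, hm, h⟩
    change exitTime K₁ (walk X) < exitTime K₂ (walk X)
    rw [exitTime_eq_coe_iff.2 hm]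
    exact coe_lt_exitTime_iff.2 h

lemma isExitTime_inter_iff {K₁ K₂ : Set Λ} {w : ℕ → Λ} {m : ℕ} :
    (IsExitTime K₁ w m ∧ ∀ j, 1 ≤ j → j ≤ m → w j ∈ K₂) ↔
      IsExitTime (K₁ ∩ K₂) w m ∧ w m ∈ K₂ \ K₁ := by
  constructor
  · rintro ⟨⟨h1, h2, h3⟩, h4⟩
    exact ⟨⟨h1, fun h => h2 h.1, fun i hi him => ⟨h3 i hi him, h4 i hi him.le⟩⟩,
      h4 m h1 le_rfl, h2⟩
  · rintro ⟨⟨h1, h2, h3⟩, h4, h5⟩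
    refine ⟨⟨h1, h5, fun i hi him => (h3 i hi him).1⟩, fun j hj hjm => ?_⟩
    rcases hjm.lt_or_eq with h | rfl
    exacts [(h3 j hj h).2, h4]

lemma leavesBefore_eq_exitEvent {K₁ K₂ : Set Λ} (h₁ : (0 : Λ) ∈ K₁) (h₂ : (0 : Λ) ∈ K₂) :
    leavesBefore K₁ K₂ = exitEvent (K₁ ∩ K₂) (K₂ \ K₁) 0 := by
  ext X
  rw [mem_leavesBefore_iff, mem_exitEvent_zero_iff (Set.mem_inter h₁ h₂)
    (Set.disjoint_left.2 fun x hx hx' => hx.2 hx'.1)]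
  simp_rw [isExitTime_inter_iff]

end ExitTime

end LatticeWalk

namespace LatticeWalk

section LoopErasedWalk

variable {d : ℕ} {Λ : Submodule ℤ (EuclideanSpace ℝ (Fin d))}

lemma mem_lerwEvent_iff {l : ℕ} {K : Set Λ} {ω : List Λ} {X : ℕ → Λ} [DecidableEq Λ] :
    X ∈ lerwEvent l K ω ↔
      ∃ m, IsExitTime K (walk X) m ∧ loopErasedUntilExit (ball Λ l) (walk X) m = ω := by
  constructor
  · rintro ⟨h1, h2⟩
    obtain ⟨m, hm⟩ := exitTime_lt_top_iff.1 h1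
    rw [exitTime_eq_coe_iff.2 hm] at h2
    refine ⟨m, hm, ?_⟩
    convert h2
    exact (ENat.toNat_natCast m).symm
  · rintro ⟨m, hm, h⟩
    refine ⟨exitTime_lt_top_iff.2 ⟨m, hm⟩, ?_⟩
    rw [exitTime_eq_coe_iff.2 hm]
    convert h
    exact ENat.toNat_natCast m

/-- The loop-erasure of the walk up to its exit from `K` begins with `ω`, and the walk leaves `K`
at a point of `A`. -/
def lerwExitEvent (l : ℕ) (K A : Set Λ) (ω : List Λ) : Set (ℕ → Λ) :=
  lerwEvent l K ω ∩ {X | ∃ m, IsExitTime K (walk X) m ∧ walk X m ∈ A}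

/-- Up to time `t`, the walk stays in `K`, and for each `i < k` its last visit to `v i` is followed
by a step to `v (i + 1)`, the step to `v k` being the one that ends at time `t`. -/
def lastVisitEvent (K : Set Λ) (k : ℕ) (v : ℕ → Λ) (t : ℕ) : Set (ℕ → Λ) :=
  {X | walk X t = v k ∧ (∀ j, 1 ≤ j → j < t → walk X j ∈ K) ∧
    ∃ τ : ℕ → ℕ, τ (k - 1) + 1 = t ∧ ∀ i < k, τ i < t ∧ walk X (τ i) = v i ∧
      walk X (τ i + 1) = v (i + 1) ∧ ∀ j, τ i < j → j < t → walk X j ≠ v i}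

lemma dependsOnFirst_lastVisitEvent (K : Set Λ) (k : ℕ) (v : ℕ → Λ) (t : ℕ) :
    DependsOnFirst t (lastVisitEvent K k v t) := by
  rintro X Y h ⟨h1, h2, τ, h3, h4⟩
  have hw : ∀ j ≤ t, walk Y j = walk X j := fun j hj => (walk_congr h hj).symm
  refine ⟨by rw [hw t le_rfl, h1], fun j hj hjt => ?_, τ, h3, fun i hi => ?_⟩
  · rw [hw j hjt.le]; exact h2 j hj hjt
  · obtain ⟨h5, h6, h7, h8⟩ := h4 i hi
    refine ⟨h5, by rw [hw _ h5.le, h6], by rw [hw _ h5, h7], fun j hj hjt => ?_⟩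
    rw [hw j hjt.le]; exact h8 j hj hjt

variable {l : ℕ} {K A : Set Λ} {k : ℕ} {v : ℕ → Λ}

lemma lerwExitEvent_eq_iUnion (hK : ball Λ l ⊆ K) (hA : Disjoint A K) (hk : 1 ≤ k)
    (hv0 : v 0 = 0) (hvB : ∀ i < k, v i ∈ ball Λ l) (hvk : v k ∉ ball Λ l) :
    lerwExitEvent l K A ((List.range (k + 1)).map v) =
      ⋃ t, (lastVisitEvent K k v t ∩ shift t ⁻¹' exitEvent (K \ v '' Set.Iio k) A (v k)) := by
  classical
  ext X
  simp only [lerwExitEvent, Set.mem_inter_iff, mem_lerwEvent_iff, Set.mem_ofPred_eq,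
    Set.mem_iUnion, Set.mem_preimage]
  have hiff := fun m => loopErasedUntilExit_eq_iff (w := walk X) (m := m) hk
    (by rw [hv0, walk_zero]) hvB hvk
  constructor
  · rintro ⟨⟨m, hm, hl⟩, m', hm', hmA⟩
    obtain rfl := hm.unique hm'
    obtain ⟨τ, hτ⟩ := (hiff m).1 hl
    obtain ⟨h1, -, h2, h3, h4⟩ := hτ (k - 1) (by omega)
    rw [show k - 1 + 1 = k by omega] at h3
    refine ⟨τ (k - 1) + 1, ⟨h3, fun j hj hj' => hm.2.2 j hj (by omega), τ, rfl,
      fun i hi => ?_⟩, m - (τ (k - 1) + 1), ?_, fun i hi => ?_⟩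
    · obtain ⟨h5, h6, h7, h8, h9⟩ := hτ i hi
      exact ⟨by omega, h7, h8, fun j hj hj' => h9 j hj (by omega)⟩
    · rw [← h3, ← walk_add, show τ (k - 1) + 1 + (m - (τ (k - 1) + 1)) = m by omega]
      exact hmA
    · have e : v k + walk (shift (τ (k - 1) + 1) X) i = walk X (τ (k - 1) + 1 + i) := by
        rw [walk_add, h3]
      rw [e]
      refine ⟨hm.2.2 _ (by omega) (by omega), ?_⟩
      rintro ⟨a, ha, hva⟩
      obtain ⟨h5, h6, h7, h8, h9⟩ := hτ a ha
      exact h9 (τ (k - 1) + 1 + i) (by omega) (by omega) hva.symm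
  · rintro ⟨t, ⟨h1, h2, τ, h3, h4⟩, j, hj, hj'⟩
    have hfut : ∀ i, v k + walk (shift t X) i = walk X (t + i) := fun i => by
      rw [walk_add, h1]
    rw [hfut] at hj
    simp only [hfut] at hj'
    have hjK : walk X (t + j) ∉ K := fun h => Set.disjoint_left.1 hA hj h
    have hm : IsExitTime K (walk X) (t + j) := by
      refine ⟨by omega, hjK, fun i hi hi' => ?_⟩
      rcases lt_or_ge i t with h | h
      · exact h2 i hi h
      · obtain ⟨a, rfl⟩ := Nat.exists_eq_add_of_le h
        exact (hj' a (by omega)).1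
    refine ⟨⟨t + j, hm, (hiff _).2 ⟨τ, fun i hi => ?_⟩⟩, t + j, hm, hj⟩
    obtain ⟨h5, h6, h7, h8⟩ := h4 i hi
    refine ⟨by omega, by omega, h6, h7, fun a ha ha' hva => ?_⟩
    rcases lt_or_ge a t with h | h
    · exact h8 a ha h hva
    · obtain ⟨b, rfl⟩ := Nat.exists_eq_add_of_le h
      rcases (show b ≤ j by omega).lt_or_eq with hb | rfl
      · exact (hj' b hb).2 ⟨i, hi, hva.symm⟩
      · exact hjK (hva ▸ hK (hvB i hi))

lemma disjoint_lastVisitEvent (hA : Disjoint A K) (hk : 1 ≤ k) {t t' : ℕ} (htt : t < t') :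
    Disjoint
      (lastVisitEvent K k v t ∩ shift t ⁻¹' exitEvent (K \ v '' Set.Iio k) A (v k))
      (lastVisitEvent K k v t' ∩ shift t' ⁻¹' exitEvent (K \ v '' Set.Iio k) A (v k)) := by
  rw [Set.disjoint_left]
  rintro X ⟨⟨h1, -, τ, h3, -⟩, j, hj, hj'⟩ ⟨⟨-, h2', τ', h3', h4'⟩, -⟩
  have hfut : ∀ i, v k + walk (shift t X) i = walk X (t + i) := fun i => by
    rw [walk_add, h1]
  rw [hfut] at hj
  simp only [hfut] at hj'
  have hjK : walk X (t + j) ∉ K := fun h => Set.disjoint_left.1 hA hj h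
  obtain ⟨h5, h6, -, -⟩ := h4' (k - 1) (by omega)
  obtain ⟨a, ha⟩ := Nat.exists_eq_add_of_le (show t ≤ τ' (k - 1) by omega)
  rw [ha] at h6
  -- the exit from `K` comes after time `t' - 1`, so a visit to `v (k - 1)` at that time is avoided
  have haj : a < j := by
    by_contra! h
    rcases h.lt_or_eq with h | rfl
    · exact hjK (h2' (t + j) (by omega) (by omega))
    · exact hjK (h2' (t + j) (by omega) (by omega))
  exact (hj' a haj).2 ⟨k - 1, by simp; omega, h6.symm⟩

/-- Cut the walk just after its last visit to the last-but-one point of `ω`. What precedes does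
not see how the walk leaves `K`; what follows has to leave `K` without meeting `ω` again. -/
lemma exists_measure_lerwExitEvent [DiscreteTopology Λ] (p : PMF Λ) (hK : ball Λ l ⊆ K)
    (hk : 1 ≤ k) (hv0 : v 0 = 0) (hvB : ∀ i < k, v i ∈ ball Λ l) (hvk : v k ∉ ball Λ l) :
    ∃ W : ℝ, 0 ≤ W ∧ ∀ A, Disjoint A K →
      (stepsLaw p).real (lerwExitEvent l K A ((List.range (k + 1)).map v)) =
        W * hit p (K \ v '' Set.Iio k) A (v k) := by
  refine ⟨(∑' t, stepsLaw p (lastVisitEvent K k v t)).toReal, ENNReal.toReal_nonneg,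
    fun A hA => ?_⟩
  have hm := measurableSet_exitEvent (K \ v '' Set.Iio k) A (v k)
  have hdep := dependsOnFirst_lastVisitEvent K k v
  rw [lerwExitEvent_eq_iUnion hK hA hk hv0 hvB hvk, Measure.real, measure_iUnion]
  · simp_rw [stepsLaw_inter_shift p (hdep _) hm]
    rw [ENNReal.tsum_mul_right, ENNReal.toReal_mul]
    rfl
  · intro t t' htt
    rcases lt_or_gt_of_ne htt with h | h
    · exact disjoint_lastVisitEvent hA hk h
    · exact (disjoint_lastVisitEvent hA hk h).symm
  · exact fun t => (hdep t).measurableSet.inter (measurable_shift t hm)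

lemma exists_of_mem_pathsToBoundary {p : PMF Λ} {ω : List Λ} (hω : ω ∈ pathsToBoundary p l) :
    ∃ (k : ℕ) (v : ℕ → Λ), ω = (List.range (k + 1)).map v ∧ 1 ≤ l ∧ 1 ≤ k ∧ v 0 = 0 ∧
      (∀ i < k, v i ∈ ball Λ l) ∧ v k ∉ ball Λ l ∧ ∀ i < k, 0 < p (v (i + 1) - v i) := by
  obtain ⟨h1, h2, h3, y, h4, h5, x, hx, -⟩ := hω
  have hl : 1 ≤ l := by
    by_contra h
    obtain rfl : l = 0 := by omega
    have : ‖x‖ < ((0 : ℕ) : ℝ) := hx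
    rw [Nat.cast_zero] at this
    exact absurd this (not_lt.2 (norm_nonneg x))
  have h0B : (0 : Λ) ∈ ball Λ l := by
    change ‖(0 : Λ)‖ < l
    rw [norm_zero]
    exact_mod_cast hl
  have hlen : 0 < ω.length := by
    rw [List.length_pos_iff]
    rintro rfl
    simp at h1
  let v : ℕ → Λ := fun i => ω.getD i 0
  have hv : ∀ i (hi : i < ω.length), ω[i] = v i := fun i hi => by simp [v, hi]
  have hv0 : v 0 = 0 := by
    rw [List.head?_eq_getElem?, List.getElem?_eq_getElem hlen, hv] at h1
    exact Option.some_injective _ h1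
  have hvk : v (ω.length - 1) = y := by
    rw [List.getLast?_eq_getElem?, List.getElem?_eq_getElem (by omega), hv] at h4
    exact Option.some_injective _ h4
  refine ⟨ω.length - 1, v, ?_, hl, ?_, hv0, fun i hi => ?_, by rwa [hvk], fun i hi => ?_⟩
  · refine List.ext_getElem (by simp; omega) fun i hi hi' => ?_
    rw [hv i hi]
    simp
  · by_contra h
    rw [show ω.length - 1 = 0 by omega, hv0] at hvk
    exact h5 (hvk ▸ h0B)
  · have hi' : i < ω.dropLast.length := by simpa using hi
    have := h3 _ (List.getElem_mem hi')
    rwa [List.getElem_dropLast, hv] at this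
  · have := List.isChain_iff_getElem.1 h2 i (by omega)
    rwa [hv, hv] at this

lemma lerwExitEvent_compl (ω : List Λ) : lerwExitEvent l K Kᶜ ω = lerwEvent l K ω := by
  classical
  refine Set.inter_eq_left.2 fun X hX => ?_
  obtain ⟨m, hm, -⟩ := mem_lerwEvent_iff.1 hX
  exact ⟨m, hm, hm.2.1⟩

lemma lerwEvent_inter_leavesBefore {K₁ K₂ : Set Λ} (ω : List Λ) :
    leavesBefore K₁ K₂ ∩ lerwEvent l K₁ ω = lerwExitEvent l (K₁ ∩ K₂) (K₂ \ K₁) ω := by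
  classical
  ext X
  simp only [lerwExitEvent, Set.mem_inter_iff, mem_lerwEvent_iff, mem_leavesBefore_iff,
    Set.mem_ofPred_eq]
  constructor
  · rintro ⟨⟨m, h1, h2⟩, m', h1', h3⟩
    obtain rfl := h1.unique h1'
    obtain ⟨h4, h5⟩ := isExitTime_inter_iff.1 ⟨h1, h2⟩
    exact ⟨⟨m, h4, h3⟩, m, h4, h5⟩
  · rintro ⟨⟨m, h1, h2⟩, m', h1', h3⟩
    obtain rfl := h1.unique h1'
    obtain ⟨h4, h5⟩ := isExitTime_inter_iff.2 ⟨h1, h3⟩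
    exact ⟨⟨m, h4, h5⟩, m, h4, h2⟩

end LoopErasedWalk

end LatticeWalk

namespace LatticeWalk

section Comparison

variable {d : ℕ} {Λ : Submodule ℤ (EuclideanSpace ℝ (Fin d))} {p : PMF Λ}

/-! ### Comparison of the conditioned and the unconditioned law -/

lemma errorRate_pos {n : ℝ} (hn : 4 ≤ n) : 0 < errorRate d n := by
  have := Real.log_pos (show 1 < n by linarith)
  rw [errorRate]
  split_ifs <;> positivity

lemma errorRate_le_errorRate {n n' : ℝ} (hn : 4 ≤ n) (h : n ≤ n') :
    errorRate d n' ≤ errorRate d n := by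
  have := Real.log_pos (show 1 < n by linarith)
  rw [errorRate, errorRate]
  split_ifs <;> gcongr

lemma inv_mul_escapeRate_le {n : ℝ} (hn : 4 ≤ n) :
    1 / (n * escapeRate d n) ≤ 3 * errorRate d n := by
  have hn0 : 0 < n := by linarith
  have hlog := Real.log_pos (show 1 < n by linarith)
  rw [escapeRate, errorRate]
  split_ifs
  · have h1 : Real.log n ≤ 2 * √n := by
      have h := Real.log_le_sub_one_of_pos (Real.sqrt_pos.2 hn0)
      rw [Real.log_sqrt hn0.le] at h
      linarith
    have h2 : √2 ≤ 3 / 2 := by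
      rw [Real.sqrt_le_left (by norm_num)]
      norm_num
    have h3 : 0 < √n := Real.sqrt_pos.2 hn0
    have h4 : 1 / (n * (1 / √(2 * n))) = √2 / √n := by
      rw [Real.sqrt_mul (by norm_num)]
      field_simp
      rw [Real.sq_sqrt hn0.le]
    rw [h4, mul_one_div, div_le_div_iff₀ h3 hlog]
    have h5 : √2 * Real.log n ≤ 3 / 2 * (2 * √n) := by gcongr
    linarith
  · rw [mul_one_div, mul_one_div, one_div_div]
    gcongr
    norm_num

lemma errorRate_le_inv {c n : ℝ} (hc : 0 < c) (hn : Real.exp c ≤ n) :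
    errorRate d n ≤ 1 / c := by
  rw [errorRate]
  split_ifs
  · gcongr
    rwa [Real.le_log_iff_exp_le ((Real.exp_pos c).trans_le hn)]
  · gcongr
    linarith [Real.add_one_le_exp c]

namespace IsStepDistribution

variable (hp : IsStepDistribution p)
include hp

/-- Both laws are the same multiple of the probability of leaving `K₁ ∩ K₂` from the end `y` of
`ω` without meeting the rest `η` of `ω`: for the conditioned walk, the exit has moreover to be
in `K₂ \ K₁`, and one divides by the probability of such an exit from `0`. -/
lemma exists_condLerwMeasure_reduction [DiscreteTopology Λ] {l : ℕ} {K₁ K₂ : Set Λ}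
    (h₁ : ball Λ l ⊆ K₁) (h₂ : ball Λ l ⊆ K₂) (had : Admissible p K₁ K₂) {ω : List Λ}
    (hω : ω ∈ pathsToBoundary p l) :
    1 ≤ l ∧ hit p (K₁ ∩ K₂) (K₁ ∩ K₂)ᶜ 0 = 1 ∧
    ∃ (η : Finset Λ) (y : Λ), ↑η ⊆ ball Λ l ∧ 0 ∈ η ∧ y ∉ ball Λ l ∧
      (∃ x ∈ ball Λ l, ∃ s ∈ hp.steps, y = x + s) ∧ 0 < hit p (ball Λ l) {y} 0 ∧
      (∀ c : ℝ, hit p ((K₁ ∩ K₂) \ η) (K₂ \ K₁) y ≤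
          c * (hit p (K₁ ∩ K₂) (K₂ \ K₁) 0 * hit p ((K₁ ∩ K₂) \ η) (K₁ ∩ K₂)ᶜ y) →
        condLerwMeasure p l K₁ K₂ ω ≤ c * lerwMeasure p l (K₁ ∩ K₂) ω) ∧
      (∀ c : ℝ, hit p (K₁ ∩ K₂) (K₂ \ K₁) 0 * hit p ((K₁ ∩ K₂) \ η) (K₁ ∩ K₂)ᶜ y ≤
          c * hit p ((K₁ ∩ K₂) \ η) (K₂ \ K₁) y →
        lerwMeasure p l (K₁ ∩ K₂) ω ≤ c * condLerwMeasure p l K₁ K₂ ω) := by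
  classical
  obtain ⟨k, v, rfl, hl, hk, hv0, hvB, hvk, hstep⟩ := exists_of_mem_pathsToBoundary hω
  have h0B : (0 : Λ) ∈ ball Λ l := hv0 ▸ hvB 0 hk
  have h0 : (0 : Λ) ∈ K₁ ∩ K₂ := ⟨h₁ h0B, h₂ h0B⟩
  have hA : Disjoint (K₂ \ K₁) (K₁ ∩ K₂) := Set.disjoint_left.2 fun x hx hx' => hx.2 hx'.1
  have hK : ball Λ l ⊆ K₁ ∩ K₂ := Set.subset_inter h₁ h₂
  have hLB : leavesBefore K₁ K₂ = exitEvent (K₁ ∩ K₂) (K₂ \ K₁) 0 :=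
    leavesBefore_eq_exitEvent h0.1 h0.2
  have hLBm : MeasurableSet (leavesBefore K₁ K₂) := hLB ▸ measurableSet_exitEvent _ _ _
  have hLBp : (stepsLaw p).real (leavesBefore K₁ K₂) = hit p (K₁ ∩ K₂) (K₂ \ K₁) 0 := by
    rw [hLB]; rfl
  have hhpos : 0 < hit p (K₁ ∩ K₂) (K₂ \ K₁) 0 := by
    rw [← hLBp]
    exact ENNReal.toReal_pos had.2.ne' (measure_ne_top _ _)
  have hη : (((Finset.range k).image v : Finset Λ) : Set Λ) = v '' Set.Iio k := by
    rw [Finset.coe_image, Finset.coe_range]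
  obtain ⟨W, hW, hWA⟩ := exists_measure_lerwExitEvent p hK hk hv0 hvB hvk
  rw [← hη] at hWA
  have hmu := hWA _ disjoint_compl_left
  rw [lerwExitEvent_compl] at hmu
  have hcond : condLerwMeasure p l K₁ K₂ ((List.range (k + 1)).map v) =
      (hit p (K₁ ∩ K₂) (K₂ \ K₁) 0)⁻¹ *
        (W * hit p ((K₁ ∩ K₂) \ ((Finset.range k).image v : Finset Λ)) (K₂ \ K₁) (v k)) := by
    rw [condLerwMeasure, Measure.real, cond_apply hLBm, ENNReal.toReal_mul, ENNReal.toReal_inv,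
      ← Measure.real, ← Measure.real, lerwEvent_inter_leavesBefore, hWA _ hA, hLBp]
  refine ⟨hl, ?_, (Finset.range k).image v, v k, ?_, ?_, hvk, ?_, ?_, fun c hc => ?_,
    fun c hc => ?_⟩
  · have hae : ∀ᵐ X ∂stepsLaw p, X ∈ exitEvent (K₁ ∩ K₂) (K₁ ∩ K₂)ᶜ 0 := by
      have key : ∀ X : ℕ → Λ, (∃ j, 1 ≤ j ∧ walk X j ∉ K₁ ∩ K₂) →
          X ∈ exitEvent (K₁ ∩ K₂) (K₁ ∩ K₂)ᶜ 0 := fun X ⟨j, hj, hj'⟩ => by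
        obtain ⟨m, -, hm⟩ := exists_isExitTime hj hj'
        exact (mem_exitEvent_zero_iff h0 disjoint_compl_left).2 ⟨m, hm, hm.2.1⟩
      rcases had.1 with h | h <;> filter_upwards [h] with X hX
      · obtain ⟨m, hm⟩ := exitTime_lt_top_iff.1 hX
        exact key X ⟨m, hm.1, fun h => hm.2.1 h.1⟩
      · obtain ⟨m, hm⟩ := exitTime_lt_top_iff.1 hX
        exact key X ⟨m, hm.1, fun h => hm.2.1 h.2⟩
    rw [hit, Measure.real, (mem_ae_iff_prob_eq_one (measurableSet_exitEvent _ _ _)).1 hae]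
    rfl
  · rw [hη]
    rintro _ ⟨i, hi, rfl⟩
    exact hvB i hi
  · exact Finset.mem_image.2 ⟨0, Finset.mem_range.2 hk, hv0⟩
  · refine ⟨v (k - 1), hvB _ (by omega), v k - v (k - 1), ?_, by abel⟩
    have := hstep (k - 1) (by omega)
    rw [show k - 1 + 1 = k by omega] at this
    exact hp.mem_steps_iff_pos.2 this
  · refine hp.hit_pos_of_reflTransGen (Set.disjoint_singleton_left.2 hvk) (v := v k) ?_ rfl
    have : ∀ i ≤ k, Relation.ReflTransGen
        (fun x y => x ∈ ball Λ l ∪ {v k} ∧ y - x ∈ hp.steps) 0 (v i) := fun i => by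
      induction i with
      | zero => intro _; rw [hv0]
      | succ i ih =>
        exact fun hi => (ih (by omega)).tail
          ⟨Or.inl (hvB i hi), hp.mem_steps_iff_pos.2 (hstep i hi)⟩
    exact this k le_rfl
  · rw [hcond, lerwMeasure, hmu, inv_mul_eq_div, div_le_iff₀ hhpos]
    nlinarith [mul_le_mul_of_nonneg_left hc hW]
  · rw [hcond, lerwMeasure, hmu, inv_mul_eq_div, mul_div_assoc', le_div_iff₀ hhpos]
    nlinarith [mul_le_mul_of_nonneg_left hc hW]

variable [DiscreteTopology Λ] [IsZLattice ℝ Λ]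

/-- The upper bound up to a constant, at all scales. Small scales are handled by the case
distinction whether `K` contains a large ball. -/
lemma exists_escape_le (hd : 2 ≤ d) : ∃ C : ℝ, 0 < C ∧ ∀ (l : ℕ) (K A : Set Λ), 1 ≤ l →
    ball Λ (4 * l) ⊆ K → Disjoint A K → hit p K Kᶜ 0 = 1 → ∀ η : Finset Λ, ↑η ⊆ ball Λ l →
    (0 : Λ) ∈ η → ∀ y ∉ ball Λ l, (∃ x ∈ ball Λ l, ∃ s ∈ hp.steps, y = x + s) →
    0 < hit p (ball Λ l) {y} 0 →
    hit p (K \ η) A y ≤ C * (hit p K A 0 * hit p (K \ η) Kᶜ y) := by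
  obtain ⟨C₁, n₀, hC₁, hn₀, hlarge⟩ := hp.exists_escape_comparable_of_large hd
  obtain ⟨C₂, l₀, hC₂, -, hscale⟩ := hp.exists_escape_comparable_of_scale hd
  obtain ⟨R, hR1, hR⟩ := hp.exists_bound
  choose C₃ hC₃ hsmall using fun l : ℕ => hp.exists_escape_le_of_missing hd l (n₀ * l + R)
  obtain ⟨L, hL⟩ := exists_nat_ge l₀
  set C₄ := (1 + C₁ / (n₀ * escapeRate d n₀)) ^ 6 with hC₄
  have hC₄0 : 0 ≤ C₄ := by rw [hC₄]; positivity
  have hsum0 : 0 ≤ ∑ l ∈ Finset.range L, C₃ l := Finset.sum_nonneg fun l _ => (hC₃ l).le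
  refine ⟨C₂ + C₄ + ∑ l ∈ Finset.range L, C₃ l, by positivity, ?_⟩
  intro l K A hl hK hA h1 η hη h0 y hy hyx hpos
  have hl1 : (1 : ℝ) ≤ l := by exact_mod_cast hl
  have hyη : y ∉ η := fun h => hy (hη h)
  have hX : 0 ≤ hit p K A 0 * hit p (K \ η) Kᶜ y :=
    mul_nonneg (hit_nonneg p _ _ _) (hit_nonneg p _ _ _)
  have hmono : ∀ r r' : ℝ, r ≤ r' → ball Λ r ⊆ ball Λ r' := fun r r' h x hx =>
    lt_of_lt_of_le hx h
  have hle : ∀ c, hit p (K \ η) A y ≤ c * (hit p K A 0 * hit p (K \ η) Kᶜ y) →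
      c ≤ C₂ + C₄ + ∑ l ∈ Finset.range L, C₃ l → hit p (K \ η) A y ≤
        (C₂ + C₄ + ∑ l ∈ Finset.range L, C₃ l) * (hit p K A 0 * hit p (K \ η) Kᶜ y) :=
    fun c h h' => h.trans (by gcongr)
  rcases le_or_gt l₀ l with hll | hll
  · exact hle C₂ (hscale l K A hll hK hA h1 η hη h0 y hyη hyx).1 (by linarith)
  · by_cases hbig : ball Λ (n₀ * l) ⊆ K
    · exact hle C₄ (hlarge l n₀ K A hl1 le_rfl hbig hA h1 η hη h0 y hyη hyx).1 (by linarith)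
    · obtain ⟨z, hz, hzK⟩ := Set.not_subset.1 hbig
      refine hle (C₃ l) (hsmall l K A ((hmono _ _ (by linarith)).trans hK) hA
        ⟨z, hmono _ _ (by linarith) hz, hzK⟩ η hη y hy ?_ hpos) ?_
      · obtain ⟨x, hx, s, hs, rfl⟩ := hyx
        have h2 : ‖x‖ < l := hx
        have h3 := norm_add_le x s
        have h4 := hR s hs
        change ‖x + s‖ < n₀ * l + R
        nlinarith
      · have : l ∈ Finset.range L := Finset.mem_range.2 (by exact_mod_cast hll.trans_le hL)
        have := Finset.single_le_sum (f := C₃) (fun i _ => (hC₃ i).le) this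
        linarith

end IsStepDistribution

end Comparison

end LatticeWalk
theorem mainTheorem9 (d : ℕ) (hd : 2 ≤ d)
    (Λ : Submodule ℤ (EuclideanSpace ℝ (Fin d))) [DiscreteTopology Λ] [IsZLattice ℝ Λ]
    (p : PMF Λ) (hp : LatticeWalk.IsStepDistribution p) :
    (∃ C : ℝ, 0 < C ∧ ∀ (l : ℕ) (n : ℝ) (K₁ K₂ : Set Λ), 4 ≤ n →
      LatticeWalk.ball Λ (n * l) ⊆ K₁ → LatticeWalk.ball Λ (n * l) ⊆ K₂ →
      LatticeWalk.Admissible p K₁ K₂ →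
      ∀ ω ∈ LatticeWalk.pathsToBoundary p l,
        (1 - C * LatticeWalk.errorRate d n) * LatticeWalk.lerwMeasure p l (K₁ ∩ K₂) ω ≤
            LatticeWalk.condLerwMeasure p l K₁ K₂ ω ∧
          LatticeWalk.condLerwMeasure p l K₁ K₂ ω ≤
            (1 + C * LatticeWalk.errorRate d n) * LatticeWalk.lerwMeasure p l (K₁ ∩ K₂) ω) ∧
    (∃ (C : ℝ) (l₀ : ℕ), 0 < C ∧ ∀ (l : ℕ) (K₁ K₂ : Set Λ), l₀ ≤ l →
      LatticeWalk.ball Λ (4 * l) ⊆ K₁ → LatticeWalk.ball Λ (4 * l) ⊆ K₂ →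
      LatticeWalk.Admissible p K₁ K₂ →
      ∀ ω ∈ LatticeWalk.pathsToBoundary p l,
        1 / C * LatticeWalk.lerwMeasure p l (K₁ ∩ K₂) ω ≤
            LatticeWalk.condLerwMeasure p l K₁ K₂ ω ∧
          LatticeWalk.condLerwMeasure p l K₁ K₂ ω ≤
            C * LatticeWalk.lerwMeasure p l (K₁ ∩ K₂) ω) := by
  obtain ⟨C₁, n₀, hC₁, hn₀, hlarge⟩ := hp.exists_escape_comparable_of_large hd
  obtain ⟨C₂, l₀, hC₂, -, hscale⟩ := hp.exists_escape_comparable_of_scale hd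
  obtain ⟨C₃, hC₃, hupper⟩ := hp.exists_escape_le hd
  have hmono : ∀ r r' : ℝ, r ≤ r' → LatticeWalk.ball Λ r ⊆ LatticeWalk.ball Λ r' :=
    fun r r' h x hx => lt_of_lt_of_le hx h
  have hdisj : ∀ K₁ K₂ : Set Λ, Disjoint (K₂ \ K₁) (K₁ ∩ K₂) := fun K₁ K₂ =>
    Set.disjoint_left.2 fun x hx hx' => hx.2 hx'.1
  have hmu : ∀ l K ω, 0 ≤ LatticeWalk.lerwMeasure p l K ω := fun _ _ _ => measureReal_nonneg
  have hcond : ∀ l K₁ K₂ ω, 0 ≤ LatticeWalk.condLerwMeasure p l K₁ K₂ ω :=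
    fun _ _ _ _ => measureReal_nonneg
  refine ⟨?_, C₂, ⌈l₀⌉₊, hC₂, fun l K₁ K₂ hl h₁ h₂ had ω hω => ?_⟩
  · -- for `n` at least `n₁`, the factor `(1 + C₁ / (n * escapeRate d n)) ^ 6` is at most
    -- `1 + 63 * c * errorRate d n`
    -- for `n` smaller than `n₁`, the second summand of the constant makes the lower bound trivial
    -- and reduces the upper bound to the one with some constant `C₃`
    set c := 3 * C₁ with hc
    have hc0 : 0 < c := by positivity
    set n₁ := max n₀ (Real.exp c) with hn₁
    have hn₁4 : 4 ≤ n₁ := hn₀.trans (le_max_left _ _)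
    have he₁ := LatticeWalk.errorRate_pos (d := d) hn₁4
    refine ⟨63 * c + (1 + C₃) / LatticeWalk.errorRate d n₁, by positivity, ?_⟩
    intro l n K₁ K₂ hn h₁ h₂ had ω hω
    have hl0 : (0 : ℝ) ≤ l := Nat.cast_nonneg l
    have hb : LatticeWalk.ball Λ l ⊆ LatticeWalk.ball Λ (n * l) := hmono _ _ (by nlinarith)
    have hb4 : LatticeWalk.ball Λ (4 * l) ⊆ LatticeWalk.ball Λ (n * l) :=
      hmono _ _ (by gcongr)
    obtain ⟨hl, hK1, η, y, hη, h0, hy, hyx, hpos, hup, hlow⟩ :=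
      hp.exists_condLerwMeasure_reduction (hb.trans h₁) (hb.trans h₂) had hω
    have hl1 : (1 : ℝ) ≤ l := by exact_mod_cast hl
    have hμ := hmu l (K₁ ∩ K₂) ω
    have hν := hcond l K₁ K₂ ω
    have he := LatticeWalk.errorRate_pos (d := d) hn
    rcases le_or_gt n₁ n with hnn | hnn
    · obtain ⟨hA, hB⟩ := hlarge l n (K₁ ∩ K₂) (K₂ \ K₁) hl1 ((le_max_left _ _).trans hnn)
        (Set.subset_inter h₁ h₂) (hdisj K₁ K₂) hK1 η hη h0 y (fun h => hy (hη h)) hyx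
      set x := c * LatticeWalk.errorRate d n with hx
      have hx0 : 0 ≤ x := by positivity
      have hx1 : x ≤ 1 := by
        have := LatticeWalk.errorRate_le_inv (d := d) hc0 ((le_max_right _ _).trans hnn)
        calc x ≤ c * (1 / c) := by rw [hx]; gcongr
          _ = 1 := by field_simp
      have hE0 : 0 ≤ C₁ / (n * LatticeWalk.escapeRate d n) := by
        have : 0 < LatticeWalk.escapeRate d n := by
          have : 0 < n := by linarith
          rw [LatticeWalk.escapeRate]; split_ifs <;> positivity
        have : 0 < n := by linarith
        positivity
      have hEx : C₁ / (n * LatticeWalk.escapeRate d n) ≤ x := by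
        rw [← mul_one_div, hx, hc]
        calc _ ≤ C₁ * (3 * LatticeWalk.errorRate d n) := by
              gcongr; exact LatticeWalk.inv_mul_escapeRate_le hn
          _ = _ := by ring
      have hpow : (1 + C₁ / (n * LatticeWalk.escapeRate d n)) ^ 6 ≤ 1 + 63 * x := by
        calc _ ≤ (1 + x) ^ 6 := by gcongr
          _ = 1 + x * (6 + 15 * x + 20 * x ^ 2 + 15 * x ^ 3 + 6 * x ^ 4 + x ^ 5) := by ring
          _ ≤ 1 + x * (6 + 15 * 1 + 20 * 1 ^ 2 + 15 * 1 ^ 3 + 6 * 1 ^ 4 + 1 ^ 5) := by gcongr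
          _ = _ := by ring
      have hup' := hup _ hA
      have hlow' := hlow _ hB
      have hCx : 63 * x ≤ (63 * c + (1 + C₃) / LatticeWalk.errorRate d n₁) *
          LatticeWalk.errorRate d n := by
        have : 0 ≤ (1 + C₃) / LatticeWalk.errorRate d n₁ * LatticeWalk.errorRate d n := by
          positivity
        rw [hx, add_mul]
        linarith
      refine ⟨?_, ?_⟩
      · have h3 : (1 - 63 * x) * LatticeWalk.lerwMeasure p l (K₁ ∩ K₂) ω ≤
            LatticeWalk.condLerwMeasure p l K₁ K₂ ω := by
          rcases le_or_gt (63 * x) 1 with h | h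
          · have h4 : LatticeWalk.lerwMeasure p l (K₁ ∩ K₂) ω ≤
                (1 + 63 * x) * LatticeWalk.condLerwMeasure p l K₁ K₂ ω :=
              hlow'.trans (by gcongr)
            have h5 := mul_le_mul_of_nonneg_left h4 (sub_nonneg.2 h)
            nlinarith [mul_nonneg (sq_nonneg x) hν]
          · nlinarith
        refine le_trans ?_ h3
        gcongr
      · refine hup'.trans ?_
        gcongr
        linarith
    · have hbig : 1 + C₃ ≤ (63 * c + (1 + C₃) / LatticeWalk.errorRate d n₁) *
          LatticeWalk.errorRate d n := by
        have h1 := LatticeWalk.errorRate_le_errorRate (d := d) hn hnn.le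
        have h2 : (1 + C₃) / LatticeWalk.errorRate d n₁ * LatticeWalk.errorRate d n₁ = 1 + C₃ :=
          div_mul_cancel₀ _ he₁.ne'
        have h3 : (1 + C₃) / LatticeWalk.errorRate d n₁ * LatticeWalk.errorRate d n₁ ≤
            (1 + C₃) / LatticeWalk.errorRate d n₁ * LatticeWalk.errorRate d n := by gcongr
        have h4 : 0 ≤ 63 * c * LatticeWalk.errorRate d n := by positivity
        rw [add_mul]
        linarith
      refine ⟨?_, ?_⟩
      · nlinarith
      · refine (hup _ (hupper l (K₁ ∩ K₂) (K₂ \ K₁) hl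
          (hb4.trans (Set.subset_inter h₁ h₂)) (hdisj K₁ K₂) hK1 η hη h0 y hy hyx hpos)).trans ?_
        gcongr
        linarith
  · have hl0 : (0 : ℝ) ≤ l := Nat.cast_nonneg l
    have hb : LatticeWalk.ball Λ l ⊆ LatticeWalk.ball Λ (4 * l) := hmono _ _ (by linarith)
    obtain ⟨-, hK1, η, y, hη, h0, hy, hyx, -, hup, hlow⟩ :=
      hp.exists_condLerwMeasure_reduction (hb.trans h₁) (hb.trans h₂) had hω
    obtain ⟨hA, hB⟩ := hscale l (K₁ ∩ K₂) (K₂ \ K₁) (Nat.ceil_le.1 hl)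
      (Set.subset_inter h₁ h₂) (hdisj K₁ K₂) hK1 η hη h0 y (fun h => hy (hη h)) hyx
    refine ⟨?_, hup _ hA⟩
    rw [one_div, inv_mul_le_iff₀ hC₂]
    exact hlow _ hB
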